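/- Let $(M,g)$ be an $n$-dimensional Riemannian spin manifold, $n\ge 3$, with spinor bundle $\Sigma$ (associated to a spin structure by the complex spin representation, i.e. an irreducible Hermitian module over the complex Clifford algebra), fundamental tensor-spinor (Clifford multiplication) $\gamma$ with $\gamma^\alpha\gamma^\beta+\gamma^\beta\gamma^\alpha=-2g^{\alpha\beta}$, Levi-Civita connection $\nabla$, and the connection induced by it on tensor-spinors, also written $\nabla$. Let $T\subset T^*M\otimes\Sigma$ be the twistor bundle, defined by $\gamma^\alpha\varphi_\alpha=0$. For $\Phi$ in $T^*M\otimes T$ (that is, $\gamma^\beta\Phi_{\alpha\beta}=0$) put $$(P_\Sigma\Phi)_{\alpha\beta}=-\tfrac{1}{2(n-1)}\Big\{\gamma_\alpha\gamma_\beta+\tfrac{n-2}{n}\gamma_\beta\gamma_\alpha\Big\}\Phi^\lambda{}_\lambda,$$ $$(P_T\Phi)_{\alpha\beta}=\tfrac{1}{(n+2)(n-2)}\Big\{-n\gamma_\alpha\gamma^\lambda\Phi_{\lambda\beta}+2\gamma_\beta\gamma^\lambda\Phi_{\lambda\alpha}+2\gamma_\alpha\gamma_\beta\Phi^\lambda{}_\lambda-\tfrac4n\gamma_\beta\gamma_\alpha\Phi^\lambda{}_\lambda\Big\},$$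 $$(P_Y\Phi)_{\alpha\beta}=\tfrac12\{\Phi_{\alpha\beta}-\Phi_{\beta\alpha}\}+\tfrac{1}{2(n-2)}\{\gamma_\alpha\gamma^\lambda\Phi_{\lambda\beta}-\gamma_\beta\gamma^\lambda\Phi_{\lambda\alpha}\}-\tfrac{1}{2(n-1)(n-2)}\{\gamma_\alpha\gamma_\beta-\gamma_\beta\gamma_\alpha\}\Phi^\lambda{}_\lambda,$$ $$(P_Z\Phi)_{\alpha\beta}=\tfrac12\{\Phi_{\alpha\beta}+\Phi_{\beta\alpha}\}+\tfrac{1}{2(n+2)}\{\gamma_\alpha\gamma^\lambda\Phi_{\lambda\beta}+\gamma_\beta\gamma^\lambda\Phi_{\lambda\alpha}-2g_{\alpha\beta}\Phi^\lambda{}_\lambda\}$$ (the complementary orthogonal projections of $T^*M\otimes T$ onto its copies of $\Sigma$ and $T$, onto $Y=(\Lambda^2\otimes\Sigma)\cap(T^*M\otimes T)$ and onto $Z=(\mathrm{TFS}^2\otimes\Sigma)\cap(T^*M\otimes T)$, where $\mathrm{TFS}^2$ is the bundle of trace-free symmetric $2$-tensors). For $u\in\{\Sigma,T,Y,Z\}$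 let $G_u\varphi=P_u(\nabla\varphi)$ for smooth sections $\varphi$ of $T$, and $G_u^*\Phi=\nabla^*(P_u\Phi)$ for smooth sections $\Phi$ of $T^*M\otimes T$, where $(\nabla^*\Phi)_\beta=-\nabla^\alpha\Phi_{\alpha\beta}$. Let $R$ be the Riemann tensor, $[\nabla_\alpha,\nabla_\beta]X^\lambda=R^\lambda{}_{\mu\alpha\beta}X^\mu$, let $r_{\mu\beta}=R^\alpha{}_{\mu\alpha\beta}$ be the Ricci tensor, $K=r^\beta{}_\beta$ the scalar curvature, $b=r-\frac Kn g$ the trace-free Ricci tensor, and $C$ the Weyl tensor (the totally trace-free part of $R$). For a section $\varphi$ of $T$ put $$(b\cdot\varphi)_\mu=\tfrac1n\big((n-2)b_{\mu\lambda}\varphi^\lambda-b_{\alpha\lambda}\gamma^\alpha\gamma_\mu\varphi^\lambda\big),\qquad (C\diamond\varphi)_\mu=C_{\alpha\beta}{}^\lambda{}_\mu\gamma^\alpha\gamma^\beta\varphi_\lambda .$$ Then each $G_u^*$ is the formal adjoint of $G_u$: it takes values in $T$, and for all smooth sections $\varphi$ of $T$ and $\Phi$ of $T^*M\otimes T$ there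 is a smooth vector field $X$, vanishing at every point where $\varphi$ or $\Phi$ vanishes, with $\mathrm{Re}\,\langle G_u\varphi,\Phi\rangle-\mathrm{Re}\,\langle\varphi,G_u^*\Phi\rangle=\nabla^\alpha X_\alpha$. Moreover, on all smooth sections of $T$, $$Z_1:=\frac{(n-3)(n-2)}{2n}G_\Sigma^*G_\Sigma-\frac{(n+2)(n-3)}{2n}G_T^*G_T+G_Y^*G_Y=\frac18\,C\diamond+\frac{n-3}{2(n-2)}\,b\cdot-\frac{(n-2)(n-3)}{8n(n-1)}\,K,$$ $$Z_2:=-\frac{(n-1)(n+2)}{2n}G_\Sigma^*G_\Sigma-\frac{(n+1)(n-2)}{2n}G_T^*G_T+G_Z^*G_Z=\frac38\,C\diamond-\frac{n+1}{2(n-2)}\,b\cdot-\frac{(n+2)(n+1)}{8n(n-1)}\,K.$$ -/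

import Mathlib

open Bundle FiberBundle VectorField
open scoped Manifold ContDiff

namespace SpinGeom

noncomputable section

/-! ### Spinor modules -/

/-- The form `v ↦ -|v|²` on `ℝⁿ`; its Clifford algebra has the relations
`e_a e_b + e_b e_a = -2 δ_ab`. -/
abbrev negForm (n : ℕ) : QuadraticForm ℝ (Fin n → ℝ) :=
  QuadraticMap.weightedSumSquares ℝ (fun _ : Fin n => (-1 : ℝ))

/-- The generator `e_a` of the Clifford algebra of `negForm n`. -/
def cliffordGen (n : ℕ) (a : Fin n) : CliffordAlgebra (negForm n) :=
  CliffordAlgebra.ι (negForm n) (Pi.single a 1)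

/-- A spinor module: an irreducible complex module `Δ` over the Clifford algebra, with a Hermitian
inner product for which vectors act by skew-adjoint maps. Restricted to `spinGroup (negForm n)`,
which is `Spin(n)`, it is the (unitary) spin representation. -/
structure SpinorModule (n : ℕ) (Δ : Type*) [NormedAddCommGroup Δ] [InnerProductSpace ℂ Δ] where
  rho : CliffordAlgebra (negForm n) →ₐ[ℝ] Module.End ℂ Δ
  skew : ∀ (v : Fin n → ℝ) (ψ χ : Δ),
    inner ℂ (rho (CliffordAlgebra.ι (negForm n) v) ψ) χ
      = -inner ℂ ψ (rho (CliffordAlgebra.ι (negForm n) v) χ)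
  nontrivial : Nontrivial Δ
  irreducible : ∀ W : Submodule ℂ Δ,
    (∀ v : Fin n → ℝ, ∀ ψ ∈ W, rho (CliffordAlgebra.ι (negForm n) v) ψ ∈ W) → W = ⊥ ∨ W = ⊤

variable {n : ℕ}
  {M : Type*} [TopologicalSpace M] [ChartedSpace (EuclideanSpace ℝ (Fin n)) M]
  [IsManifold (𝓡 n) ∞ M]
  [RiemannianBundle (fun x : M => TangentSpace (𝓡 n) x)]
  {Δ : Type*} [NormedAddCommGroup Δ] [InnerProductSpace ℂ Δ]
  {S : M → Type*} [∀ x, NormedAddCommGroup (S x)] [∀ x, InnerProductSpace ℂ (S x)]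

/-! ### Spin structures and the spinor bundle -/

/-- A local spin frame of the bundle `S`, over an open set `dom`: a smooth orthonormal frame `vec`
of the tangent bundle, together with a smooth family `spin` of unitary isomorphisms from the spinor
module to the fibres of `S`. Nothing is required outside `dom`. -/
structure SpinFrame (n : ℕ) (M : Type*) [TopologicalSpace M]
    [ChartedSpace (EuclideanSpace ℝ (Fin n)) M] [IsManifold (𝓡 n) ∞ M]
    [RiemannianBundle (fun x : M => TangentSpace (𝓡 n) x)]
    (Δ : Type*) [NormedAddCommGroup Δ] [InnerProductSpace ℂ Δ]
    (S : M → Type*) [∀ x, NormedAddCommGroup (S x)] [∀ x, InnerProductSpace ℂ (S x)]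
    [TopologicalSpace (TotalSpace Δ S)] [FiberBundle Δ S] where
  dom : Set M
  isOpen_dom : IsOpen dom
  vec : Fin n → (x : M) → TangentSpace (𝓡 n) x
  spin : (x : M) → Δ ≃ₗᵢ[ℂ] S x
  orthonormal_vec : ∀ x ∈ dom, Orthonormal ℝ (fun a => vec a x)
  smooth_vec : ∀ a, ContMDiffOn (𝓡 n) ((𝓡 n).prod 𝓘(ℝ, EuclideanSpace ℝ (Fin n))) ∞
    (fun x => TotalSpace.mk' (EuclideanSpace ℝ (Fin n)) x (vec a x)) dom
  smooth_spin : ∀ ψ : Δ, ContMDiffOn (𝓡 n) ((𝓡 n).prod 𝓘(ℝ, Δ)) ∞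
    (fun x => TotalSpace.mk' Δ x (spin x ψ)) dom

/-- A spin structure on `M` with `S` as its spinor bundle. It is given by an atlas of local spin
frames covering `M`, any two of which differ by an element of `Spin(n)` at each common point; so
the spin frames of the atlas span a principal `Spin(n)`-bundle, to which `S` is associated by the
spin representation. The field `gam` is the fundamental tensor-spinor (Clifford multiplication);
in a spin frame it is the model Clifford multiplication. -/
structure SpinStructure (ρ : SpinorModule n Δ)
    (S : M → Type*) [∀ x, NormedAddCommGroup (S x)] [∀ x, InnerProductSpace ℂ (S x)]
    [TopologicalSpace (TotalSpace Δ S)] [FiberBundle Δ S] where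
  gam : (x : M) → TangentSpace (𝓡 n) x →ₗ[ℝ] Module.End ℂ (S x)
  atlas : Set (SpinFrame n M Δ S)
  cover : ∀ x : M, ∃ f ∈ atlas, x ∈ f.dom
  gam_frame : ∀ f ∈ atlas, ∀ x ∈ f.dom, ∀ (a : Fin n) (ψ : Δ),
    gam x (f.vec a x) (f.spin x ψ) = f.spin x (ρ.rho (cliffordGen n a) ψ)
  transition : ∀ f ∈ atlas, ∀ f' ∈ atlas, ∀ x ∈ f.dom ∩ f'.dom,
    ∃ g ∈ spinGroup (negForm n), ∀ ψ : Δ, f'.spin x ψ = f.spin x (ρ.rho g ψ)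

/-! ### Connections -/

set_option synthInstance.maxHeartbeats 200000 in
/-- The Levi-Civita connection: smooth, torsion-free and metric. -/
structure IsLeviCivita
    [IsContMDiffRiemannianBundle (𝓡 n) ∞ (EuclideanSpace ℝ (Fin n))
      (fun x : M => TangentSpace (𝓡 n) x)]
    (cov : CovariantDerivative (𝓡 n) (EuclideanSpace ℝ (Fin n))
      (fun x : M => TangentSpace (𝓡 n) x)) : Prop where
  smooth : cov.ContMDiffCovariantDerivative ∞
  torsion_eq_zero : cov.torsion = 0
  metric : cov.IsMetricCompatible

section Operators

variable [TopologicalSpace (TotalSpace Δ S)] [FiberBundle Δ S]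

/-- The spin connection: the connection on `S` induced by the connection `covT` on the tangent
bundle. In every spin frame of the spin structure, with frame `(e_a)`, the derivative of a spinor
field `ψ` with constant components is `∇_u ψ = (1/4) ∑_{a,b} ⟨∇_u e_a, e_b⟩ γ(e_a) γ(e_b) ψ`. -/
def IsSpinConnection {ρ : SpinorModule n Δ} (σ : SpinStructure (M := M) ρ S)
    (covT : CovariantDerivative (𝓡 n) (EuclideanSpace ℝ (Fin n))
      (fun x : M => TangentSpace (𝓡 n) x))
    (covS : CovariantDerivative (𝓡 n) Δ S) : Prop :=
  ∀ f ∈ σ.atlas, ∀ x ∈ f.dom, ∀ (u : TangentSpace (𝓡 n) x) (ψ : Δ),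
    covS (fun y => f.spin y ψ) x u =
      (1 / 4 : ℝ) • ∑ a, ∑ b, (inner ℝ (covT (f.vec a) x u) (f.vec b x) : ℝ) •
        σ.gam x (f.vec a x) (σ.gam x (f.vec b x) (f.spin x ψ))

/-! ### Contractions and covariant derivatives of tensor-spinors

A field of spinor-valued `1`-forms is written `φ x u` and a field of spinor-valued `2`-tensors
`Φ x u v`, where `u` and `v` are tangent vectors at `x`. -/

instance finiteDimensional_tangentSpace (x : M) : FiniteDimensional ℝ (TangentSpace (𝓡 n) x) :=
  inferInstanceAs (FiniteDimensional ℝ (EuclideanSpace ℝ (Fin n)))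

/-- An orthonormal basis of the tangent space, used to write contractions. -/
def onb (x : M) : OrthonormalBasis (Fin (Module.finrank ℝ (TangentSpace (𝓡 n) x))) ℝ
    (TangentSpace (𝓡 n) x) :=
  stdOrthonormalBasis ℝ (TangentSpace (𝓡 n) x)

/-- Contraction of a bilinear expression with the metric. -/
def contr {V : Type*} [AddCommGroup V] (x : M)
    (B : TangentSpace (𝓡 n) x → TangentSpace (𝓡 n) x → V) : V :=
  ∑ i, B (onb x i) (onb x i)

variable
    (covT : CovariantDerivative (𝓡 n) (EuclideanSpace ℝ (Fin n))
      (fun x : M => TangentSpace (𝓡 n) x))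
    (covS : CovariantDerivative (𝓡 n) Δ S)

/-- `(∇φ)(u, v) = ∇_u (φ(V)) - φ(∇_u V)`, where `V` is a local extension of `v`;
in indices `∇_α φ_β`, with `u` in the slot `α` and `v` in the slot `β`. -/
def nablaOne (φ : (x : M) → TangentSpace (𝓡 n) x → S x) (x : M)
    (u v : TangentSpace (𝓡 n) x) : S x :=
  covS (fun y => φ y (extend (EuclideanSpace ℝ (Fin n)) v y)) x u
    - φ x (covT (extend (EuclideanSpace ℝ (Fin n)) v) x u)

/-- `(∇Φ)(w, u, v) = ∇_w (Φ(U, V)) - Φ(∇_w U, V) - Φ(U, ∇_w V)`, where `U` and `V` are local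
extensions of `u` and `v`; in indices `∇_λ Φ_αβ`. -/
def nablaTwo (Φ : (x : M) → TangentSpace (𝓡 n) x → TangentSpace (𝓡 n) x → S x) (x : M)
    (w u v : TangentSpace (𝓡 n) x) : S x :=
  covS (fun y => Φ y (extend (EuclideanSpace ℝ (Fin n)) u y)
      (extend (EuclideanSpace ℝ (Fin n)) v y)) x w
    - Φ x (covT (extend (EuclideanSpace ℝ (Fin n)) u) x w) v
    - Φ x u (covT (extend (EuclideanSpace ℝ (Fin n)) v) x w)

/-- `(∇*Φ)_β = -∇^α Φ_αβ`. -/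
def nablaStar (Φ : (x : M) → TangentSpace (𝓡 n) x → TangentSpace (𝓡 n) x → S x) (x : M)
    (v : TangentSpace (𝓡 n) x) : S x :=
  -contr x (fun u w => nablaTwo covT covS Φ x u w v)

/-- The divergence `∇^α X_α` of a vector field. -/
def divergence (X : (x : M) → TangentSpace (𝓡 n) x) (x : M) : ℝ :=
  contr x (fun u v => (inner ℝ (covT X x u) v : ℝ))

/-! ### Curvature -/

/-- `R(u, v) w = [∇_u, ∇_v] w`, in indices `R^λ_{μαβ}` with `w` in `μ`, `u` in `α`, `v` in `β`. -/
def curv (x : M) (u v w : TangentSpace (𝓡 n) x) : TangentSpace (𝓡 n) x :=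
  letI U := extend (EuclideanSpace ℝ (Fin n)) u
  letI V := extend (EuclideanSpace ℝ (Fin n)) v
  letI W := extend (EuclideanSpace ℝ (Fin n)) w
  covT (fun y => covT W y (V y)) x u - covT (fun y => covT W y (U y)) x v
    - covT W x (mlieBracket (𝓡 n) U V x)

/-- The Ricci tensor `r_{μβ} = R^α_{μαβ}`. -/
def ricci (x : M) (w v : TangentSpace (𝓡 n) x) : ℝ :=
  contr x (fun u u' => (inner ℝ (curv covT x u v w) u' : ℝ))

/-- The scalar curvature `K`. -/
def scal (x : M) : ℝ := contr x (ricci covT x)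

/-- The Einstein (trace-free Ricci) tensor `b = r - (K/n) g`. -/
def einstein (x : M) (u v : TangentSpace (𝓡 n) x) : ℝ :=
  ricci covT x u v - scal covT x / n * inner ℝ u v

/-- The Schouten tensor `V = (r - J g)/(n - 2)`, where `J = K/(2(n - 1))`. -/
def schouten (x : M) (u v : TangentSpace (𝓡 n) x) : ℝ :=
  (ricci covT x u v - scal covT x / (2 * (n - 1)) * inner ℝ u v) / (n - 2)

/-- The Weyl tensor `C_{αβκλ}`, the totally trace-free part of `R_{αβκλ}`. -/
def weyl (x : M) (a b k l : TangentSpace (𝓡 n) x) : ℝ :=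
  inner ℝ (curv covT x k l b) a
    + schouten covT x b k * inner ℝ a l - schouten covT x b l * inner ℝ a k
    + schouten covT x a l * inner ℝ b k - schouten covT x a k * inner ℝ b l

/-! ### Twistors and the gradients -/

/-- Sections of `T*M ⊗ Σ` that are smooth. -/
def IsSmoothOne (Δ : Type*) [NormedAddCommGroup Δ] [InnerProductSpace ℂ Δ]
    [TopologicalSpace (TotalSpace Δ S)] [FiberBundle Δ S] [VectorBundle ℝ Δ S]
    (φ : (x : M) → TangentSpace (𝓡 n) x →L[ℝ] S x) : Prop :=
  ContMDiff (𝓡 n) ((𝓡 n).prod 𝓘(ℝ, EuclideanSpace ℝ (Fin n) →L[ℝ] Δ)) ∞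
    (fun x => TotalSpace.mk' (EuclideanSpace ℝ (Fin n) →L[ℝ] Δ)
      (E := fun x : M => TangentSpace (𝓡 n) x →L[ℝ] S x) x (φ x))

/-- Sections of `T*M ⊗ T*M ⊗ Σ` that are smooth. -/
def IsSmoothTwo (Δ : Type*) [NormedAddCommGroup Δ] [InnerProductSpace ℂ Δ]
    [TopologicalSpace (TotalSpace Δ S)] [FiberBundle Δ S] [VectorBundle ℝ Δ S]
    (Φ : (x : M) → TangentSpace (𝓡 n) x →L[ℝ] TangentSpace (𝓡 n) x →L[ℝ] S x) : Prop :=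
  ContMDiff (𝓡 n) ((𝓡 n).prod 𝓘(ℝ, EuclideanSpace ℝ (Fin n) →L[ℝ]
      EuclideanSpace ℝ (Fin n) →L[ℝ] Δ)) ∞
    (fun x => TotalSpace.mk' (EuclideanSpace ℝ (Fin n) →L[ℝ] EuclideanSpace ℝ (Fin n) →L[ℝ] Δ)
      (E := fun x : M => TangentSpace (𝓡 n) x →L[ℝ] TangentSpace (𝓡 n) x →L[ℝ] S x) x (Φ x))

variable {ρ : SpinorModule n Δ} (σ : SpinStructure (M := M) ρ S)

/-- The defining equation `γ^α φ_α = 0` of the twistor bundle `T`, at the point `x`. -/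
def IsTwistorAt (x : M) (φ : TangentSpace (𝓡 n) x → S x) : Prop :=
  contr x (fun u v => σ.gam x u (φ v)) = 0

/-- The trace `Φ^λ_λ`. -/
def tr (Φ : (x : M) → TangentSpace (𝓡 n) x → TangentSpace (𝓡 n) x → S x) (x : M) : S x :=
  contr x (Φ x)

/-- The contraction `γ^λ Φ_{λβ}`, with `v` in the slot `β`. -/
def gtr (Φ : (x : M) → TangentSpace (𝓡 n) x → TangentSpace (𝓡 n) x → S x) (x : M)
    (v : TangentSpace (𝓡 n) x) : S x :=
  contr x (fun u w => σ.gam x u (Φ x w v))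

/-- The projection of `T*M ⊗ T` onto its copy of the spinor bundle. -/
def projS (Φ : (x : M) → TangentSpace (𝓡 n) x → TangentSpace (𝓡 n) x → S x) (x : M)
    (u v : TangentSpace (𝓡 n) x) : S x :=
  -(1 / (2 * ((n : ℝ) - 1))) • (σ.gam x u (σ.gam x v (tr Φ x))
    + (((n : ℝ) - 2) / n) • σ.gam x v (σ.gam x u (tr Φ x)))

/-- The projection of `T*M ⊗ T` onto its copy of `T`. -/
def projT (Φ : (x : M) → TangentSpace (𝓡 n) x → TangentSpace (𝓡 n) x → S x) (x : M)
    (u v : TangentSpace (𝓡 n) x) : S x :=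
  (1 / (((n : ℝ) + 2) * ((n : ℝ) - 2))) •
    (-(n : ℝ) • σ.gam x u (gtr σ Φ x v) + (2 : ℝ) • σ.gam x v (gtr σ Φ x u)
      + (2 : ℝ) • σ.gam x u (σ.gam x v (tr Φ x))
      - (4 / (n : ℝ)) • σ.gam x v (σ.gam x u (tr Φ x)))

/-- The projection of `T*M ⊗ T` onto `Y = (Λ² ⊗ Σ) ∩ (T*M ⊗ T)`. -/
def projY (Φ : (x : M) → TangentSpace (𝓡 n) x → TangentSpace (𝓡 n) x → S x) (x : M)
    (u v : TangentSpace (𝓡 n) x) : S x :=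
  (1 / 2 : ℝ) • (Φ x u v - Φ x v u)
    + (1 / (2 * ((n : ℝ) - 2))) • (σ.gam x u (gtr σ Φ x v) - σ.gam x v (gtr σ Φ x u))
    - (1 / (2 * ((n : ℝ) - 1) * ((n : ℝ) - 2))) •
      (σ.gam x u (σ.gam x v (tr Φ x)) - σ.gam x v (σ.gam x u (tr Φ x)))

/-- The projection of `T*M ⊗ T` onto `Z = (TFS² ⊗ Σ) ∩ (T*M ⊗ T)`. -/
def projZ (Φ : (x : M) → TangentSpace (𝓡 n) x → TangentSpace (𝓡 n) x → S x) (x : M)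
    (u v : TangentSpace (𝓡 n) x) : S x :=
  (1 / 2 : ℝ) • (Φ x u v + Φ x v u)
    + (1 / (2 * ((n : ℝ) + 2))) • (σ.gam x u (gtr σ Φ x v) + σ.gam x v (gtr σ Φ x u)
      - (2 * inner ℝ u v : ℝ) • tr Φ x)

/-- The labels of the four summands of `T*M ⊗ T`. -/
inductive Summand
  | S | T | Y | Z

/-- The four projections of `T*M ⊗ T`. -/
def proj (s : Summand) (Φ : (x : M) → TangentSpace (𝓡 n) x → TangentSpace (𝓡 n) x → S x) :
    (x : M) → TangentSpace (𝓡 n) x → TangentSpace (𝓡 n) x → S x :=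
  match s with
  | .S => projS σ Φ
  | .T => projT σ Φ
  | .Y => projY σ Φ
  | .Z => projZ σ Φ

/-- The gradients `G_s φ = P_s (∇φ)`. -/
def grad (s : Summand) (φ : (x : M) → TangentSpace (𝓡 n) x → S x) :
    (x : M) → TangentSpace (𝓡 n) x → TangentSpace (𝓡 n) x → S x :=
  proj σ s (nablaOne covT covS φ)

/-- The operators `G_s* Φ = ∇* (P_s Φ)`. -/
def gradAdj (s : Summand) (Φ : (x : M) → TangentSpace (𝓡 n) x → TangentSpace (𝓡 n) x → S x) :
    (x : M) → TangentSpace (𝓡 n) x → S x :=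
  nablaStar covT covS (proj σ s Φ)

/-- `D'` is the formal adjoint of `D : Γ(T) → Γ(T*M ⊗ T)`: it takes values in `T`, and for all
smooth sections `φ` of `T` and `Φ` of `T*M ⊗ T` the function `⟨Dφ, Φ⟩ - ⟨φ, D'Φ⟩` is the divergence
of a smooth vector field that vanishes wherever `φ` or `Φ` does. The pairings are the real parts of
the Hermitian ones, which determine the latter by complex linearity. -/
def IsFormalAdjoint [VectorBundle ℝ Δ S]
    (D : ((x : M) → TangentSpace (𝓡 n) x → S x) →
      (x : M) → TangentSpace (𝓡 n) x → TangentSpace (𝓡 n) x → S x)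
    (D' : ((x : M) → TangentSpace (𝓡 n) x → TangentSpace (𝓡 n) x → S x) →
      (x : M) → TangentSpace (𝓡 n) x → S x) : Prop :=
  ∀ Φ : (x : M) → TangentSpace (𝓡 n) x →L[ℝ] TangentSpace (𝓡 n) x →L[ℝ] S x,
    IsSmoothTwo Δ Φ → (∀ x u, IsTwistorAt σ x (Φ x u)) →
    (∀ x, IsTwistorAt σ x (D' (fun y u v => Φ y u v) x)) ∧
    ∀ φ : (x : M) → TangentSpace (𝓡 n) x →L[ℝ] S x,
      IsSmoothOne Δ φ → (∀ x, IsTwistorAt σ x (φ x)) →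
      ∃ X : (x : M) → TangentSpace (𝓡 n) x,
        ContMDiff (𝓡 n) ((𝓡 n).prod 𝓘(ℝ, EuclideanSpace ℝ (Fin n))) ∞
          (fun x => TotalSpace.mk' (EuclideanSpace ℝ (Fin n)) x (X x)) ∧
        (∀ x, φ x = 0 ∨ Φ x = 0 → X x = 0) ∧
        ∀ x, contr x (fun u u' => contr x (fun v v' =>
              (inner ℂ (D (fun y w => φ y w) x u v) (Φ x u' v')).re))
            - contr x (fun v v' =>
              (inner ℂ (φ x v) (D' (fun y u w => Φ y u w) x v')).re)
          = divergence covT X x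

/-! ### The curvature actions on twistors -/

/-- `(b·φ)_μ = (1/n) ((n - 2) b_{μλ} φ^λ - b_{αλ} γ^α γ_μ φ^λ)`. -/
def einsteinAct (φ : (x : M) → TangentSpace (𝓡 n) x → S x) (x : M)
    (m : TangentSpace (𝓡 n) x) : S x :=
  (1 / (n : ℝ)) •
    (((n : ℝ) - 2) • contr x (fun l l' => einstein covT x m l • φ x l')
      - contr x (fun a a' => contr x (fun l l' =>
          einstein covT x a l • σ.gam x a' (σ.gam x m (φ x l')))))

/-- `(C◇φ)_μ = C_{αβ}^λ_μ γ^α γ^β φ_λ`. -/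
def weylAct (φ : (x : M) → TangentSpace (𝓡 n) x → S x) (x : M)
    (m : TangentSpace (𝓡 n) x) : S x :=
  contr x (fun a a' => contr x (fun b b' => contr x (fun l l' =>
    weyl covT x a b l m • σ.gam x a' (σ.gam x b' (φ x l')))))

end Operators

end

end SpinGeom

/-! Every assertion is local, so it can be checked in a spin frame, where a tensor-spinor becomes a
family of functions with values in the fixed module `Δ`. A covariant derivative is then a
directional derivative plus the action of the skew matrix of connection coefficients, and a
projection becomes a matrix expression in the operators `ρ.gen a` with constant coefficients. This
separates the proof into algebra in `Δ` and calculus on `M`.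

Two algebraic facts give the formal adjoints. The projections are equivariant under skew matrices
(`IsCliffordFamily.frameProj_skewAct₂`), hence parallel (`nabla₂_frameProj`), so they can be moved
through `∇*`. They are also symmetric on twistor-valued tensors, because the action of vectors is
skew (`sum_inner_frameProj_comm`). With the field `X_α = Re ⟨φ_β, (PΦ)_α^β⟩`, the adjoint identity
is the Leibniz rule `sum_rePair_nabla`. The adjoint takes values in `T` because the twistor
condition is itself parallel (`sum_gen_nabla`) and the projections preserve it.

The projections are also idempotent (`IsCliffordFamily.frameProj_frameProj`). Together with
parallelism this turns `G_s* G_s φ` into `-∑_a P_s(∇_a ∇φ)_{ab}`, a contraction of the second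
derivative `H = ∇∇φ`. The Clifford relations and the Ricci identity bring every such contraction to
a combination of three second-order expressions, namely `∑_a H_{aab}`, the trace `H_{baa}` and `Γ_b
Γ_a H_{acc}`, plus curvature terms. The coefficients in `Z_1` and `Z_2` are those for which the
three expressions cancel. The surviving curvature terms are reduced by the first Bianchi identity,
in the form `R_{alde} Γ_l Γ_d Γ_e = -2 Ric_{ae} Γ_e`, and are then regrouped into Weyl, trace-free
Ricci and scalar parts. This is `frameLap_weitzenboeck`.

On the analytic side the main point is the Ricci identity `nabla₂_nabla_sub`. It rests on the Lie
bracket being the commutator of derivations (`mvfderiv_mlieBracket`), on the structure equation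
`riem_eq`, and on the commutator of the actions of two skew matrices
(`IsCliffordFamily.skewAct_comm`). -/

namespace SpinGeom

/-! ### Clifford algebra in an orthonormal frame -/

section CliffordFamily

variable {n : ℕ} {V : Type*} [AddCommGroup V] [Module ℝ V]

/-- A family of operators with the Clifford relations `Γ_a Γ_b + Γ_b Γ_a = -2 δ_ab`. -/
def IsCliffordFamily (Γ : Fin n → Module.End ℝ V) : Prop :=
  ∀ a b ψ, Γ a (Γ b ψ) = -Γ b (Γ a ψ) - (if a = b then (2 : ℝ) else 0) • ψ

/-- The contraction `Γ_a Φ_{ab}` in an orthonormal frame. -/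
def frameGtr (Γ : Fin n → Module.End ℝ V) (Φ : Fin n → Fin n → V) (b : Fin n) : V :=
  ∑ a, Γ a (Φ a b)

/-- The trace in an orthonormal frame. -/
def frameTr (Φ : Fin n → Fin n → V) : V := ∑ a, Φ a a

/-- The four projections in an orthonormal frame. -/
noncomputable def frameProj (Γ : Fin n → Module.End ℝ V) (s : Summand) (Φ : Fin n → Fin n → V)
    (a b : Fin n) : V :=
  match s with
  | .S => -(1 / (2 * ((n : ℝ) - 1))) • (Γ a (Γ b (frameTr Φ))
      + (((n : ℝ) - 2) / n) • Γ b (Γ a (frameTr Φ)))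
  | .T => (1 / (((n : ℝ) + 2) * ((n : ℝ) - 2))) •
      (-(n : ℝ) • Γ a (frameGtr Γ Φ b) + (2 : ℝ) • Γ b (frameGtr Γ Φ a)
        + (2 : ℝ) • Γ a (Γ b (frameTr Φ)) - (4 / (n : ℝ)) • Γ b (Γ a (frameTr Φ)))
  | .Y => (1 / 2 : ℝ) • (Φ a b - Φ b a)
      + (1 / (2 * ((n : ℝ) - 2))) • (Γ a (frameGtr Γ Φ b) - Γ b (frameGtr Γ Φ a))
      - (1 / (2 * ((n : ℝ) - 1) * ((n : ℝ) - 2))) •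
        (Γ a (Γ b (frameTr Φ)) - Γ b (Γ a (frameTr Φ)))
  | .Z => (1 / 2 : ℝ) • (Φ a b + Φ b a)
      + (1 / (2 * ((n : ℝ) + 2))) • (Γ a (frameGtr Γ Φ b) + Γ b (frameGtr Γ Φ a)
        - (2 * if a = b then (1 : ℝ) else 0) • frameTr Φ)

variable {Γ : Fin n → Module.End ℝ V} (hΓ : IsCliffordFamily Γ)

namespace IsCliffordFamily

include hΓ

lemma sq (a : Fin n) (ψ : V) : Γ a (Γ a ψ) = -ψ := by
  have h := hΓ a a ψ
  simp only [if_true] at h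
  linear_combination (norm := module) (1 / 2 : ℝ) • h

lemma sum_sq (ψ : V) : ∑ a, Γ a (Γ a ψ) = -(n : ℝ) • ψ := by
  simp [hΓ.sq, ← Nat.cast_smul_eq_nsmul ℝ]

lemma sum_swap (a : Fin n) (χ : Fin n → V) :
    ∑ b, Γ b (Γ a (χ b)) = -Γ a (∑ b, Γ b (χ b)) - (2 : ℝ) • χ a := by
  simp_rw [hΓ _ a, Finset.sum_sub_distrib, Finset.sum_neg_distrib, ← map_sum]
  simp [ite_smul]

lemma sum_sandwich (a : Fin n) (ψ : V) :
    ∑ b, Γ b (Γ a (Γ b ψ)) = ((n : ℝ) - 2) • Γ a ψ := by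
  rw [hΓ.sum_swap a fun b => Γ b ψ, hΓ.sum_sq, map_smul]
  module

/-- Exchanging the two Clifford factors produces the twistor condition, which vanishes, and the
contraction `-2δ`. So the trace is already determined by the contraction `frameGtr`. -/
lemma sum_frameGtr {Φ : Fin n → Fin n → V} (hΦ : ∀ a, ∑ b, Γ b (Φ a b) = 0) :
    ∑ b, Γ b (frameGtr Γ Φ b) = -(2 : ℝ) • frameTr Φ := by
  simp only [frameGtr, map_sum]
  rw [Finset.sum_comm]
  simp_rw [hΓ.sum_swap _ (fun b => Φ _ b), hΦ]
  simp [frameTr, Finset.smul_sum]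

/-- The projections take values in the twistors. -/
lemma sum_frameProj (hn : 3 ≤ n) {Φ : Fin n → Fin n → V} (hΦ : ∀ a, ∑ b, Γ b (Φ a b) = 0)
    (s : Summand) (a : Fin n) : ∑ b, Γ b (frameProj Γ s Φ a b) = 0 := by
  have hn' : (3 : ℝ) ≤ n := by exact_mod_cast hn
  have h0 : (n : ℝ) ≠ 0 := by positivity
  have h1 : (n : ℝ) - 1 ≠ 0 := by linarith
  have h2 : (n : ℝ) - 2 ≠ 0 := by linarith
  have h3 : (n : ℝ) + 2 ≠ 0 := by positivity
  have e1 := hΓ.sum_sandwich a (frameTr Φ)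
  have e2 := hΓ.sum_sq (Γ a (frameTr Φ))
  have e3 := hΓ.sum_swap a (frameGtr Γ Φ)
  rw [hΓ.sum_frameGtr hΦ, map_smul] at e3
  have e4 := hΓ.sum_sq (frameGtr Γ Φ a)
  have e5 : ∑ b, Γ b (Φ b a) = frameGtr Γ Φ a := rfl
  cases s
  · simp only [frameProj, map_add, map_smul, Finset.sum_add_distrib, ← Finset.smul_sum, e1, e2]
    match_scalars
    field_simp
    ring
  · simp only [frameProj, map_add, map_sub, map_smul, Finset.sum_add_distrib,
      Finset.sum_sub_distrib, ← Finset.smul_sum, e1, e2, e3, e4]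
    match_scalars <;> field_simp <;> ring
  · simp only [frameProj, map_add, map_sub, map_smul, Finset.sum_add_distrib,
      Finset.sum_sub_distrib, ← Finset.smul_sum, e1, e2, e3, e4, e5, hΦ]
    match_scalars <;> field_simp <;> ring
  · have e6 : ∑ b, (2 * if a = b then (1 : ℝ) else 0) • Γ b (frameTr Φ)
        = (2 : ℝ) • Γ a (frameTr Φ) := by simp [ite_smul]
    simp only [frameProj, map_add, map_sub, map_smul, Finset.sum_add_distrib,
      Finset.sum_sub_distrib, ← Finset.smul_sum, e3, e4, e5, e6, hΦ]
    match_scalars <;> field_simp <;> ring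

/-- The projections are idempotent on `T*M ⊗ T`. -/
lemma frameProj_frameProj (hn : 3 ≤ n) {Φ : Fin n → Fin n → V}
    (hΦ : ∀ a, ∑ b, Γ b (Φ a b) = 0) (s : Summand) (a b : Fin n) :
    frameProj Γ s (frameProj Γ s Φ) a b = frameProj Γ s Φ a b := by
  have hn' : (3 : ℝ) ≤ n := by exact_mod_cast hn
  have h0 : (n : ℝ) ≠ 0 := by positivity
  have h1 : (n : ℝ) - 1 ≠ 0 := by linarith
  have h2 : (n : ℝ) - 2 ≠ 0 := by linarith
  have h3 : (n : ℝ) + 2 ≠ 0 := by positivity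
  have e1 := fun b => hΓ.sum_sandwich b (frameTr Φ)
  have e2 := hΓ.sum_sq
  have e3 := fun b => hΓ.sum_swap b (frameGtr Γ Φ)
  simp only [hΓ.sum_frameGtr hΦ, map_smul] at e3
  have e4 := hΓ.sum_frameGtr hΦ
  have e5 : ∀ b, ∑ a, Γ a (Φ a b) = frameGtr Γ Φ b := fun _ => rfl
  have e6 : ∑ a, Φ a a = frameTr Φ := rfl
  cases s
  -- This projection sees only the trace of `Φ`, so its idempotence amounts to the preservation of
  -- the trace.
  · have ht : frameTr (frameProj Γ .S Φ) = frameTr Φ := by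
      conv_lhs => simp only [frameTr, frameProj, Finset.sum_add_distrib, ← Finset.smul_sum]
      simp only [e2, e6]
      match_scalars
      field_simp
      ring
    rw [frameProj, ht]
    rfl
  · have ht : frameTr (frameProj Γ .T Φ) = 0 := by
      conv_lhs => simp only [frameTr, frameProj, Finset.sum_add_distrib, Finset.sum_sub_distrib,
        ← Finset.smul_sum]
      simp only [e2, e4, e6]
      match_scalars
      field_simp
      ring
    -- The contraction of the `T`-component is the twistor part of `frameGtr Γ Φ`: the correction
    -- term removes its Clifford trace `-2 tr Φ`.
    have hg : ∀ b, frameGtr Γ (frameProj Γ .T Φ) b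
        = frameGtr Γ Φ b - (2 / (n : ℝ)) • Γ b (frameTr Φ) := fun b => by
      conv_lhs => simp only [frameGtr, frameProj, map_add, map_sub, map_smul,
        Finset.sum_add_distrib, Finset.sum_sub_distrib, ← Finset.smul_sum]
      simp only [e5, e1, e2, e3]
      match_scalars <;> field_simp <;> ring
    simp only [frameProj.eq_2, ht, hg, map_sub, map_smul, map_zero]
    match_scalars <;> field_simp <;> ring
  · have ht : frameTr (frameProj Γ .Y Φ) = 0 := by
      simp [frameTr, frameProj]
    have hg : ∀ b, frameGtr Γ (frameProj Γ .Y Φ) b = 0 := fun b => by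
      conv_lhs => simp only [frameGtr, frameProj, map_add, map_sub, map_smul,
        Finset.sum_add_distrib, Finset.sum_sub_distrib, ← Finset.smul_sum]
      simp only [e5, e1, e2, e3, hΦ]
      match_scalars <;> field_simp <;> ring
    -- Only the outer projection is unfolded. With both contractions of the inner one equal to zero,
    -- what remains is its skew-symmetrization.
    simp only [frameProj.eq_3 Γ (frameProj Γ .Y Φ), ht, hg, map_zero]
    simp only [frameProj]
    module
  · have e8 : ∀ b, ∑ a, (2 * if a = b then (1 : ℝ) else 0) • Γ a (frameTr Φ)
        = (2 : ℝ) • Γ b (frameTr Φ) := by simp [ite_smul]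
    have ht : frameTr (frameProj Γ .Z Φ) = 0 := by
      conv_lhs => simp only [frameTr, frameProj, Finset.sum_add_distrib, Finset.sum_sub_distrib,
        ← Finset.smul_sum]
      simp only [if_true, mul_one, Finset.sum_const, Finset.card_univ, Fintype.card_fin,
        ← Nat.cast_smul_eq_nsmul ℝ, e4, e6]
      match_scalars
      field_simp
      ring
    have hg : ∀ b, frameGtr Γ (frameProj Γ .Z Φ) b = 0 := fun b => by
      conv_lhs => simp only [frameGtr, frameProj, map_add, map_sub, map_smul,
        Finset.sum_add_distrib, Finset.sum_sub_distrib, ← Finset.smul_sum]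
      simp only [e5, e2, e3, e8, hΦ]
      match_scalars <;> field_simp <;> ring
    simp only [frameProj.eq_4 Γ (frameProj Γ .Z Φ), ht, hg, map_zero]
    simp only [frameProj, eq_comm (a := b)]
    module

end IsCliffordFamily

end CliffordFamily

/-! ### Symmetry of the projections under a skew Clifford action -/

section SelfAdjoint

variable {n : ℕ} {V : Type*} [NormedAddCommGroup V] [InnerProductSpace ℝ V]
  {Γ : Fin n → Module.End ℝ V}

/-- The pairing of `Γ_a χ_b` with a `2`-tensor. -/
lemma sum_inner_left_of_skew (hs : ∀ a ψ χ, inner ℝ (Γ a ψ) χ = -inner ℝ ψ (Γ a χ))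
    (χ : Fin n → V) (Φ : Fin n → Fin n → V) :
    ∑ a, ∑ b, inner ℝ (Γ a (χ b)) (Φ a b) = -∑ b, inner ℝ (χ b) (frameGtr Γ Φ b) := by
  simp_rw [hs, Finset.sum_neg_distrib, frameGtr, inner_sum]
  rw [Finset.sum_comm]

/-- Skewness moves `Γ b` onto `Φ`, where the twistor condition applies. This removes every term of a
projection whose outer Clifford factor carries the second index. -/
lemma sum_inner_right_of_skew (hs : ∀ a ψ χ, inner ℝ (Γ a ψ) χ = -inner ℝ ψ (Γ a χ))
    (χ : Fin n → V) {Φ : Fin n → Fin n → V} (hΦ : ∀ a, ∑ b, Γ b (Φ a b) = 0) :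
    ∑ a, ∑ b, inner ℝ (Γ b (χ a)) (Φ a b) = 0 := by
  simp_rw [hs, Finset.sum_neg_distrib, ← inner_sum, hΦ]
  simp

/-- The right-hand sides involve only pairings of traces, of contractions and of the tensors
themselves, each symmetric under exchange of `Ψ` and `Φ`. Symmetry of the projections can then be
read off. -/
lemma sum_inner_frameProj_left (hΓ : IsCliffordFamily Γ)
    (hs : ∀ a ψ χ, inner ℝ (Γ a ψ) χ = -inner ℝ ψ (Γ a χ)) (s : Summand)
    (Ψ : Fin n → Fin n → V) {Φ : Fin n → Fin n → V} (hΦ : ∀ a, ∑ b, Γ b (Φ a b) = 0) :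
    ∑ a, ∑ b, inner ℝ (frameProj Γ s Ψ a b) (Φ a b) =
      match s with
      | .S => (1 / (2 * ((n : ℝ) - 1))) * 2 * inner ℝ (frameTr Ψ) (frameTr Φ)
      | .T => (1 / (((n : ℝ) + 2) * ((n : ℝ) - 2))) *
          (n * ∑ b, inner ℝ (frameGtr Γ Ψ b) (frameGtr Γ Φ b)
            - 4 * inner ℝ (frameTr Ψ) (frameTr Φ))
      | .Y => (1 / 2) * (∑ a, ∑ b, inner ℝ (Ψ a b) (Φ a b) - ∑ a, ∑ b, inner ℝ (Ψ b a) (Φ a b))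
          - (1 / (2 * ((n : ℝ) - 2))) * ∑ b, inner ℝ (frameGtr Γ Ψ b) (frameGtr Γ Φ b)
          + (1 / (2 * ((n : ℝ) - 1) * ((n : ℝ) - 2))) * 2 * inner ℝ (frameTr Ψ) (frameTr Φ)
      | .Z => (1 / 2) * (∑ a, ∑ b, inner ℝ (Ψ a b) (Φ a b) + ∑ a, ∑ b, inner ℝ (Ψ b a) (Φ a b))
          - (1 / (2 * ((n : ℝ) + 2))) * (∑ b, inner ℝ (frameGtr Γ Ψ b) (frameGtr Γ Φ b)
            + 2 * inner ℝ (frameTr Ψ) (frameTr Φ)) := by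
  have e1 := sum_inner_left_of_skew hs (frameGtr Γ Ψ) Φ
  have e2 := sum_inner_right_of_skew hs (frameGtr Γ Ψ) hΦ
  have e3 : ∑ a, ∑ b, inner ℝ (Γ a (Γ b (frameTr Ψ))) (Φ a b)
      = -2 * inner ℝ (frameTr Ψ) (frameTr Φ) := by
    rw [sum_inner_left_of_skew hs (fun b => Γ b (frameTr Ψ)) Φ]
    simp_rw [hs, Finset.sum_neg_distrib, ← inner_sum, hΓ.sum_frameGtr hΦ, inner_smul_right]
    ring
  have e4 := sum_inner_right_of_skew hs (fun a => Γ a (frameTr Ψ)) hΦ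
  have e5 : ∑ a, ∑ b, (2 * if a = b then (1 : ℝ) else 0) * inner ℝ (frameTr Ψ) (Φ a b)
      = 2 * inner ℝ (frameTr Ψ) (frameTr Φ) := by
    conv_rhs => rw [frameTr, frameTr, inner_sum]
    simp [← Finset.mul_sum, frameTr]
  cases s <;> simp only [frameProj, inner_smul_left, inner_add_left, inner_sub_left,
    Finset.sum_add_distrib, Finset.sum_sub_distrib, ← Finset.mul_sum, e1, e2, e3, e4,
    RCLike.conj_to_real]
  · ring
  · ring
  · ring
  · rw [e5]; ring

/-- The projections are symmetric on `T*M ⊗ T`. -/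
lemma sum_inner_frameProj_comm (hΓ : IsCliffordFamily Γ)
    (hs : ∀ a ψ χ, inner ℝ (Γ a ψ) χ = -inner ℝ ψ (Γ a χ)) (s : Summand)
    {Ψ Φ : Fin n → Fin n → V} (hΨ : ∀ a, ∑ b, Γ b (Ψ a b) = 0)
    (hΦ : ∀ a, ∑ b, Γ b (Φ a b) = 0) :
    ∑ a, ∑ b, inner ℝ (frameProj Γ s Ψ a b) (Φ a b)
      = ∑ a, ∑ b, inner ℝ (Ψ a b) (frameProj Γ s Φ a b) := by
  simp_rw [fun a b => real_inner_comm (frameProj Γ s Φ a b) (Ψ a b)]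
  rw [sum_inner_frameProj_left hΓ hs s Ψ hΦ, sum_inner_frameProj_left hΓ hs s Φ hΨ]
  have h1 : inner ℝ (frameTr Φ) (frameTr Ψ) = inner ℝ (frameTr Ψ) (frameTr Φ) :=
    real_inner_comm _ _
  have h2 : ∑ a, ∑ b, inner ℝ (Φ b a) (Ψ a b) = ∑ a, ∑ b, inner ℝ (Ψ b a) (Φ a b) := by
    rw [Finset.sum_comm]
    simp_rw [real_inner_comm]
  have h3 : ∑ a, ∑ b, inner ℝ (Φ a b) (Ψ a b) = ∑ a, ∑ b, inner ℝ (Ψ a b) (Φ a b) := by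
    simp_rw [real_inner_comm]
  have h4 : ∑ b, inner ℝ (frameGtr Γ Φ b) (frameGtr Γ Ψ b)
      = ∑ b, inner ℝ (frameGtr Γ Ψ b) (frameGtr Γ Φ b) := by
    simp_rw [real_inner_comm]
  simp only [h1, h2, h3, h4]

end SelfAdjoint

end SpinGeom

namespace SpinGeom

/-! ### Algebraic curvature tensors in an orthonormal frame -/

section CurvatureAlgebra

variable {n : ℕ}

/-- The symmetries of the components `R c a b d = ⟨R(e_c, e_a) e_b, e_d⟩`. -/
structure IsCurvatureLike (R : Fin n → Fin n → Fin n → Fin n → ℝ) : Prop where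
  swap_left : ∀ c a b d, R c a b d = -R a c b d
  swap_right : ∀ c a b d, R c a b d = -R c a d b
  bianchi : ∀ c a b d, R c a b d + R a b c d + R b c a d = 0

variable (R : Fin n → Fin n → Fin n → Fin n → ℝ)

/-- The Ricci tensor in an orthonormal frame. -/
def frameRic (b a : Fin n) : ℝ := ∑ c, R c a b c

/-- The scalar curvature in an orthonormal frame. -/
def frameScal : ℝ := ∑ a, frameRic R a a

/-- The Schouten tensor in an orthonormal frame. -/
noncomputable def frameSchouten (a b : Fin n) : ℝ :=
  (frameRic R a b - frameScal R / (2 * (n - 1)) * if a = b then 1 else 0) / (n - 2)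

/-- The trace-free Ricci tensor in an orthonormal frame. -/
noncomputable def frameEinstein (a b : Fin n) : ℝ :=
  frameRic R a b - frameScal R / n * if a = b then 1 else 0

/-- The Weyl tensor in an orthonormal frame. -/
noncomputable def frameWeyl (a b k l : Fin n) : ℝ :=
  R k l b a
    + frameSchouten R b k * (if a = l then 1 else 0)
    - frameSchouten R b l * (if a = k then 1 else 0)
    + frameSchouten R a l * (if b = k then 1 else 0)
    - frameSchouten R a k * (if b = l then 1 else 0)

variable {R} (hR : IsCurvatureLike R)

include hR in
lemma IsCurvatureLike.pair_symm (a b c d : Fin n) : R a b c d = R c d a b := by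
  obtain ⟨h1, h2, h3⟩ := hR
  -- The classical argument: the Bianchi identities for the four cyclic rotations of `(a, b, c, d)`
  -- are combined using the skew symmetries in each pair.
  linarith [h3 a b c d, h3 b c d a, h3 c d a b, h3 d a b c, h1 a b c d, h2 a b c d,
    h1 b c a d, h2 b c a d, h1 c a b d, h2 c a b d, h1 c d a b, h2 c d a b, h1 a d b c,
    h2 a d b c, h1 b d a c, h2 b d a c, h1 b c d a, h1 c a d b, h2 b a c d, h1 b a d c,
    h2 d b c a, h1 d b c a, h1 d b a c, h2 d a c b, h1 d a b c, h2 d a b c, h1 d c a b,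
    h2 a c d b, h1 a c d b, h1 a c b d, h2 a c b d, h2 d c a b, h1 d c b a, h1 a b d c,
    h2 d b a c]

include hR in
lemma IsCurvatureLike.frameRic_comm (a b : Fin n) : frameRic R a b = frameRic R b a := by
  refine Finset.sum_congr rfl fun c _ => ?_
  rw [hR.pair_symm, hR.swap_left, hR.swap_right, neg_neg]

include hR in
lemma IsCurvatureLike.self_right (a b c : Fin n) : R a b c c = 0 := by
  linarith [hR.swap_right a b c c]

include hR in
lemma IsCurvatureLike.sum_contr_left (a b : Fin n) : ∑ c, R c a c b = -frameRic R b a := by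
  rw [frameRic, ← Finset.sum_neg_distrib]
  exact Finset.sum_congr rfl fun c _ => hR.swap_right c a c b

include hR in
lemma IsCurvatureLike.sum_contr_mid (a b : Fin n) : ∑ c, R a c b c = -frameRic R b a := by
  rw [frameRic, ← Finset.sum_neg_distrib]
  exact Finset.sum_congr rfl fun c _ => hR.swap_left a c b c

include hR in
lemma IsCurvatureLike.sum_contr_outer (a b : Fin n) : ∑ c, R a c c b = frameRic R b a := by
  rw [frameRic]
  refine Finset.sum_congr rfl fun c _ => ?_
  rw [hR.swap_left, hR.swap_right, neg_neg]

variable {V : Type*} [AddCommGroup V] [Module ℝ V] {Γ : Fin n → Module.End ℝ V}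

omit [Module ℝ V] in
lemma sum_comm_cycle (f : Fin n → Fin n → Fin n → V) :
    ∑ l, ∑ d, ∑ e, f d e l = ∑ l, ∑ d, ∑ e, f l d e := by
  rw [Finset.sum_comm]
  refine Finset.sum_congr rfl fun d _ => ?_
  rw [Finset.sum_comm]

include hR in
/-- The contraction of the curvature with three Clifford multiplications. -/
lemma IsCurvatureLike.sum_clifford (hΓ : IsCliffordFamily Γ) (a : Fin n) (ψ : V) :
    ∑ l, ∑ d, ∑ e, R a l d e • Γ l (Γ d (Γ e ψ)) = -(2 : ℝ) • ∑ e, frameRic R a e • Γ e ψ := by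
  -- Pair symmetry transfers the Bianchi identity to the last three indices.
  have hb : ∀ l d e, R a l d e + R a d e l + R a e l d = 0 := by
    intro l d e
    rw [hR.pair_symm a l, hR.pair_symm a d, hR.pair_symm a e]
    linarith [hR.bianchi d e l a, hR.swap_right d e a l, hR.swap_right e l a d,
      hR.swap_right l d a e]
  have h0 : ∑ l, ∑ d, ∑ e, (R a l d e + R a d e l + R a e l d) • Γ l (Γ d (Γ e ψ)) = 0 := by
    simp [hb]
  simp only [add_smul, Finset.sum_add_distrib] at h0
  -- The cyclic sum is contracted with `Γ l Γ d Γ e`. After renaming indices, `c1` and `c2` return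
  -- the permuted products to the original order at the cost of contractions.
  have c1 : ∀ l d e, Γ d (Γ e (Γ l ψ)) = Γ l (Γ d (Γ e ψ))
      + (if l = d then (2 : ℝ) else 0) • Γ e ψ - (if e = l then (2 : ℝ) else 0) • Γ d ψ := by
    intro l d e
    rw [hΓ e l ψ, map_sub, map_neg, map_smul, hΓ d l (Γ e ψ)]
    simp only [eq_comm (a := d) (b := l)]
    module
  have c2 : ∀ l d e, Γ e (Γ l (Γ d ψ)) = Γ l (Γ d (Γ e ψ))
      + (if e = d then (2 : ℝ) else 0) • Γ l ψ - (if e = l then (2 : ℝ) else 0) • Γ d ψ := by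
    intro l d e
    rw [hΓ e l (Γ d ψ), hΓ e d ψ, map_sub, map_neg, map_smul]
    module
  have t1 : ∑ l, ∑ d, ∑ e, R a e l d • Γ l (Γ d (Γ e ψ))
      = ∑ l, ∑ d, ∑ e, R a l d e • (Γ l (Γ d (Γ e ψ))
        + (if l = d then (2 : ℝ) else 0) • Γ e ψ - (if e = l then (2 : ℝ) else 0) • Γ d ψ) := by
    rw [← sum_comm_cycle]
    refine Finset.sum_congr rfl fun l _ => Finset.sum_congr rfl fun d _ =>
      Finset.sum_congr rfl fun e _ => ?_
    rw [c1]
  have t2 : ∑ l, ∑ d, ∑ e, R a d e l • Γ l (Γ d (Γ e ψ))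
      = ∑ l, ∑ d, ∑ e, R a l d e • (Γ l (Γ d (Γ e ψ))
        + (if e = d then (2 : ℝ) else 0) • Γ l ψ - (if e = l then (2 : ℝ) else 0) • Γ d ψ) := by
    rw [← sum_comm_cycle fun l d e => R a l d e • (Γ l (Γ d (Γ e ψ))
        + (if e = d then (2 : ℝ) else 0) • Γ l ψ - (if e = l then (2 : ℝ) else 0) • Γ d ψ)]
    refine Finset.sum_congr rfl fun l _ => Finset.sum_congr rfl fun d _ =>
      Finset.sum_congr rfl fun e _ => ?_
    rw [← c2]
  rw [t1, t2] at h0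
  simp only [smul_add, smul_sub, Finset.sum_add_distrib, Finset.sum_sub_distrib] at h0
  have s1 : ∑ l, ∑ d, ∑ e, R a l d e • (if l = d then (2 : ℝ) else 0) • Γ e ψ
      = (2 : ℝ) • ∑ e, frameRic R a e • Γ e ψ := by
    simp only [ite_smul, zero_smul, smul_ite, smul_zero, Finset.sum_ite_irrel,
      Finset.sum_const_zero, Finset.sum_ite_eq, Finset.mem_univ, if_true]
    rw [Finset.sum_comm, Finset.smul_sum]
    refine Finset.sum_congr rfl fun e _ => ?_
    rw [← Finset.sum_smul, hR.sum_contr_outer, hR.frameRic_comm, smul_comm]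
  have s2 : ∑ l, ∑ d, ∑ e, R a l d e • (if e = d then (2 : ℝ) else 0) • Γ l ψ = 0 := by
    simp [ite_smul, hR.self_right]
  have s3 : ∑ l, ∑ d, ∑ e, R a l d e • (if e = l then (2 : ℝ) else 0) • Γ d ψ
      = -(2 : ℝ) • ∑ e, frameRic R a e • Γ e ψ := by
    simp only [ite_smul, zero_smul, smul_ite, smul_zero, Finset.sum_ite_eq', Finset.mem_univ,
      if_true]
    rw [Finset.sum_comm, Finset.smul_sum]
    refine Finset.sum_congr rfl fun e _ => ?_
    rw [← Finset.sum_smul, hR.sum_contr_mid, hR.frameRic_comm]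
    module
  rw [s1, s2, s3] at h0
  -- The three cyclic terms each contribute the desired sum, and the contractions contribute six
  -- times the Ricci term.
  linear_combination (norm := module) (1 / 3 : ℝ) • h0

include hR in
/-- Lichnerowicz' identity. -/
lemma IsCurvatureLike.sum_clifford_four (hΓ : IsCliffordFamily Γ) (ψ : V) :
    ∑ a, ∑ l, Γ a (Γ l (∑ d, ∑ e, R a l d e • Γ d (Γ e ψ))) = (2 * frameScal R) • ψ := by
  have h1 : ∀ a, ∑ l, Γ a (Γ l (∑ d, ∑ e, R a l d e • Γ d (Γ e ψ)))
      = -(2 : ℝ) • ∑ e, frameRic R a e • Γ a (Γ e ψ) := by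
    intro a
    have := congrArg (Γ a) (hR.sum_clifford hΓ a ψ)
    simpa only [map_sum, map_smul] using this
  simp only [h1, ← Finset.smul_sum]
  -- The Ricci tensor is symmetric, so only the symmetric part `-δ` of `Γ a Γ e` contributes, and it
  -- gives the scalar curvature.
  have h2 : ∑ a, ∑ e, frameRic R a e • Γ a (Γ e ψ) = -∑ a, ∑ e, frameRic R a e • Γ a (Γ e ψ)
      - (2 * frameScal R) • ψ := by
    conv_lhs => rw [Finset.sum_comm]
    have : ∀ e a, frameRic R a e • Γ a (Γ e ψ) = -(frameRic R e a • Γ e (Γ a ψ))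
        - frameRic R e a • (if a = e then (2 : ℝ) else 0) • ψ := by
      intro e a
      rw [hΓ a e, hR.frameRic_comm]
      module
    rw [Finset.sum_congr rfl fun e _ => Finset.sum_congr rfl fun a _ => this e a]
    simp only [Finset.sum_sub_distrib, Finset.sum_neg_distrib]
    congr 1
    simp only [ite_smul, zero_smul, smul_ite, smul_zero, Finset.sum_ite_eq', Finset.mem_univ,
      if_true, ← Finset.sum_smul, frameScal]
    rw [mul_comm, mul_smul]
  linear_combination (norm := module) -h2

end CurvatureAlgebra

end SpinGeom

namespace SpinGeom

/-! ### The curvature actions on twistors and the Weitzenböck formulas in a frame -/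

section Weitzenboeck

variable {n : ℕ} {V : Type*} [AddCommGroup V] [Module ℝ V] (Γ : Fin n → Module.End ℝ V)
  (R : Fin n → Fin n → Fin n → Fin n → ℝ) (φ : Fin n → V)

/-- The action of the Weyl tensor on twistors in an orthonormal frame. -/
noncomputable def frameWeylAct (m : Fin n) : V :=
  ∑ a, ∑ b, ∑ l, frameWeyl R a b l m • Γ a (Γ b (φ l))

/-- The action of the trace-free Ricci tensor on twistors in an orthonormal frame. -/
noncomputable def frameEinsteinAct (m : Fin n) : V :=
  (1 / (n : ℝ)) • (((n : ℝ) - 2) • ∑ l, frameEinstein R m l • φ l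
    - ∑ a, ∑ l, frameEinstein R a l • Γ a (Γ m (φ l)))

/-- The action of the curvature of `T*M ⊗ Σ` in an orthonormal frame. -/
noncomputable def frameCurvAct (c a b : Fin n) : V :=
  (1 / 4 : ℝ) • ∑ d, ∑ e, R c a d e • Γ d (Γ e (φ b)) - ∑ d, R c a b d • φ d

/-- The action of the full curvature tensor in the pattern of the Weyl action. -/
def frameRiemAct (m : Fin n) : V := ∑ a, ∑ b, ∑ l, R l m b a • Γ a (Γ b (φ l))

/-- The action `r_{m l} φ_l` of the Ricci tensor. -/
def frameRicAct (m : Fin n) : V := ∑ l, frameRic R m l • φ l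

/-- The contraction `r_{a l} γ_a φ_l`. -/
def frameRicContr : V := ∑ a, Γ a (frameRicAct R φ a)

variable {Γ R φ} (hΓ : IsCliffordFamily Γ) (hR : IsCurvatureLike R) (hφ : ∑ a, Γ a (φ a) = 0)

section Twistor

include hΓ hφ

/-- Moving `Γ m` to the left in `Γ a Γ m` contracts away one Ricci factor, and the twistor condition
removes the Clifford trace of `φ`. This gives the form in which the action is compared with the
curvature terms of the Ricci identity. -/
lemma frameEinsteinAct_eq (hn : 3 ≤ n) (m : Fin n) :
    frameEinsteinAct Γ R φ m = frameRicAct R φ m + (1 / (n : ℝ)) • Γ m (frameRicContr Γ R φ)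
      - (frameScal R / n) • φ m := by
  have hn' : (3 : ℝ) ≤ n := by exact_mod_cast hn
  have h0 : (n : ℝ) ≠ 0 := by positivity
  have e1 : ∑ l, frameEinstein R m l • φ l = frameRicAct R φ m - (frameScal R / n) • φ m := by
    simp [frameEinstein, sub_smul, Finset.sum_sub_distrib, frameRicAct, ite_smul]
  have e2 : ∑ a, ∑ l, frameEinstein R a l • Γ a (Γ m (φ l))
      = ∑ a, Γ a (Γ m (frameRicAct R φ a)) - (frameScal R / n) • ∑ a, Γ a (Γ m (φ a)) := by
    simp [frameEinstein, sub_smul, Finset.sum_sub_distrib, frameRicAct, ite_smul,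
      Finset.smul_sum]
  rw [frameEinsteinAct, e1, e2, hΓ.sum_swap, hΓ.sum_swap, hφ, frameRicContr]
  simp only [map_zero]
  match_scalars <;> field_simp <;> ring

include hR in
-- Each Schouten term of the Weyl tensor carries a Kronecker delta, which collapses one of the three
-- sums. The twistor condition kills the term pairing `Γ b` with `φ b`, and the other three reduce
-- to `W`, the Schouten tensor applied to `φ`, and its Clifford trace.
lemma frameWeylAct_eq (hn : 3 ≤ n) (m : Fin n) :
    frameWeylAct Γ R φ m = frameRiemAct Γ R φ m
      + (2 / ((n : ℝ) - 2)) • Γ m (frameRicContr Γ R φ)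
      + (4 / ((n : ℝ) - 2)) • frameRicAct R φ m
      - (2 * frameScal R / (((n : ℝ) - 1) * (n - 2))) • φ m := by
  have hn' : (3 : ℝ) ≤ n := by exact_mod_cast hn
  have h1 : (n : ℝ) - 1 ≠ 0 := by linarith
  have h2 : (n : ℝ) - 2 ≠ 0 := by linarith
  set W : Fin n → V := fun a => ∑ l, frameSchouten R a l • φ l with hW
  have hWa : ∀ a, W a = (1 / ((n : ℝ) - 2)) • frameRicAct R φ a
      - (frameScal R / (2 * (n - 1) * (n - 2))) • φ a := by
    intro a
    simp only [hW, frameSchouten, frameRicAct, Finset.smul_sum, div_eq_mul_inv, sub_mul, sub_smul,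
      Finset.sum_sub_distrib]
    congr 1
    · refine Finset.sum_congr rfl fun l _ => ?_
      rw [smul_smul]; congr 1; ring
    · simp only [mul_ite, mul_one, mul_zero, ite_mul, zero_mul, ite_smul, zero_smul,
        Finset.sum_ite_eq, Finset.mem_univ, if_true]
      congr 1
      field_simp
  have hQ : ∑ a, Γ a (W a) = (1 / ((n : ℝ) - 2)) • frameRicContr Γ R φ := by
    simp only [hWa, map_sub, map_smul, Finset.sum_sub_distrib, ← Finset.smul_sum, hφ,
      frameRicContr, smul_zero, sub_zero]
  have hs : ∀ a b, frameSchouten R a b = frameSchouten R b a := by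
    intro a b
    simp only [frameSchouten, hR.frameRic_comm a b, eq_comm]
  have e1 : ∑ a, ∑ b, ∑ l, (frameSchouten R b l * if a = m then (1 : ℝ) else 0) •
      Γ a (Γ b (φ l)) = Γ m (∑ b, Γ b (W b)) := by
    simp [hW, ite_smul, Finset.sum_ite_irrel]
  have e2 : ∑ a, ∑ b, ∑ l, (frameSchouten R b m * if a = l then (1 : ℝ) else 0) •
      Γ a (Γ b (φ l)) = -(2 : ℝ) • W m := by
    have : ∀ b, ∑ a, Γ a (Γ b (φ a)) = -(2 : ℝ) • φ b := by
      intro b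
      rw [hΓ.sum_swap, hφ]; simp
    simp only [mul_ite, mul_one, mul_zero, ite_smul, zero_smul, Finset.sum_ite_eq,
      Finset.mem_univ, if_true]
    rw [Finset.sum_comm]
    simp only [← Finset.smul_sum, this, hW]
    rw [Finset.smul_sum]
    refine Finset.sum_congr rfl fun b _ => ?_
    rw [hs b m, smul_comm]
  have e3 : ∑ a, ∑ b, ∑ l, (frameSchouten R a m * if b = l then (1 : ℝ) else 0) •
      Γ a (Γ b (φ l)) = 0 := by
    simp only [mul_ite, mul_one, mul_zero, ite_smul, zero_smul, Finset.sum_ite_eq,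
      Finset.mem_univ, if_true, ← Finset.smul_sum, ← map_sum, hφ]
    simp
  have e4 : ∑ a, ∑ b, ∑ l, (frameSchouten R a l * if b = m then (1 : ℝ) else 0) •
      Γ a (Γ b (φ l)) = -Γ m (∑ b, Γ b (W b)) - (2 : ℝ) • W m := by
    rw [← hΓ.sum_swap m W]
    simp [hW, ite_smul, Finset.sum_ite_irrel]
  have e5 : frameWeylAct Γ R φ m = frameRiemAct Γ R φ m + Γ m (∑ b, Γ b (W b))
      + (2 : ℝ) • W m + 0 - (-Γ m (∑ b, Γ b (W b)) - (2 : ℝ) • W m) := by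
    rw [← e4, ← e3, ← e1]
    have : (2 : ℝ) • W m = -(-(2 : ℝ) • W m) := by module
    rw [this, ← e2]
    simp only [frameWeylAct, frameWeyl, frameRiemAct, add_smul, sub_smul, Finset.sum_add_distrib,
      Finset.sum_sub_distrib]
    abel
  rw [e5, hQ, hWa, map_smul]
  match_scalars <;> field_simp <;> ring

end Twistor

section CurvatureTerms

include hΓ hR

/-- The curvature term of `γ_a γ_l ∇_a ∇_l φ_b`. -/
lemma sum_clifford_frameCurvAct (b : Fin n) :
    ∑ a, ∑ l, Γ a (Γ l (frameCurvAct Γ R φ a l b))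
      = (frameScal R / 2) • φ b - frameRiemAct Γ R φ b := by
  simp only [frameCurvAct, map_sub, map_smul, Finset.sum_sub_distrib, ← Finset.smul_sum,
    hR.sum_clifford_four hΓ]
  congr 1
  · module
  · simp only [frameRiemAct, map_sum, map_smul]
    refine Finset.sum_congr rfl fun a _ => Finset.sum_congr rfl fun l _ =>
      Finset.sum_congr rfl fun d _ => ?_
    rw [hR.pair_symm a l b d, hR.swap_left b d, hR.swap_right d b, neg_neg]

omit hΓ in
/-- The curvature term of `∇_a ∇_b φ_a`. -/
lemma sum_frameCurvAct (b : Fin n) :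
    ∑ a, frameCurvAct Γ R φ a b a
      = -(1 / 4 : ℝ) • frameRiemAct Γ R φ b + frameRicAct R φ b := by
  simp only [frameCurvAct, Finset.sum_sub_distrib, ← Finset.smul_sum]
  rw [sub_eq_add_neg]
  congr 1
  · rw [neg_smul, ← smul_neg, frameRiemAct]
    congr 1
    rw [← sum_comm_cycle fun d e a => R a b e d • Γ d (Γ e (φ a))]
    simp only [← Finset.sum_neg_distrib]
    refine Finset.sum_congr rfl fun a _ => Finset.sum_congr rfl fun d _ =>
      Finset.sum_congr rfl fun e _ => ?_
    rw [hR.swap_right a b d e, neg_smul]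
  · rw [Finset.sum_comm, frameRicAct, ← Finset.sum_neg_distrib]
    refine Finset.sum_congr rfl fun d _ => ?_
    rw [← Finset.sum_smul, hR.sum_contr_left, neg_smul, neg_neg, hR.frameRic_comm]

/-- The curvature term of `γ_l ∇_a ∇_l φ_a`. -/
lemma sum_clifford_frameCurvAct_trace :
    ∑ a, ∑ l, Γ l (frameCurvAct Γ R φ a l a) = (1 / 2 : ℝ) • frameRicContr Γ R φ := by
  have h1 : ∀ a, ∑ l, Γ l (∑ d, ∑ e, R a l d e • Γ d (Γ e (φ a)))
      = -(2 : ℝ) • ∑ e, frameRic R a e • Γ e (φ a) := by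
    intro a
    simpa only [map_sum, map_smul] using hR.sum_clifford hΓ a (φ a)
  have h2 : ∑ a, ∑ e, frameRic R a e • Γ e (φ a) = frameRicContr Γ R φ := by
    rw [Finset.sum_comm, frameRicContr]
    simp only [frameRicAct, map_sum, map_smul]
    exact Finset.sum_congr rfl fun e _ => Finset.sum_congr rfl fun a _ => by
      rw [hR.frameRic_comm]
  have h3 : ∑ a, ∑ l, ∑ d, R a l a d • Γ l (φ d) = -frameRicContr Γ R φ := by
    rw [sum_comm_cycle fun l d a => R a l a d • Γ l (φ d), frameRicContr,
      ← Finset.sum_neg_distrib]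
    refine Finset.sum_congr rfl fun l _ => ?_
    simp only [frameRicAct, map_sum, map_smul, ← Finset.sum_neg_distrib, ← Finset.sum_smul,
      hR.sum_contr_left, neg_smul, hR.frameRic_comm l]
  simp only [frameCurvAct, map_sub, map_smul, Finset.sum_sub_distrib, ← Finset.smul_sum, h1, h2]
  simp only [map_sum, map_smul, h3]
  module

end CurvatureTerms

variable {H : Fin n → Fin n → Fin n → V}

/-- The trace terms in the Weitzenböck formulas, by contracting the Ricci identity. -/
lemma sum_sum_clifford_second (hR : IsCurvatureLike R) (hΓ : IsCliffordFamily Γ)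
    (hH : ∀ c a b, H c a b - H a c b = frameCurvAct Γ R φ c a b) (b : Fin n) :
    ∑ a, Γ a (frameGtr Γ (H a) b) = -∑ a, H a a b
      + (1 / 2 : ℝ) • ((frameScal R / 2) • φ b - frameRiemAct Γ R φ b) := by
  -- The symmetric part of `Γ a Γ l` is `-δ` and yields the rough Laplacian. The skew part sees only
  -- the commutator of derivatives, evaluated in `h2`.
  have h1 : ∑ a, ∑ l, Γ a (Γ l (H a l b)) = -(∑ a, ∑ l, Γ a (Γ l (H l a b)))
      - (2 : ℝ) • ∑ a, H a a b := by
    conv_lhs => rw [Finset.sum_comm]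
    rw [Finset.sum_congr rfl fun l _ => Finset.sum_congr rfl fun a _ => hΓ a l _]
    simp [Finset.sum_sub_distrib, ite_smul, Finset.smul_sum]
  have h2 : ∑ a, ∑ l, Γ a (Γ l (H a l b)) - ∑ a, ∑ l, Γ a (Γ l (H l a b))
      = (frameScal R / 2) • φ b - frameRiemAct Γ R φ b := by
    rw [← sum_clifford_frameCurvAct hΓ hR]
    simp only [← hH, map_sub, Finset.sum_sub_distrib]
  simp only [frameGtr, map_sum]
  rw [← h2]
  linear_combination (norm := module) (1 / 2 : ℝ) • h1

/-- Exchanging the two derivative indices turns `Γ_l H_{ala}` into `Γ_l H_{laa}`, which contains `H`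
only through its inner trace. The cost is the contracted curvature. -/
lemma sum_sum_clifford_trace (hR : IsCurvatureLike R) (hΓ : IsCliffordFamily Γ)
    (hH : ∀ c a b, H c a b - H a c b = frameCurvAct Γ R φ c a b) :
    ∑ a, frameGtr Γ (H a) a = ∑ a, Γ a (frameTr (H a))
      + (1 / 2 : ℝ) • frameRicContr Γ R φ := by
  rw [← sum_clifford_frameCurvAct_trace hΓ hR]
  have h1 : ∑ a, Γ a (frameTr (H a)) = ∑ a, ∑ l, Γ l (H l a a) := by
    simp only [frameTr, map_sum]
    rw [Finset.sum_comm]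
  rw [h1]
  simp only [← hH, map_sub, Finset.sum_sub_distrib, frameGtr]
  abel

/-- The transposed contraction `H_{aba}` occurs in the projections onto `Y` and `Z`. The Ricci
identity replaces it by the trace `H_{baa}`. -/
lemma sum_second_swap (hR : IsCurvatureLike R)
    (hH : ∀ c a b, H c a b - H a c b = frameCurvAct Γ R φ c a b) (b : Fin n) :
    ∑ a, H a b a = frameTr (H b) - (1 / 4 : ℝ) • frameRiemAct Γ R φ b + frameRicAct R φ b := by
  have h : ∑ a, H a b a - ∑ a, H b a a = ∑ a, frameCurvAct Γ R φ a b a := by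
    simp only [← hH, Finset.sum_sub_distrib]
  rw [sum_frameCurvAct hR] at h
  rw [frameTr]
  linear_combination (norm := module) h

/-- The component of `G_s* G_s φ` in an orthonormal frame, with `H = ∇∇φ`. -/
noncomputable def frameLap (Γ : Fin n → Module.End ℝ V) (H : Fin n → Fin n → Fin n → V)
    (s : Summand) (b : Fin n) : V :=
  -∑ a, frameProj Γ s (H a) a b

lemma sum_clifford_swap_trace (hΓ : IsCliffordFamily Γ) (H : Fin n → Fin n → Fin n → V)
    (b : Fin n) :
    ∑ a, Γ a (Γ b (frameTr (H a))) = -Γ b (∑ a, Γ a (frameTr (H a)))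
      - (2 : ℝ) • frameTr (H b) :=
  hΓ.sum_swap b fun a => frameTr (H a)

/-- The two Weitzenböck formulas in an orthonormal frame. -/
theorem frameLap_weitzenboeck (hn : 3 ≤ n) (hΓ : IsCliffordFamily Γ) (hR : IsCurvatureLike R)
    (hφ : ∑ a, Γ a (φ a) = 0)
    (hH : ∀ c a b, H c a b - H a c b = frameCurvAct Γ R φ c a b) (b : Fin n) :
    (((n : ℝ) - 3) * (n - 2) / (2 * n)) • frameLap Γ H .S b
        - (((n : ℝ) + 2) * (n - 3) / (2 * n)) • frameLap Γ H .T b + frameLap Γ H .Y b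
      = (1 / 8 : ℝ) • frameWeylAct Γ R φ b
        + (((n : ℝ) - 3) / (2 * (n - 2))) • frameEinsteinAct Γ R φ b
        - (((n : ℝ) - 2) * (n - 3) / (8 * n * (n - 1)) * frameScal R) • φ b ∧
    -(((n : ℝ) - 1) * (n + 2) / (2 * n)) • frameLap Γ H .S b
        - (((n : ℝ) + 1) * (n - 2) / (2 * n)) • frameLap Γ H .T b + frameLap Γ H .Z b
      = (3 / 8 : ℝ) • frameWeylAct Γ R φ b
        - (((n : ℝ) + 1) / (2 * (n - 2))) • frameEinsteinAct Γ R φ b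
        - (((n : ℝ) + 2) * (n + 1) / (8 * n * (n - 1)) * frameScal R) • φ b := by
  have hn' : (3 : ℝ) ≤ n := by exact_mod_cast hn
  have h0 : (n : ℝ) ≠ 0 := by positivity
  have h1 : (n : ℝ) - 1 ≠ 0 := by linarith
  have h2 : (n : ℝ) - 2 ≠ 0 := by linarith
  have h3 : (n : ℝ) + 2 ≠ 0 := by positivity
  have e1 := sum_sum_clifford_second hR hΓ hH b
  have e2 := congrArg (Γ b) (sum_sum_clifford_trace hR hΓ hH)
  have e3 := sum_second_swap hR hH b
  have e4 := sum_clifford_swap_trace hΓ H b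
  have e5 : ∑ a, (2 * if a = b then (1 : ℝ) else 0) • frameTr (H a)
      = (2 : ℝ) • frameTr (H b) := by simp [ite_smul]
  rw [map_add, map_smul] at e2
  rw [frameWeylAct_eq hΓ hR hφ hn, frameEinsteinAct_eq hΓ hφ hn]
  simp only [frameLap, frameProj, Finset.sum_add_distrib, Finset.sum_sub_distrib,
    ← Finset.smul_sum, ← map_sum, e1, e2, e3, e4, e5]
  -- The only second-order terms left are `∑ a, H a a b`, `frameTr (H b)` and `Γ b (∑ a, Γ a
  -- (frameTr (H a)))`. In both combinations their coefficients vanish, and the curvature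
  -- coefficients agree.
  constructor
  · match_scalars <;> field_simp <;> ring
  · match_scalars <;> field_simp <;> ring

end Weitzenboeck

end SpinGeom

namespace SpinGeom

/-! ### Directional derivatives on manifolds -/

section DirectionalDerivative

open scoped Topology

variable {n : ℕ} {M : Type*} [TopologicalSpace M] [ChartedSpace (EuclideanSpace ℝ (Fin n)) M]
  {F : Type*} [NormedAddCommGroup F] [NormedSpace ℝ F]

variable (n) in
/-- Smoothness of a vector-valued function on a set. -/
abbrev SmoothFun (U : Set M) (g : M → F) : Prop := ContMDiffOn (𝓡 n) 𝓘(ℝ, F) ∞ g U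

variable (n) in
/-- Differentiability of a vector-valued function at a point. -/
abbrev DiffFunAt (g : M → F) (x : M) : Prop := MDifferentiableAt (𝓡 n) 𝓘(ℝ, F) g x

/-- Smoothness of a vector field on a set. -/
abbrev SmoothField [IsManifold (𝓡 n) ∞ M] (U : Set M) (V : (x : M) → TangentSpace (𝓡 n) x) : Prop :=
  ContMDiffOn (𝓡 n) ((𝓡 n).prod 𝓘(ℝ, EuclideanSpace ℝ (Fin n))) ∞
    (fun x => TotalSpace.mk' (EuclideanSpace ℝ (Fin n)) x (V x)) U

/-- Differentiability of a vector field at a point. -/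
abbrev DiffFieldAt [IsManifold (𝓡 n) ∞ M] (V : (x : M) → TangentSpace (𝓡 n) x) (x : M) : Prop :=
  MDifferentiableAt (𝓡 n) ((𝓡 n).prod 𝓘(ℝ, EuclideanSpace ℝ (Fin n)))
    (fun x => TotalSpace.mk' (EuclideanSpace ℝ (Fin n)) x (V x)) x

lemma SmoothFun.diffAt {U : Set M} (hU : IsOpen U) {g : M → F} (hg : SmoothFun n U g) {x : M}
    (hx : x ∈ U) : DiffFunAt n g x :=
  (hg.contMDiffAt (hU.mem_nhds hx)).mdifferentiableAt (by simp)

lemma mvfderiv_sum {ι : Type*} (s : Finset ι) {g : ι → M → F} {x : M}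
    (hg : ∀ i ∈ s, DiffFunAt n (g i) x) :
    mvfderiv (𝓡 n) (fun y => ∑ i ∈ s, g i y) x = ∑ i ∈ s, mvfderiv (𝓡 n) (g i) x ∧
      DiffFunAt n (fun y => ∑ i ∈ s, g i y) x := by
  classical
  induction s using Finset.induction_on with
  | empty => simp [mvfderiv_const, mdifferentiableAt_const]
  | insert a s ha ih =>
    simp only [Finset.sum_insert ha]
    have h1 := ih fun i hi => hg i (Finset.mem_insert_of_mem hi)
    have h2 := hg a (Finset.mem_insert_self _ _)
    exact ⟨by rw [mvfderiv_fun_add h2 h1.2, h1.1], h2.add h1.2⟩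

lemma mvfderiv_clm_apply {G : Type*} [NormedAddCommGroup G] [NormedSpace ℝ G] (L : F →L[ℝ] G)
    {g : M → F} {x : M} (hg : DiffFunAt n g x) (v : TangentSpace (𝓡 n) x) :
    mvfderiv (𝓡 n) (fun y => L (g y)) x v = L (mvfderiv (𝓡 n) g x v) := by
  have h : MDifferentiableAt 𝓘(ℝ, F) 𝓘(ℝ, G) L (g x) := L.differentiableAt.mdifferentiableAt
  have := mfderiv_comp x h hg
  rw [mfderiv_eq_fderiv, L.fderiv] at this
  exact congr($this v)

lemma DiffFunAt.clm_apply {G : Type*} [NormedAddCommGroup G] [NormedSpace ℝ G] (L : F →L[ℝ] G)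
    {g : M → F} {x : M} (hg : DiffFunAt n g x) : DiffFunAt n (fun y => L (g y)) x := by
  have h : MDifferentiableAt 𝓘(ℝ, F) 𝓘(ℝ, G) L (g x) := L.differentiableAt.mdifferentiableAt
  exact h.comp x hg

lemma SmoothFun.clm_apply {G : Type*} [NormedAddCommGroup G] [NormedSpace ℝ G] (L : F →L[ℝ] G)
    {g : M → F} {U : Set M} (hg : SmoothFun n U g) : SmoothFun n U (fun y => L (g y)) :=
  L.contMDiff.comp_contMDiffOn hg

lemma mvfderiv_congr {g g' : M → F} {x : M} (h : g =ᶠ[𝓝 x] g') :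
    mvfderiv (𝓡 n) g x = mvfderiv (𝓡 n) g' x := by
  ext v
  exact congr($(h.mfderiv_eq (I := 𝓡 n) (I' := 𝓘(ℝ, F))) v)

lemma mvfderiv_eq_zero_of_eventually {g : M → F} {c : F} {x : M} (h : ∀ᶠ y in 𝓝 x, g y = c) :
    mvfderiv (𝓡 n) g x = 0 := by
  rw [mvfderiv_congr (g' := fun _ => c) h, mvfderiv_const]

lemma SmoothFun.sum {ι : Type*} [Fintype ι] {U : Set M}
    {g : ι → M → F} (hg : ∀ i, SmoothFun n U (g i)) : SmoothFun n U (fun y => ∑ i, g i y) :=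
  fun x hx => ContMDiffWithinAt.sum fun i _ => hg i x hx

lemma mvfderiv_sum_smul {ι : Type*} (t : Finset ι)
    {g : ι → M → ℝ} {c : ι → M → F} {x : M}
    (hg : ∀ i ∈ t, DiffFunAt n (g i) x) (hc : ∀ i ∈ t, DiffFunAt n (c i) x)
    (u : TangentSpace (𝓡 n) x) :
    mvfderiv (𝓡 n) (fun y => ∑ i ∈ t, g i y • c i y) x u =
      ∑ i ∈ t, (mvfderiv (𝓡 n) (g i) x u • c i x + g i x • mvfderiv (𝓡 n) (c i) x u) := by
  rw [(mvfderiv_sum (g := fun i y => g i y • c i y) t fun i hi => (hg i hi).smul (hc i hi)).1,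
    sum_apply]
  refine Finset.sum_congr rfl fun i hi => ?_
  rw [mvfderiv_fun_smul (hg i hi) (hc i hi)]
  simp [add_comm]

lemma mvfderiv_add_apply {g h : M → F} {x : M}
    (hg : DiffFunAt n g x) (hh : DiffFunAt n h x) (u : TangentSpace (𝓡 n) x) :
    mvfderiv (𝓡 n) (fun y => g y + h y) x u = mvfderiv (𝓡 n) g x u + mvfderiv (𝓡 n) h x u := by
  rw [mvfderiv_fun_add hg hh, add_apply]

variable [IsManifold (𝓡 n) ∞ M]

lemma SmoothField.diffAt {U : Set M} (hU : IsOpen U) {V : (x : M) → TangentSpace (𝓡 n) x}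
    (hV : SmoothField U V) {x : M} (hx : x ∈ U) : DiffFieldAt V x :=
  (hV.contMDiffAt (hU.mem_nhds hx)).mdifferentiableAt (by simp)

lemma SmoothFun.mvfderiv_apply {g : M → F} {V : (x : M) → TangentSpace (𝓡 n) x} {U : Set M}
    (hU : IsOpen U) (hg : SmoothFun n U g) (hV : SmoothField U V) :
    SmoothFun n U (fun y => mvfderiv (𝓡 n) g y (V y)) := by
  intro x hx
  have hgx := hg.contMDiffAt (hU.mem_nhds hx)
  have hVx := hV.contMDiffAt (hU.mem_nhds hx)
  have h1 := hgx.mfderiv_const (m := ∞) (by simp)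
  have h2 := ContMDiffAt.clm_apply_of_inCoordinates (IM := 𝓡 n) (IB₁ := 𝓡 n) (IB₂ := 𝓘(ℝ, F))
      (n := ∞)
    (E₁ := fun x : M => TangentSpace (𝓡 n) x)
    (E₂ := fun x : F => TangentSpace 𝓘(ℝ, F) x) (b₁ := fun y : M => y) (b₂ := g)
    (ϕ := fun y => mfderiv (𝓡 n) 𝓘(ℝ, F) g y) (v := V) (m₀ := x) h1 hVx hgx
  have h3 := (contMDiff_snd_tangentBundle_modelSpace F 𝓘(ℝ, F) (n := ∞)).contMDiffAt.comp x h2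
  exact h3.contMDiffWithinAt

lemma SmoothField.mlieBracket {U : Set M} (hU : IsOpen U) {X Y : (x : M) → TangentSpace (𝓡 n) x}
    (hX : SmoothField U X) (hY : SmoothField U Y) :
    SmoothField U (mlieBracket (𝓡 n) X Y) := by
  intro x hx
  have : IsManifold (𝓡 n) (minSmoothness ℝ 2) M := by
    rw [minSmoothness_of_isRCLikeNormedField]
    infer_instance
  have : IsManifold (𝓡 n) (((⊤ : ℕ∞) : WithTop ℕ∞) + 1) M := by
    simpa using (inferInstance : IsManifold (𝓡 n) ∞ M)
  exact (ContMDiffAt.mlieBracket_vectorField (m := ⊤) (n := ⊤) (hX.contMDiffAt (hU.mem_nhds hx))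
    (hY.contMDiffAt (hU.mem_nhds hx)) (by simp)).contMDiffWithinAt

lemma exists_smoothField_extend {x : M} (v : TangentSpace (𝓡 n) x) :
    ∃ U : Set M, IsOpen U ∧ x ∈ U ∧ SmoothField U (extend (EuclideanSpace ℝ (Fin n)) v) := by
  obtain ⟨s, hs, h⟩ := exists_contMDiffOn_extend (k := ∞) (𝓡 n) (EuclideanSpace ℝ (Fin n)) v
  obtain ⟨U, hUs, hU, hx⟩ := mem_nhds_iff.1 hs
  exact ⟨U, hU, hx, h.mono hUs⟩

lemma mlieBracket_smul_eventuallyEq {U : Set M} (hU : IsOpen U) {g : M → ℝ}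
    {Y W : (x : M) → TangentSpace (𝓡 n) x} (hg : SmoothFun n U g)
    (hW : SmoothField U W) {x : M} (hx : x ∈ U) :
    mlieBracket (𝓡 n) Y (g • W) =ᶠ[𝓝 x]
      (fun y => mvfderiv (𝓡 n) g y (Y y)) • W + g • mlieBracket (𝓡 n) Y W := by
  filter_upwards [hU.mem_nhds hx] with y hy
  exact mlieBracket_smul_right (hg.diffAt hU hy) (hW.diffAt hU hy)

lemma mlieBracket_mlieBracket_smul {U : Set M} (hU : IsOpen U) {g : M → ℝ}
    {X Y W : (x : M) → TangentSpace (𝓡 n) x} (hg : SmoothFun n U g)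
    (hY : SmoothField U Y) (hW : SmoothField U W) {x : M} (hx : x ∈ U) :
    mlieBracket (𝓡 n) X (mlieBracket (𝓡 n) Y (g • W)) x =
      mvfderiv (𝓡 n) (fun y => mvfderiv (𝓡 n) g y (Y y)) x (X x) • W x
        + mvfderiv (𝓡 n) g x (Y x) • mlieBracket (𝓡 n) X W x
        + (mvfderiv (𝓡 n) g x (X x) • mlieBracket (𝓡 n) Y W x
        + g x • mlieBracket (𝓡 n) X (mlieBracket (𝓡 n) Y W) x) := by
  have hd := (SmoothFun.mvfderiv_apply hU hg hY)
  have hb := hY.mlieBracket hU hW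
  rw [Filter.EventuallyEq.mlieBracket_vectorField_eq (Filter.EventuallyEq.refl _ X)
    (mlieBracket_smul_eventuallyEq hU hg hW hx),
    mlieBracket_add_right, mlieBracket_smul_right (hd.diffAt hU hx) (hW.diffAt hU hx),
    mlieBracket_smul_right (hg.diffAt hU hx) (hb.diffAt hU hx)]
  · exact SmoothField.diffAt hU (hd.smul_section hW) hx
  · exact SmoothField.diffAt hU (hg.smul_section hb) hx

/-- The Lie bracket of vector fields is the commutator of derivations, on scalar functions. -/
lemma mvfderiv_mlieBracket_real [NeZero n] {U : Set M} (hU : IsOpen U) {g : M → ℝ}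
    {X Y : (x : M) → TangentSpace (𝓡 n) x} (hg : SmoothFun n U g) (hX : SmoothField U X)
    (hY : SmoothField U Y) {x : M} (hx : x ∈ U) :
    mvfderiv (𝓡 n) g x (mlieBracket (𝓡 n) X Y x) =
      mvfderiv (𝓡 n) (fun y => mvfderiv (𝓡 n) g y (Y y)) x (X x)
        - mvfderiv (𝓡 n) (fun y => mvfderiv (𝓡 n) g y (X y)) x (Y x) := by
  -- The claim is extracted from the Jacobi identity by testing it on `g • W` with `W` nonzero at
  -- `x`; a nonzero tangent vector exists since `n ≠ 0`.
  obtain ⟨v, hv⟩ : ∃ v : TangentSpace (𝓡 n) x, v ≠ 0 :=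
    haveI : Nontrivial (EuclideanSpace ℝ (Fin n)) := inferInstance
    exists_ne (0 : EuclideanSpace ℝ (Fin n))
  obtain ⟨U', hU', hx', hW'⟩ := exists_smoothField_extend v
  set W := extend (EuclideanSpace ℝ (Fin n)) v
  have hO := hU.inter hU'
  have hxO : x ∈ U ∩ U' := ⟨hx, hx'⟩
  have hX := hX.mono (Set.inter_subset_left (t := U'))
  have hY := hY.mono (Set.inter_subset_left (t := U'))
  have hg := hg.mono (Set.inter_subset_left (t := U'))
  have hW : SmoothField (U ∩ U') W := hW'.mono Set.inter_subset_right
  have two : ∀ {Z : (x : M) → TangentSpace (𝓡 n) x}, SmoothField (U ∩ U') Z →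
      ContMDiffAt (𝓡 n) ((𝓡 n).prod 𝓘(ℝ, EuclideanSpace ℝ (Fin n))) (minSmoothness ℝ 2)
        (fun x => TotalSpace.mk' (EuclideanSpace ℝ (Fin n)) x (Z x)) x := by
    intro Z hZ
    rw [minSmoothness_of_isRCLikeNormedField]
    exact (hZ.contMDiffAt (hO.mem_nhds hxO)).of_le ENat.LEInfty.out
  have : IsManifold (𝓡 n) (minSmoothness ℝ 3) M := by
    rw [minSmoothness_of_isRCLikeNormedField]
    infer_instance
  -- Subtracting `g` times the Jacobi identity for `X, Y, W` from the one for `X, Y, g • W` leaves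
  -- the required scalar identity multiplied by `W x`.
  have j1 := leibniz_identity_mlieBracket_apply (two hX) (two hY) (two (hg.smul_section hW))
  have j2 := leibniz_identity_mlieBracket_apply (two hX) (two hY) (two hW)
  rw [mlieBracket_mlieBracket_smul hO hg hY hW hxO, mlieBracket_mlieBracket_smul hO hg hX hW hxO,
    mlieBracket_smul_right (SmoothFun.diffAt hO hg hxO) (hW.diffAt hO hxO), j2] at j1
  have hWx : W x = v := extend_apply_self _ v
  rw [hWx] at j1
  have j3 : (mvfderiv (𝓡 n) g x (mlieBracket (𝓡 n) X Y x) -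
      (mvfderiv (𝓡 n) (fun y => mvfderiv (𝓡 n) g y (Y y)) x (X x)
        - mvfderiv (𝓡 n) (fun y => mvfderiv (𝓡 n) g y (X y)) x (Y x))) • v = 0 := by
    linear_combination (norm := module) -j1
  exact sub_eq_zero.1 ((smul_eq_zero.1 j3).resolve_right hv)

/-- The Lie bracket of vector fields is the commutator of derivations. -/
lemma mvfderiv_mlieBracket [NeZero n] {U : Set M} (hU : IsOpen U) {g : M → F}
    {X Y : (x : M) → TangentSpace (𝓡 n) x} (hg : SmoothFun n U g) (hX : SmoothField U X)
    (hY : SmoothField U Y) {x : M} (hx : x ∈ U) :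
    mvfderiv (𝓡 n) g x (mlieBracket (𝓡 n) X Y x) =
      mvfderiv (𝓡 n) (fun y => mvfderiv (𝓡 n) g y (Y y)) x (X x)
        - mvfderiv (𝓡 n) (fun y => mvfderiv (𝓡 n) g y (X y)) x (Y x) := by
  -- Continuous functionals commute with directional derivatives and separate points of `F`, so the
  -- scalar case suffices.
  have key : ∀ {Z Z' : (x : M) → TangentSpace (𝓡 n) x} (L : F →L[ℝ] ℝ), SmoothField U Z →
      mvfderiv (𝓡 n) (fun y => mvfderiv (𝓡 n) (fun z => L (g z)) y (Z y)) x (Z' x)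
        = L (mvfderiv (𝓡 n) (fun y => mvfderiv (𝓡 n) g y (Z y)) x (Z' x)) := by
    intro Z Z' L hZ
    rw [← mvfderiv_clm_apply L ((SmoothFun.mvfderiv_apply hU hg hZ).diffAt hU hx)]
    congr 1
    refine mvfderiv_congr ?_
    filter_upwards [hU.mem_nhds hx] with y hy
    exact mvfderiv_clm_apply L (hg.diffAt hU hy) _
  by_contra hne
  obtain ⟨L, hL⟩ := SeparatingDual.exists_separating_of_ne (R := ℝ) hne
  apply hL
  rw [map_sub, ← key L hX, ← key L hY, ← mvfderiv_clm_apply L (hg.diffAt hU hx)]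
  exact mvfderiv_mlieBracket_real hU (hg.clm_apply L) hX hY hx

end DirectionalDerivative
end SpinGeom

namespace SpinGeom

section Frames

open scoped Topology

variable {n : ℕ}
  {M : Type*} [TopologicalSpace M] [ChartedSpace (EuclideanSpace ℝ (Fin n)) M]
  [IsManifold (𝓡 n) ∞ M]
  [RiemannianBundle (fun x : M => TangentSpace (𝓡 n) x)]
  {Δ : Type*} [NormedAddCommGroup Δ] [InnerProductSpace ℂ Δ]
  {S : M → Type*} [∀ x, NormedAddCommGroup (S x)] [∀ x, InnerProductSpace ℂ (S x)]
  [TopologicalSpace (TotalSpace Δ S)] [FiberBundle Δ S]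

/-! ### Orthonormal frames and contractions -/

omit [IsManifold (𝓡 n) ∞ M] in
/-- Contractions may be computed in any orthonormal basis. -/
lemma contr_eq_sum {V : Type*} [AddCommGroup V] [Module ℝ V] {x : M} {ι : Type*} [Fintype ι]
    (b : OrthonormalBasis ι ℝ (TangentSpace (𝓡 n) x))
    {B : TangentSpace (𝓡 n) x → TangentSpace (𝓡 n) x → V} (hB : IsBilinearMap ℝ B) :
    contr x B = ∑ a, B (b a) (b a) := by
  classical
  have h : ∀ i, B (onb x i) (onb x i)
      = ∑ a, ∑ c, ((inner ℝ (b a) (onb x i) : ℝ) * inner ℝ (b c) (onb x i)) • B (b a) (b c) := by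
    intro i
    conv_lhs => rw [← b.sum_repr' (onb x i)]
    change hB.toLinearMap (∑ a, _) (∑ c, _) = _
    rw [map_sum, Finset.sum_comm]
    refine Finset.sum_congr rfl fun c _ => ?_
    rw [map_sum, LinearMap.sum_apply]
    refine Finset.sum_congr rfl fun a _ => ?_
    rw [map_smul, map_smul, LinearMap.smul_apply, smul_smul, mul_comm]
    rfl
  have h2 : ∀ a c, ∑ i, (inner ℝ (b a) (onb x i) : ℝ) * inner ℝ (b c) (onb x i)
      = if a = c then 1 else 0 := by
    intro a c
    rw [← orthonormal_iff_ite.1 b.orthonormal a c, ← (onb x).sum_inner_mul_inner (b a) (b c)]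
    exact Finset.sum_congr rfl fun i _ => by rw [real_inner_comm (b c)]
  simp only [contr, h]
  rw [Finset.sum_comm]
  refine Finset.sum_congr rfl fun a _ => ?_
  rw [Finset.sum_comm]
  simp only [← Finset.sum_smul, h2]
  simp

namespace SpinFrame

variable (f : SpinFrame n M Δ S)

/-- The orthonormal basis of a tangent space given by a spin frame. -/
noncomputable def basis {x : M} (hx : x ∈ f.dom) :
    OrthonormalBasis (Fin n) ℝ (TangentSpace (𝓡 n) x) :=
  OrthonormalBasis.mk (f.orthonormal_vec x hx)
    ((f.orthonormal_vec x hx).linearIndependent.span_eq_top_of_card_eq_finrank' (by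
      rw [Fintype.card_fin]
      exact (finrank_euclideanSpace_fin (𝕜 := ℝ) (n := n)).symm)).ge

@[simp]
lemma basis_apply {x : M} (hx : x ∈ f.dom) (a : Fin n) : f.basis hx a = f.vec a x := by
  simp [basis]

lemma sum_inner_smul_vec {x : M} (hx : x ∈ f.dom) (v : TangentSpace (𝓡 n) x) :
    ∑ a, (inner ℝ v (f.vec a x) : ℝ) • f.vec a x = v := by
  conv_rhs => rw [← (f.basis hx).sum_repr' v]
  simp only [basis_apply, real_inner_comm]

lemma contr_eq {V : Type*} [AddCommGroup V] [Module ℝ V] {x : M} (hx : x ∈ f.dom)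
    {B : TangentSpace (𝓡 n) x → TangentSpace (𝓡 n) x → V} (hB : IsBilinearMap ℝ B) :
    contr x B = ∑ a, B (f.vec a x) (f.vec a x) := by
  simp [contr_eq_sum (f.basis hx) hB]

lemma inner_vec {x : M} (hx : x ∈ f.dom) (a b : Fin n) :
    (inner ℝ (f.vec a x) (f.vec b x) : ℝ) = if a = b then 1 else 0 :=
  orthonormal_iff_ite.1 (f.orthonormal_vec x hx) a b

lemma smooth (a : Fin n) : SmoothField f.dom (f.vec a) := f.smooth_vec a

lemma spin_real_smul (x : M) (r : ℝ) (ψ : Δ) : f.spin x (r • ψ) = r • f.spin x ψ :=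
  ((f.spin x).toLinearEquiv.restrictScalars ℝ).map_smul r ψ

end SpinFrame

end Frames
end SpinGeom

namespace SpinGeom

section TangentConnection

open scoped Topology

variable {n : ℕ}
  {M : Type*} [TopologicalSpace M] [ChartedSpace (EuclideanSpace ℝ (Fin n)) M]
  [IsManifold (𝓡 n) ∞ M]

/-! ### The Levi-Civita connection on smooth local fields -/

variable {covT : CovariantDerivative (𝓡 n) (EuclideanSpace ℝ (Fin n))
      (fun x : M => TangentSpace (𝓡 n) x)}

lemma cov_congr {V W : (x : M) → TangentSpace (𝓡 n) x} {x : M} (hV : DiffFieldAt V x)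
    (hW : DiffFieldAt W x) (h : ∀ᶠ y in 𝓝 x, V y = W y) : covT V x = covT W x :=
  covT.isCovariantDerivativeOn.congr_of_eventuallyEq hV hW Filter.univ_mem h

lemma cov_add {V W : (x : M) → TangentSpace (𝓡 n) x} {x : M} (hV : DiffFieldAt V x)
    (hW : DiffFieldAt W x) (u : TangentSpace (𝓡 n) x) :
    covT (fun y => V y + W y) x u = covT V x u + covT W x u :=
  congr($(covT.isCovariantDerivativeOn.add hV hW) u)

lemma cov_smul {g : M → ℝ} {W : (x : M) → TangentSpace (𝓡 n) x} {x : M} (hg : DiffFunAt n g x)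
    (hW : DiffFieldAt W x) (u : TangentSpace (𝓡 n) x) :
    covT (fun y => g y • W y) x u = g x • covT W x u + mvfderiv (𝓡 n) g x u • W x :=
  congr($(covT.isCovariantDerivativeOn.leibniz hW hg) u)

/-- Near a point, a smooth local field and its covariant derivative agree with
those of a global one. -/
lemma exists_smoothField_univ [T2Space M] {U : Set M} (hU : IsOpen U)
    {W : (x : M) → TangentSpace (𝓡 n) x} (hW : SmoothField U W) {x : M} (hx : x ∈ U) :
    ∃ W' : (x : M) → TangentSpace (𝓡 n) x, SmoothField Set.univ W' ∧
      (∀ᶠ y in 𝓝 x, W y = W' y) ∧ ∀ᶠ y in 𝓝 x, covT W y = covT W' y := by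
  obtain ⟨χ, -, hχ⟩ := (SmoothBumpFunction.nhds_basis_tsupport (I := 𝓡 n) x).mem_iff.1
    (hU.mem_nhds hx)
  have hs : SmoothField Set.univ (⇑χ • W) :=
    (ContMDiffOn.smul_section_of_tsupport χ.contMDiff.contMDiffOn hU hχ hW).contMDiffOn
  have he : ∀ᶠ y in 𝓝 x, W y = (⇑χ • W) y := by
    filter_upwards [χ.eventuallyEq_one] with y hy
    simp [hy]
  refine ⟨_, hs, he, ?_⟩
  filter_upwards [he.eventually_nhds, hU.mem_nhds hx] with y hy hyU
  exact cov_congr (hW.diffAt hU hyU) (hs.diffAt isOpen_univ trivial) hy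

section LeviCivita

variable [RiemannianBundle (fun x : M => TangentSpace (𝓡 n) x)]
  [IsContMDiffRiemannianBundle (𝓡 n) ∞ (EuclideanSpace ℝ (Fin n))
      (fun x : M => TangentSpace (𝓡 n) x)]

lemma SmoothField.inner {U : Set M} {V W : (x : M) → TangentSpace (𝓡 n) x} (hV : SmoothField U V)
    (hW : SmoothField U W) : SmoothFun n U (fun y => (inner ℝ (V y) (W y) : ℝ)) :=
  ContMDiffOn.inner_bundle hV hW

lemma DiffFieldAt.inner {x : M} {V W : (x : M) → TangentSpace (𝓡 n) x} (hV : DiffFieldAt V x)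
    (hW : DiffFieldAt W x) : DiffFunAt n (fun y => (inner ℝ (V y) (W y) : ℝ)) x :=
  have : IsContMDiffRiemannianBundle (𝓡 n) 1 (EuclideanSpace ℝ (Fin n))
      (fun x : M => TangentSpace (𝓡 n) x) := .of_le (n := ∞) (by simp)
  MDifferentiableAt.inner_bundle hV hW


variable (hT : IsLeviCivita covT)
include hT

set_option synthInstance.maxHeartbeats 200000 in
lemma IsLeviCivita.contMDiff_cov {W : (x : M) → TangentSpace (𝓡 n) x}
    (hW : SmoothField Set.univ W) :
    ContMDiff (𝓡 n) ((𝓡 n).prod 𝓘(ℝ, EuclideanSpace ℝ (Fin n) →L[ℝ] EuclideanSpace ℝ (Fin n))) ∞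
      (fun x => TotalSpace.mk' (EuclideanSpace ℝ (Fin n) →L[ℝ] EuclideanSpace ℝ (Fin n))
        (E := fun x : M => TangentSpace (𝓡 n) x →L[ℝ] TangentSpace (𝓡 n) x) x (covT W x)) := by
  have := hT.smooth.contMDiff.contMDiff (σ := W) (by simpa using hW)
  exact contMDiffOn_univ.1 this

/-- Smoothness of the connection is used for fields on all of `M`. A local field is therefore first
replaced, near each point, by a global one with the same covariant derivative. -/
lemma IsLeviCivita.smoothField_cov [T2Space M] {U : Set M} (hU : IsOpen U)
    {V W : (x : M) → TangentSpace (𝓡 n) x} (hW : SmoothField U W) (hV : SmoothField U V) :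
    SmoothField U (fun y => covT W y (V y)) := by
  intro x hx
  obtain ⟨W', hW', -, he⟩ := exists_smoothField_univ (covT := covT) hU hW hx
  have h := ContMDiffAt.clm_bundle_apply (hT.contMDiff_cov hW' x) (hV.contMDiffAt (hU.mem_nhds hx))
  refine (h.congr_of_eventuallyEq ?_).contMDiffWithinAt
  filter_upwards [he] with y hy
  rw [hy]

/-- Here the direction field need only be differentiable at the point; tensoriality of the curvature
is tested on such fields. -/
lemma IsLeviCivita.diffFieldAt_cov [T2Space M] {U : Set M} (hU : IsOpen U)
    {V W : (x : M) → TangentSpace (𝓡 n) x} (hW : SmoothField U W) {x : M} (hx : x ∈ U)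
    (hV : DiffFieldAt V x) : DiffFieldAt (fun y => covT W y (V y)) x := by
  obtain ⟨W', hW', -, he⟩ := exists_smoothField_univ (covT := covT) hU hW hx
  have h := MDifferentiableAt.clm_bundle_apply
    ((hT.contMDiff_cov hW' x).mdifferentiableAt (by simp)) hV
  refine h.congr_of_eventuallyEq ?_
  filter_upwards [he] with y hy
  rw [hy]

lemma IsLeviCivita.mvfderiv_inner {V W : (x : M) → TangentSpace (𝓡 n) x} {x : M}
    (hV : DiffFieldAt V x) (hW : DiffFieldAt W x) (u : TangentSpace (𝓡 n) x) :
    mvfderiv (𝓡 n) (fun y => (inner ℝ (V y) (W y) : ℝ)) x u =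
      inner ℝ (covT V x u) (W x) + inner ℝ (V x) (covT W x u) := by
  have : IsContMDiffRiemannianBundle (𝓡 n) 1 (EuclideanSpace ℝ (Fin n))
      (fun x : M => TangentSpace (𝓡 n) x) := .of_le (n := ∞) (by simp)
  have h := hT.metric.mvfderiv_inner_eq (extend (EuclideanSpace ℝ (Fin n)) u) hV hW
  simpa using h

lemma IsLeviCivita.mlieBracket_eq {V W : (x : M) → TangentSpace (𝓡 n) x} {x : M}
    (hV : DiffFieldAt V x) (hW : DiffFieldAt W x) :
    mlieBracket (𝓡 n) V W x = covT W x (V x) - covT V x (W x) := by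
  have h := covT.torsion_eq_zero_iff.1 hT.torsion_eq_zero hV hW
  rw [h]

end LeviCivita
end TangentConnection
end SpinGeom

namespace SpinGeom

open scoped Topology

/-! ### The model Clifford multiplication -/

section Model

variable {n : ℕ} {Δ : Type*} [NormedAddCommGroup Δ] [InnerProductSpace ℂ Δ]

/-- Clifford multiplication by the generators, as a family of real operators. -/
noncomputable def SpinorModule.gen (ρ : SpinorModule n Δ) (a : Fin n) : Module.End ℝ Δ :=
  (ρ.rho (cliffordGen n a)).restrictScalars ℝ

lemma SpinorModule.gen_apply (ρ : SpinorModule n Δ) (a : Fin n) (ψ : Δ) :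
    ρ.gen a ψ = ρ.rho (cliffordGen n a) ψ := rfl

lemma polar_negForm_single (a b : Fin n) :
    QuadraticMap.polar (negForm n) (Pi.single a 1) (Pi.single b 1) = -if a = b then 2 else 0 := by
  have h : ∀ v w : Fin n → ℝ, QuadraticMap.polar (negForm n) v w = -2 * ∑ i, v i * w i := by
    intro v w
    simp only [QuadraticMap.polar, QuadraticMap.weightedSumSquares_apply, smul_eq_mul,
      ← Finset.sum_sub_distrib, Pi.add_apply, Finset.mul_sum]
    exact Finset.sum_congr rfl fun i _ => by ring
  rw [h]
  rcases eq_or_ne a b with rfl | h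
  · simp [Pi.single_apply]
  · simp [Pi.single_apply, h.symm, h]

lemma SpinorModule.isCliffordFamily_gen (ρ : SpinorModule n Δ) : IsCliffordFamily ρ.gen := by
  intro a b ψ
  have h := congrArg ρ.rho (CliffordAlgebra.ι_mul_ι_add_swap (Q := negForm n) (Pi.single a 1)
    (Pi.single b 1))
  rw [map_add, map_mul, map_mul, polar_negForm_single, AlgHom.commutes] at h
  have h2 := congr($h ψ)
  rw [Module.algebraMap_end_apply] at h2
  change ρ.gen a (ρ.gen b ψ) + ρ.gen b (ρ.gen a ψ) = _ at h2
  linear_combination (norm := module) h2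

lemma SpinorModule.re_inner_gen (ρ : SpinorModule n Δ) (a : Fin n) (ψ χ : Δ) :
    (inner ℂ (ρ.gen a ψ) χ).re = -(inner ℂ ψ (ρ.gen a χ)).re :=
  congrArg Complex.re (ρ.skew (Pi.single a 1) ψ χ)

end Model

/-! ### Local calculus of spinor fields -/

section SpinorFields

variable {n : ℕ}
  {M : Type*} [TopologicalSpace M] [ChartedSpace (EuclideanSpace ℝ (Fin n)) M]
  [IsManifold (𝓡 n) ∞ M]
  {Δ : Type*} [NormedAddCommGroup Δ] [InnerProductSpace ℂ Δ]
  {S : M → Type*} [∀ x, NormedAddCommGroup (S x)] [∀ x, InnerProductSpace ℂ (S x)]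
  [TopologicalSpace (TotalSpace Δ S)] [FiberBundle Δ S] [VectorBundle ℝ Δ S]

variable (n Δ) in
/-- Smoothness of a spinor field on a set. -/
abbrev SmoothSpinor (U : Set M) (s : (x : M) → S x) : Prop :=
  ContMDiffOn (𝓡 n) ((𝓡 n).prod 𝓘(ℝ, Δ)) ∞ (fun x => TotalSpace.mk' Δ x (s x)) U

variable (n Δ) in
/-- Differentiability of a spinor field at a point. -/
abbrev DiffSpinorAt (s : (x : M) → S x) (x : M) : Prop :=
  MDifferentiableAt (𝓡 n) ((𝓡 n).prod 𝓘(ℝ, Δ)) (fun x => TotalSpace.mk' Δ x (s x)) x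

omit [IsManifold (𝓡 n) ∞ M] in
lemma diffSpinorAt_sum_smul {ι : Type*} (t : Finset ι) {g : ι → M → ℝ} {s : ι → (x : M) → S x}
    {x : M} (hg : ∀ i ∈ t, DiffFunAt n (g i) x) (hs : ∀ i ∈ t, DiffSpinorAt n Δ (s i) x) :
    DiffSpinorAt n Δ (fun y => ∑ i ∈ t, g i y • s i y) x :=
  .sum_section fun i hi => (hg i hi).smul_section (hs i hi)

section CovS

variable {covS : CovariantDerivative (𝓡 n) Δ S}

omit [IsManifold (𝓡 n) ∞ M] [VectorBundle ℝ Δ S] in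
lemma covS_congr {V W : (x : M) → S x} {x : M} (hV : DiffSpinorAt n Δ V x)
    (hW : DiffSpinorAt n Δ W x) (h : ∀ᶠ y in 𝓝 x, V y = W y) : covS V x = covS W x :=
  covS.isCovariantDerivativeOn.congr_of_eventuallyEq hV hW Filter.univ_mem h

omit [IsManifold (𝓡 n) ∞ M] in
lemma covS_sum_smul {ι : Type*} (t : Finset ι) {g : ι → M → ℝ} {s : ι → (x : M) → S x}
    {x : M} (hg : ∀ i ∈ t, DiffFunAt n (g i) x) (hs : ∀ i ∈ t, DiffSpinorAt n Δ (s i) x)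
    (u : TangentSpace (𝓡 n) x) :
    covS (fun y => ∑ i ∈ t, g i y • s i y) x u =
      ∑ i ∈ t, (g i x • covS (s i) x u + mvfderiv (𝓡 n) (g i) x u • s i x) := by
  classical
  induction t using Finset.induction_on with
  | empty =>
    simp only [Finset.sum_empty]
    exact congr($(covS.isCovariantDerivativeOn.zero (x := x)) u)
  | insert a t ha ih =>
    simp only [Finset.sum_insert ha]
    have hg' := fun i hi => hg i (Finset.mem_insert_of_mem hi)
    have hs' := fun i hi => hs i (Finset.mem_insert_of_mem hi)
    have ha' := Finset.mem_insert_self a t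
    rw [← ih hg' hs']
    have h1 := congr($(covS.isCovariantDerivativeOn.add ((hg a ha').smul_section (hs a ha'))
      (diffSpinorAt_sum_smul t hg' hs')) u)
    have h2 := congr($(covS.isCovariantDerivativeOn.leibniz (hs a ha') (hg a ha')) u)
    exact h1.trans (congrArg₂ (· + ·) h2 rfl)

end CovS

end SpinorFields

/-- Writing a `Δ`-valued function as a finite sum of scalar functions times constant spinors reduces
the calculus in a spin frame to constant spinors. Only for these do the definitions of spin frame
and spin connection say anything. -/
lemma exists_coord_clm (Δ : Type*) [NormedAddCommGroup Δ] [NormedSpace ℝ Δ]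
    [FiniteDimensional ℝ Δ] : ∃ (ι : Type) (_ : Fintype ι) (b : ι → Δ) (L : ι → Δ →L[ℝ] ℝ),
      ∀ ψ, ∑ k, L k ψ • b k = ψ :=
  let b := Module.finBasis ℝ Δ
  ⟨Fin (Module.finrank ℝ Δ), inferInstance, b, fun k => LinearMap.toContinuousLinearMap (b.coord k),
    fun ψ => b.sum_repr ψ⟩

section FrameFields

variable {n : ℕ}
  {M : Type*} [TopologicalSpace M] [ChartedSpace (EuclideanSpace ℝ (Fin n)) M]
  [IsManifold (𝓡 n) ∞ M]
  [RiemannianBundle (fun x : M => TangentSpace (𝓡 n) x)]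
  {Δ : Type*} [NormedAddCommGroup Δ] [InnerProductSpace ℂ Δ]
  {S : M → Type*} [∀ x, NormedAddCommGroup (S x)] [∀ x, InnerProductSpace ℂ (S x)]
  [TopologicalSpace (TotalSpace Δ S)] [FiberBundle Δ S]

/-! ### Spinor fields in a spin frame -/

namespace SpinFrame

variable (f : SpinFrame n M Δ S)
  (covT : CovariantDerivative (𝓡 n) (EuclideanSpace ℝ (Fin n))
      (fun x : M => TangentSpace (𝓡 n) x)) (ρ : SpinorModule n Δ)

/-- The connection coefficients `⟨∇_u e_a, e_b⟩`. -/
noncomputable def conn (x : M) (u : TangentSpace (𝓡 n) x) (a b : Fin n) : ℝ :=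
  inner ℝ (covT (f.vec a) x u) (f.vec b x)

/-- The connection form of the spin connection. -/
noncomputable def spinConn (x : M) (u : TangentSpace (𝓡 n) x) : Module.End ℝ Δ :=
  (1 / 4 : ℝ) • ∑ a, ∑ b, f.conn covT x u a b • (ρ.gen a * ρ.gen b)

/-- The covariant derivative of a spinor field in a spin frame. -/
noncomputable def spinDer (ψ : M → Δ) (x : M) (u : TangentSpace (𝓡 n) x) : Δ :=
  mvfderiv (𝓡 n) ψ x u + f.spinConn covT ρ x u (ψ x)

variable {f} {x : M}

lemma cov_vec (hx : x ∈ f.dom) (u : TangentSpace (𝓡 n) x) (a : Fin n) :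
    covT (f.vec a) x u = ∑ b, f.conn covT x u a b • f.vec b x :=
  (f.sum_inner_smul_vec hx _).symm

variable [FiniteDimensional ℂ Δ]  [VectorBundle ℝ Δ S]

lemma diffSpinorAt_spin {ψ : M → Δ} (hx : x ∈ f.dom) (hψ : DiffFunAt n ψ x) :
    DiffSpinorAt n Δ (fun y => f.spin y (ψ y)) x := by
  obtain ⟨ι, _, b, L, hL⟩ := exists_coord_clm Δ
  have h : (fun y => f.spin y (ψ y)) = fun y => ∑ k, L k (ψ y) • f.spin y (b k) := by
    ext y
    conv_lhs => rw [← hL (ψ y)]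
    simp only [map_sum, spin_real_smul]
  rw [h]
  exact diffSpinorAt_sum_smul _ (fun k _ => hψ.clm_apply (L k))
    fun k _ => ((f.smooth_spin (b k)).contMDiffAt (f.isOpen_dom.mem_nhds hx)).mdifferentiableAt
      (by simp)

/-- Read in a local trivialization, the spin frame is a smooth family of invertible operators on the
finite-dimensional space `Δ`, and inversion of operators is smooth. -/
lemma smoothFun_symm [ContMDiffVectorBundle ∞ Δ S (𝓡 n)] {s : (x : M) → S x}
    (hs : SmoothSpinor n Δ f.dom s) : SmoothFun n f.dom (fun y => (f.spin y).symm (s y)) := by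
  intro x hx
  obtain ⟨ι, _, b, L, hL⟩ := exists_coord_clm Δ
  have hnhds := f.isOpen_dom.mem_nhds hx
  set e := trivializationAt Δ S x
  have hsx := (contMDiffAt_section x).1 (hs.contMDiffAt hnhds)
  have hbx := fun k => (contMDiffAt_section x).1 ((f.smooth_spin (b k)).contMDiffAt hnhds)
  -- `A y` is the spin frame at `y` seen through the trivialization, assembled from the smooth
  -- images of basis spinors.
  let A : M → Δ →L[ℝ] Δ := fun y => ∑ k, (L k).smulRight (e ⟨y, f.spin y (b k)⟩).2
  have hA : ContMDiffAt (𝓡 n) 𝓘(ℝ, Δ →L[ℝ] Δ) ∞ A x := by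
    refine ContMDiffAt.sum fun k _ => ?_
    exact ((ContinuousLinearMap.smulRightL ℝ Δ Δ (L k)).contMDiff.contMDiffAt).comp x (hbx k)
  have hbase : ∀ᶠ y in 𝓝 x, y ∈ e.baseSet :=
    e.open_baseSet.mem_nhds (mem_baseSet_trivializationAt Δ S x)
  have hAe : ∀ y ∈ e.baseSet, ∃ E : Δ ≃L[ℝ] Δ, (E : Δ →L[ℝ] Δ) = A y ∧
      ∀ ψ, E ψ = (e ⟨y, f.spin y ψ⟩).2 := by
    intro y hy
    let E : Δ ≃L[ℝ] Δ := (((f.spin y).toLinearEquiv.restrictScalars ℝ).trans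
      (e.linearEquivAt ℝ y hy)).toContinuousLinearEquiv
    have hE : ∀ ψ, E ψ = (e ⟨y, f.spin y ψ⟩).2 := fun ψ => rfl
    refine ⟨E, ?_, hE⟩
    ext ψ
    change E ψ = A y ψ
    conv_lhs => rw [← hL ψ]
    rw [map_sum]
    simp only [A, sum_apply, ContinuousLinearMap.smulRight_apply, ← hE, map_smul]
  obtain ⟨E, hE, -⟩ := hAe x (mem_baseSet_trivializationAt Δ S x)
  have hinv : ContMDiffAt 𝓘(ℝ, Δ →L[ℝ] Δ) 𝓘(ℝ, Δ →L[ℝ] Δ) ∞ ContinuousLinearMap.inverse (A x) := by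
    rw [← hE]
    have : CompleteSpace Δ := FiniteDimensional.complete ℝ Δ
    exact (contDiffAt_map_inverse E).contMDiffAt
  have h := (hinv.comp x hA).clm_apply hsx
  refine (h.congr_of_eventuallyEq ?_).contMDiffWithinAt
  filter_upwards [hbase] with y hy
  obtain ⟨E, hE, hE'⟩ := hAe y hy
  simp only [Function.comp_apply, ← hE, ContinuousLinearMap.inverse_equiv]
  refine (E.symm_apply_eq.2 ?_).symm
  rw [hE', (f.spin y).apply_symm_apply]

variable {σ : SpinStructure (M := M) ρ S} {covS : CovariantDerivative (𝓡 n) Δ S} {covT ρ}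

/-- The connection is prescribed on spinors with constant components. The Leibniz rule, applied to
the expansion in a fixed basis, extends the formula to variable components. -/
lemma covS_spin (hS : IsSpinConnection σ covT covS) (hf : f ∈ σ.atlas) (hx : x ∈ f.dom) {ψ : M → Δ}
    (hψ : DiffFunAt n ψ x) (u : TangentSpace (𝓡 n) x) :
    covS (fun y => f.spin y (ψ y)) x u = f.spin x (f.spinDer covT ρ ψ x u) := by
  obtain ⟨ι, _, b, L, hL⟩ := exists_coord_clm Δ
  have h : (fun y => f.spin y (ψ y)) = fun y => ∑ k, L k (ψ y) • f.spin y (b k) := by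
    ext y
    conv_lhs => rw [← hL (ψ y)]
    simp only [map_sum, spin_real_smul]
  have hc : ∀ χ : Δ, covS (fun y => f.spin y χ) x u = f.spin x (f.spinConn covT ρ x u χ) := by
    intro χ
    rw [hS f hf x hx u χ, spinConn]
    simp only [LinearMap.smul_apply, LinearMap.sum_apply, spin_real_smul, map_sum,
        Module.End.mul_apply,
      SpinorModule.gen_apply, σ.gam_frame f hf x hx]
    rfl
  rw [h, covS_sum_smul _ (fun k _ => hψ.clm_apply (L k))
    fun k _ => ((f.smooth_spin (b k)).contMDiffAt (f.isOpen_dom.mem_nhds hx)).mdifferentiableAt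
      (by simp), Finset.sum_add_distrib, spinDer, add_comm, map_add]
  congr 1
  · simp only [mvfderiv_clm_apply (L _) hψ, ← spin_real_smul, ← map_sum, hL]
  · simp only [hc, ← spin_real_smul, ← map_sum, ← map_smul, hL]

end SpinFrame
end FrameFields
end SpinGeom

namespace SpinGeom

open scoped Topology

section FrameTensors

variable {n : ℕ}
  {M : Type*} [TopologicalSpace M] [ChartedSpace (EuclideanSpace ℝ (Fin n)) M]
  [IsManifold (𝓡 n) ∞ M]
  [RiemannianBundle (fun x : M => TangentSpace (𝓡 n) x)]
  {Δ : Type*} [NormedAddCommGroup Δ] [InnerProductSpace ℂ Δ]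
  {S : M → Type*} [∀ x, NormedAddCommGroup (S x)] [∀ x, InnerProductSpace ℂ (S x)]
  [TopologicalSpace (TotalSpace Δ S)] [FiberBundle Δ S]

/-! ### Tensor-spinors in a spin frame -/

namespace SpinFrame

variable (f : SpinFrame n M Δ S)

/-- The spinor-valued `1`-form `φ` has the smooth components `c a` in the frame. -/
structure HasComponents (φ : (x : M) → TangentSpace (𝓡 n) x → S x) (c : Fin n → M → Δ) : Prop where
  smooth : ∀ a, SmoothFun n f.dom (c a)
  apply : ∀ y ∈ f.dom, ∀ v, φ y v = f.spin y (∑ a, (inner ℝ v (f.vec a y) : ℝ) • c a y)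

/-- The spinor-valued `2`-tensor `Φ` has the smooth components `c a b` in the frame. -/
structure HasComponents₂ (Φ : (x : M) → TangentSpace (𝓡 n) x → TangentSpace (𝓡 n) x → S x)
    (c : Fin n → Fin n → M → Δ) : Prop where
  smooth : ∀ a b, SmoothFun n f.dom (c a b)
  apply : ∀ y ∈ f.dom, ∀ u v, Φ y u v = f.spin y (∑ a, ∑ b,
    ((inner ℝ u (f.vec a y) : ℝ) * inner ℝ v (f.vec b y)) • c a b y)

variable {f} {x : M}

lemma HasComponents.apply_vec {φ : (x : M) → TangentSpace (𝓡 n) x → S x} {c : Fin n → M → Δ}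
    (h : f.HasComponents φ c) (hx : x ∈ f.dom) (a : Fin n) :
    φ x (f.vec a x) = f.spin x (c a x) := by
  classical
  simp [h.apply x hx, f.inner_vec hx, ite_smul]

lemma HasComponents₂.apply_vec {Φ : (x : M) → TangentSpace (𝓡 n) x → TangentSpace (𝓡 n) x → S x}
    {c : Fin n → Fin n → M → Δ} (h : f.HasComponents₂ Φ c) (hx : x ∈ f.dom) (a b : Fin n) :
    Φ x (f.vec a x) (f.vec b x) = f.spin x (c a b x) := by
  classical
  simp only [h.apply x hx, mul_smul, ← Finset.smul_sum]
  simp only [f.inner_vec hx, ite_smul, one_smul, zero_smul, Finset.sum_ite_eq, Finset.mem_univ,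
    if_true]

lemma HasComponents.map_add {φ : (x : M) → TangentSpace (𝓡 n) x → S x} {c : Fin n → M → Δ}
    (h : f.HasComponents φ c) (hx : x ∈ f.dom) (u v : TangentSpace (𝓡 n) x) :
    φ x (u + v) = φ x u + φ x v := by
  simp only [h.apply x hx, inner_add_left, add_smul, Finset.sum_add_distrib, _root_.map_add]

lemma HasComponents.map_smul {φ : (x : M) → TangentSpace (𝓡 n) x → S x} {c : Fin n → M → Δ}
    (h : f.HasComponents φ c) (hx : x ∈ f.dom) (r : ℝ) (v : TangentSpace (𝓡 n) x) :
    φ x (r • v) = r • φ x v := by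
  simp only [h.apply x hx, real_inner_smul_left, mul_smul, ← Finset.smul_sum, spin_real_smul]

lemma HasComponents₂.isBilinearMap
    {Φ : (x : M) → TangentSpace (𝓡 n) x → TangentSpace (𝓡 n) x → S x}
    {c : Fin n → Fin n → M → Δ} (h : f.HasComponents₂ Φ c) (hx : x ∈ f.dom) :
    IsBilinearMap ℝ (Φ x) where
  add_left u u' v := by
    simp only [h.apply x hx, inner_add_left, add_mul, add_smul, Finset.sum_add_distrib,
      _root_.map_add]
  add_right u v v' := by
    simp only [h.apply x hx, inner_add_left, mul_add, add_smul, Finset.sum_add_distrib,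
      _root_.map_add]
  smul_left r u v := by
    simp only [h.apply x hx, real_inner_smul_left, mul_assoc, mul_smul r, ← Finset.smul_sum,
      spin_real_smul]
  smul_right r u v := by
    simp only [h.apply x hx, real_inner_smul_left, mul_left_comm _ r, mul_smul r, ← Finset.smul_sum,
      spin_real_smul]

/-- An expression that is linear in its argument is determined by its values on the frame. -/
lemma sum_inner_smul_map {V : Type*} [AddCommGroup V] [Module ℝ V] (hx : x ∈ f.dom)
    (L : TangentSpace (𝓡 n) x →ₗ[ℝ] V) (v : TangentSpace (𝓡 n) x) :
    ∑ a, (inner ℝ v (f.vec a x) : ℝ) • L (f.vec a x) = L v := by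
  conv_rhs => rw [← f.sum_inner_smul_vec hx v]
  simp only [map_sum, _root_.map_smul]

section Smooth

variable [FiniteDimensional ℂ Δ] [VectorBundle ℝ Δ S] [ContMDiffVectorBundle ∞ Δ S (𝓡 n)]

variable (f) in
/-- The components of a spinor-valued `1`-form. -/
noncomputable def components (φ : (x : M) → TangentSpace (𝓡 n) x → S x) (a : Fin n) (y : M) : Δ :=
  (f.spin y).symm (φ y (f.vec a y))

variable (f) in
/-- The components of a spinor-valued `2`-tensor. -/
noncomputable def components₂ (Φ : (x : M) → TangentSpace (𝓡 n) x → TangentSpace (𝓡 n) x → S x)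
    (a b : Fin n) (y : M) : Δ :=
  (f.spin y).symm (Φ y (f.vec a y) (f.vec b y))

variable (f) in
lemma hasComponents {φ : (x : M) → TangentSpace (𝓡 n) x →L[ℝ] S x} (hφ : IsSmoothOne Δ φ) :
    f.HasComponents (fun y v => φ y v) (f.components fun y v => φ y v) where
  smooth a := smoothFun_symm (ContMDiffOn.clm_bundle_apply hφ.contMDiffOn (f.smooth_vec a))
  apply y hy v := by
    simp only [map_sum, spin_real_smul, components, LinearIsometryEquiv.apply_symm_apply]
    exact (sum_inner_smul_map hy (φ y).toLinearMap v).symm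

variable (f) in
lemma hasComponents₂ {Φ : (x : M) → TangentSpace (𝓡 n) x →L[ℝ] TangentSpace (𝓡 n) x →L[ℝ] S x}
    (hΦ : IsSmoothTwo Δ Φ) :
    f.HasComponents₂ (fun y u v => Φ y u v) (f.components₂ fun y u v => Φ y u v) where
  smooth a b := smoothFun_symm (ContMDiffOn.clm_bundle_apply
    (ContMDiffOn.clm_bundle_apply hΦ.contMDiffOn (f.smooth_vec a)) (f.smooth_vec b))
  apply y hy u v := by
    simp only [map_sum, spin_real_smul, components₂, LinearIsometryEquiv.apply_symm_apply, mul_smul,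
      ← Finset.smul_sum]
    have h1 : ∀ w, ∑ b, (inner ℝ v (f.vec b y) : ℝ) • Φ y w (f.vec b y) = Φ y w v :=
      fun w => sum_inner_smul_map hy (Φ y w).toLinearMap v
    simp only [h1]
    exact (sum_inner_smul_map hy ((Φ y).flip v).toLinearMap u).symm

end Smooth

/-! ### Covariant derivatives of tensor-spinors in a spin frame -/

variable (f)
  (covT : CovariantDerivative (𝓡 n) (EuclideanSpace ℝ (Fin n))
      (fun x : M => TangentSpace (𝓡 n) x)) (ρ : SpinorModule n Δ)

/-- The components of `∇_u φ`. -/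
noncomputable def nabla (c : Fin n → M → Δ) (x : M) (u : TangentSpace (𝓡 n) x) (a : Fin n) : Δ :=
  f.spinDer covT ρ (c a) x u - ∑ d, f.conn covT x u a d • c d x

/-- The components of `∇_u Φ`. -/
noncomputable def nabla₂ (c : Fin n → Fin n → M → Δ) (x : M) (u : TangentSpace (𝓡 n) x)
    (a b : Fin n) : Δ :=
  f.spinDer covT ρ (c a b) x u - ∑ d, f.conn covT x u a d • c d b x
    - ∑ d, f.conn covT x u b d • c a d x

lemma conn_add (u v : TangentSpace (𝓡 n) x) (a b : Fin n) :
    f.conn covT x (u + v) a b = f.conn covT x u a b + f.conn covT x v a b := by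
  simp only [conn, _root_.map_add, inner_add_left]

lemma conn_smul (r : ℝ) (u : TangentSpace (𝓡 n) x) (a b : Fin n) :
    f.conn covT x (r • u) a b = r * f.conn covT x u a b := by
  simp only [conn, _root_.map_smul, real_inner_smul_left]

lemma spinDer_add (ψ : M → Δ) (u v : TangentSpace (𝓡 n) x) :
    f.spinDer covT ρ ψ x (u + v) = f.spinDer covT ρ ψ x u + f.spinDer covT ρ ψ x v := by
  simp only [spinDer, spinConn, conn_add, _root_.map_add, add_smul, Finset.sum_add_distrib,
    smul_add, LinearMap.add_apply]
  abel

lemma spinDer_smul (ψ : M → Δ) (r : ℝ) (u : TangentSpace (𝓡 n) x) :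
    f.spinDer covT ρ ψ x (r • u) = r • f.spinDer covT ρ ψ x u := by
  have h : f.spinConn covT ρ x (r • u) = r • f.spinConn covT ρ x u := by
    simp only [spinConn, conn_smul, mul_smul, ← Finset.smul_sum]
    rw [smul_comm]
  simp only [spinDer, h, _root_.map_smul, smul_add, LinearMap.smul_apply]

lemma isLinearMap_nabla (c : Fin n → M → Δ) (x : M) (a : Fin n) :
    IsLinearMap ℝ (fun u => f.nabla covT ρ c x u a) where
  map_add u v := by
    simp only [nabla, spinDer_add, conn_add, add_smul, Finset.sum_add_distrib]
    abel
  map_smul r u := by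
    simp only [nabla, spinDer_smul, conn_smul, mul_smul, ← Finset.smul_sum, smul_sub]

lemma isLinearMap_nabla₂ (c : Fin n → Fin n → M → Δ) (x : M) (a b : Fin n) :
    IsLinearMap ℝ (fun u => f.nabla₂ covT ρ c x u a b) where
  map_add u v := by
    simp only [nabla₂, spinDer_add, conn_add, add_smul, Finset.sum_add_distrib]
    abel
  map_smul r u := by
    simp only [nabla₂, spinDer_smul, conn_smul, mul_smul, ← Finset.smul_sum, smul_sub]

lemma spinDer_sum_smul {ι : Type*} (t : Finset ι) {g : ι → M → ℝ} {c : ι → M → Δ}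
    (hg : ∀ i ∈ t, DiffFunAt n (g i) x) (hc : ∀ i ∈ t, DiffFunAt n (c i) x)
    (u : TangentSpace (𝓡 n) x) :
    f.spinDer covT ρ (fun y => ∑ i ∈ t, g i y • c i y) x u =
      ∑ i ∈ t, (mvfderiv (𝓡 n) (g i) x u • c i x + g i x • f.spinDer covT ρ (c i) x u) := by
  simp only [spinDer, mvfderiv_sum_smul t hg hc, map_sum, _root_.map_smul, smul_add,
    ← Finset.sum_add_distrib, add_assoc]

section LeviCivita

variable [IsContMDiffRiemannianBundle (𝓡 n) ∞ (EuclideanSpace ℝ (Fin n))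
      (fun x : M => TangentSpace (𝓡 n) x)]

variable {f covT} (hT : IsLeviCivita covT)
include hT

/-- Differentiate the constant function `⟨e_a, e_b⟩`. -/
lemma conn_skew (hx : x ∈ f.dom) (u : TangentSpace (𝓡 n) x) (a b : Fin n) :
    f.conn covT x u a b = -f.conn covT x u b a := by
  have hd := fun a => (f.smooth a).diffAt f.isOpen_dom hx
  have h := hT.mvfderiv_inner (hd a) (hd b) u
  rw [mvfderiv_eq_zero_of_eventually (c := if a = b then 1 else 0)] at h
  · rw [conn, conn, real_inner_comm (f.vec a x)]
    rw [zero_apply] at h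
    linarith
  · filter_upwards [f.isOpen_dom.mem_nhds hx] with y hy
    exact f.inner_vec hy a b

/-- Metric compatibility produces the term `⟨V, ∇_u e_b⟩` with a minus sign; skewness of the
connection coefficients turns it into the sum with a plus sign and exchanged indices. -/
lemma inner_cov (hx : x ∈ f.dom)
    {V : (x : M) → TangentSpace (𝓡 n) x} (hV : DiffFieldAt V x) (u : TangentSpace (𝓡 n) x)
    (b : Fin n) :
    (inner ℝ (covT V x u) (f.vec b x) : ℝ) =
      mvfderiv (𝓡 n) (fun y => (inner ℝ (V y) (f.vec b y) : ℝ)) x u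
        + ∑ a, (inner ℝ (V x) (f.vec a x) : ℝ) * f.conn covT x u a b := by
  rw [hT.mvfderiv_inner hV ((f.smooth b).diffAt f.isOpen_dom hx) u, cov_vec covT hx u b]
  simp only [inner_sum, real_inner_smul_right]
  rw [add_assoc, ← Finset.sum_add_distrib, left_eq_add]
  refine Finset.sum_eq_zero fun a _ => ?_
  rw [conn_skew hT hx u a b]
  ring

lemma smoothFun_conn [T2Space M] {V : (x : M) → TangentSpace (𝓡 n) x} (hV : SmoothField f.dom V)
    (a b : Fin n) : SmoothFun n f.dom (fun y => f.conn covT y (V y) a b) :=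
  (hT.smoothField_cov f.isOpen_dom (f.smooth a) hV).inner (f.smooth b)

lemma smoothFun_spinDer [T2Space M] {V : (x : M) → TangentSpace (𝓡 n) x} (hV : SmoothField f.dom V)
    {ψ : M → Δ} (hψ : SmoothFun n f.dom ψ) [FiniteDimensional ℂ Δ] :
    SmoothFun n f.dom (fun y => f.spinDer covT ρ ψ y (V y)) := by
  refine (SmoothFun.mvfderiv_apply f.isOpen_dom hψ hV).add ?_
  simp only [spinConn, LinearMap.smul_apply, LinearMap.sum_apply]
  have h : SmoothFun n f.dom (fun y => ∑ a, ∑ b, f.conn covT y (V y) a b •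
      (ρ.gen a * ρ.gen b) (ψ y)) := SmoothFun.sum fun a => SmoothFun.sum fun b =>
    (smoothFun_conn hT hV a b).smul
      (hψ.clm_apply (LinearMap.toContinuousLinearMap (ρ.gen a * ρ.gen b)))
  exact h.clm_apply ((1 / 4 : ℝ) • ContinuousLinearMap.id ℝ Δ)

lemma smoothFun_nabla [T2Space M] {V : (x : M) → TangentSpace (𝓡 n) x} (hV : SmoothField f.dom V)
    {c : Fin n → M → Δ} (hc : ∀ a, SmoothFun n f.dom (c a)) [FiniteDimensional ℂ Δ] (a : Fin n) :
    SmoothFun n f.dom (fun y => f.nabla covT ρ c y (V y) a) :=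
  (smoothFun_spinDer ρ hT hV (hc a)).sub
    (SmoothFun.sum fun d => (smoothFun_conn hT hV a d).smul (hc d))

variable {ρ} [FiniteDimensional ℂ Δ] [VectorBundle ℝ Δ S] {σ : SpinStructure (M := M) ρ S}
  {covS : CovariantDerivative (𝓡 n) Δ S}

/-- The derivatives of the coefficients of the local extension of `v` cancel between the two terms
of `nablaOne`. What remains depends only on the value `v` and on the components of `φ`. -/
lemma nablaOne_eq (hS : IsSpinConnection σ covT covS) (hf : f ∈ σ.atlas) (hx : x ∈ f.dom)
    {φ : (x : M) → TangentSpace (𝓡 n) x → S x} {c : Fin n → M → Δ} (h : f.HasComponents φ c)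
    (u v : TangentSpace (𝓡 n) x) :
    nablaOne covT covS φ x u v =
      f.spin x (∑ a, (inner ℝ v (f.vec a x) : ℝ) • f.nabla covT ρ c x u a) := by
  unfold nablaOne
  have hV : DiffFieldAt (extend (EuclideanSpace ℝ (Fin n)) v) x := mdifferentiableAt_extend ..
  have hVx : extend (EuclideanSpace ℝ (Fin n)) v x = v := extend_apply_self _ v
  set V := extend (EuclideanSpace ℝ (Fin n)) v
  have hVa := fun a => hV.inner ((f.smooth a).diffAt f.isOpen_dom hx)
  have hc := fun a => (h.smooth a).diffAt f.isOpen_dom hx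
  have he : ∀ᶠ y in 𝓝 x, φ y (V y) =
      f.spin y (∑ a, (inner ℝ (V y) (f.vec a y) : ℝ) • c a y) := by
    filter_upwards [f.isOpen_dom.mem_nhds hx] with y hy
    exact h.apply y hy (V y)
  have hd : DiffFunAt n (fun y => ∑ a, (inner ℝ (V y) (f.vec a y) : ℝ) • c a y) x :=
    (mvfderiv_sum _ fun a _ => (hVa a).smul (hc a)).2
  have hd' := diffSpinorAt_spin hx hd
  -- The component expansion of `φ` holds only on `f.dom`; agreement near `x` is enough for the
  -- covariant derivative.
  rw [covS_congr (hd'.congr_of_eventuallyEq (he.mono fun y hy => congrArg (TotalSpace.mk' Δ y) hy))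
      hd' he,
    covS_spin hS hf hx hd, spinDer_sum_smul _ _ _ _ (fun a _ => hVa a) fun a _ => hc a,
    h.apply x hx, ← map_sub]
  congr 1
  simp only [inner_cov hT hx hV, hVx, nabla, add_smul, Finset.sum_add_distrib, smul_sub,
    Finset.sum_sub_distrib, Finset.sum_smul, Finset.smul_sum, smul_smul]
  rw [Finset.sum_comm (f := fun a b => ((inner ℝ v (f.vec b x) : ℝ) * f.conn covT x u b a) • c a x)]
  abel

lemma hasComponents₂_nablaOne [T2Space M] (hS : IsSpinConnection σ covT covS) (hf : f ∈ σ.atlas)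
    {φ : (x : M) → TangentSpace (𝓡 n) x → S x} {c : Fin n → M → Δ} (h : f.HasComponents φ c) :
    f.HasComponents₂ (nablaOne covT covS φ)
      (fun a b y => f.nabla covT ρ c y (f.vec a y) b) where
  smooth a b := smoothFun_nabla ρ hT (f.smooth a) h.smooth b
  apply y hy u v := by
    rw [nablaOne_eq hT hS hf hy h, Finset.sum_comm]
    congr 1
    refine Finset.sum_congr rfl fun b _ => ?_
    simp only [mul_comm (inner ℝ u _ : ℝ), mul_smul, ← Finset.smul_sum]
    exact congrArg _ (sum_inner_smul_map hy (isLinearMap_nabla f covT ρ c y b).mk' u).symm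

lemma nablaTwo_eq (hS : IsSpinConnection σ covT covS) (hf : f ∈ σ.atlas) (hx : x ∈ f.dom)
    {Φ : (x : M) → TangentSpace (𝓡 n) x → TangentSpace (𝓡 n) x → S x} {c : Fin n → Fin n → M → Δ}
    (h : f.HasComponents₂ Φ c) (w u v : TangentSpace (𝓡 n) x) :
    nablaTwo covT covS Φ x w u v =
      f.spin x (∑ a, ∑ b, ((inner ℝ u (f.vec a x) : ℝ) * inner ℝ v (f.vec b x)) •
        f.nabla₂ covT ρ c x w a b) := by
  unfold nablaTwo
  have hU : DiffFieldAt (extend (EuclideanSpace ℝ (Fin n)) u) x := mdifferentiableAt_extend ..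
  have hUx : extend (EuclideanSpace ℝ (Fin n)) u x = u := extend_apply_self _ u
  have hV : DiffFieldAt (extend (EuclideanSpace ℝ (Fin n)) v) x := mdifferentiableAt_extend ..
  have hVx : extend (EuclideanSpace ℝ (Fin n)) v x = v := extend_apply_self _ v
  set U := extend (EuclideanSpace ℝ (Fin n)) u
  set V := extend (EuclideanSpace ℝ (Fin n)) v
  have hUa := fun a => hU.inner ((f.smooth a).diffAt f.isOpen_dom hx)
  have hVa := fun a => hV.inner ((f.smooth a).diffAt f.isOpen_dom hx)
  -- The double sum is indexed by pairs, so that the Leibniz rule for a single finite sum applies.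
  have hUV : ∀ i : Fin n × Fin n, DiffFunAt n (fun y => (inner ℝ (U y) (f.vec i.1 y) : ℝ) *
      inner ℝ (V y) (f.vec i.2 y)) x := fun i => (hUa i.1).mul (hVa i.2)
  have hc := fun i : Fin n × Fin n => (h.smooth i.1 i.2).diffAt f.isOpen_dom hx
  have he : ∀ᶠ y in 𝓝 x, Φ y (U y) (V y) =
      f.spin y (∑ i : Fin n × Fin n, ((inner ℝ (U y) (f.vec i.1 y) : ℝ) *
        inner ℝ (V y) (f.vec i.2 y)) • c i.1 i.2 y) := by
    filter_upwards [f.isOpen_dom.mem_nhds hx] with y hy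
    rw [Fintype.sum_prod_type]
    exact h.apply y hy (U y) (V y)
  have hd : DiffFunAt n (fun y => ∑ i : Fin n × Fin n, ((inner ℝ (U y) (f.vec i.1 y) : ℝ) *
      inner ℝ (V y) (f.vec i.2 y)) • c i.1 i.2 y) x :=
    (mvfderiv_sum _ fun i _ => (hUV i).smul (hc i)).2
  have hd' := diffSpinorAt_spin hx hd
  rw [covS_congr (hd'.congr_of_eventuallyEq (he.mono fun y hy => congrArg (TotalSpace.mk' Δ y) hy))
    hd' he, covS_spin hS hf hx hd,
    spinDer_sum_smul _ _ _ _ (fun i _ => hUV i) fun i _ => hc i,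
    h.apply x hx, h.apply x hx, ← map_sub, ← map_sub]
  congr 1
  have hmul : ∀ i : Fin n × Fin n, mvfderiv (𝓡 n) (fun y => (inner ℝ (U y) (f.vec i.1 y) : ℝ) *
      inner ℝ (V y) (f.vec i.2 y)) x w =
      mvfderiv (𝓡 n) (fun y => (inner ℝ (U y) (f.vec i.1 y) : ℝ)) x w * inner ℝ v (f.vec i.2 x)
      + inner ℝ u (f.vec i.1 x)
          * mvfderiv (𝓡 n) (fun y => (inner ℝ (V y) (f.vec i.2 y) : ℝ)) x w := by
    intro i
    rw [mvfderiv_fun_mul (hUa i.1) (hVa i.2), hUx, hVx]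
    simp only [add_apply, smul_apply, smul_eq_mul]
    ring
  simp only [hmul, Fintype.sum_prod_type, hUx, hVx, nabla₂, inner_cov hT hx hU, inner_cov hT hx hV,
    add_smul, Finset.sum_add_distrib, smul_sub, Finset.sum_sub_distrib, Finset.sum_smul,
    Finset.smul_sum, smul_smul, add_mul, mul_add, Finset.sum_mul, Finset.mul_sum]
  have s1 : ∑ a, ∑ b, ∑ d, ((inner ℝ u (f.vec a x) : ℝ) * inner ℝ v (f.vec b x)
        * f.conn covT x w a d) • c d b x =
      ∑ a, ∑ b, ∑ d, ((inner ℝ u (f.vec d x) : ℝ) * f.conn covT x w d a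
        * inner ℝ v (f.vec b x)) • c a b x := by
    rw [Finset.sum_comm]
    refine (Finset.sum_congr rfl fun b _ => Finset.sum_comm).trans ?_
    rw [Finset.sum_comm]
    simp only [mul_right_comm (inner ℝ u _ : ℝ)]
  have s2 : ∑ a, ∑ b, ∑ d, ((inner ℝ u (f.vec a x) : ℝ) * inner ℝ v (f.vec b x)
        * f.conn covT x w b d) • c a d x =
      ∑ a, ∑ b, ∑ d, ((inner ℝ u (f.vec a x) : ℝ) * (inner ℝ v (f.vec d x)
        * f.conn covT x w d b)) • c a b x := by
    refine Finset.sum_congr rfl fun a _ => ?_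
    rw [Finset.sum_comm]
    simp only [mul_assoc]
  rw [s1, s2]
  abel

lemma nablaStar_eq (hS : IsSpinConnection σ covT covS) (hf : f ∈ σ.atlas) (hx : x ∈ f.dom)
    {Φ : (x : M) → TangentSpace (𝓡 n) x → TangentSpace (𝓡 n) x → S x} {c : Fin n → Fin n → M → Δ}
    (h : f.HasComponents₂ Φ c) (v : TangentSpace (𝓡 n) x) :
    nablaStar covT covS Φ x v = f.spin x (∑ b, (inner ℝ v (f.vec b x) : ℝ) •
        -∑ a, f.nabla₂ covT ρ c x (f.vec a x) a b) := by
  classical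
  have hB : IsBilinearMap ℝ (fun w u => nablaTwo covT covS Φ x w u v) := by
    simp only [nablaTwo_eq hT hS hf hx h]
    constructor
    · intro w w' u
      simp only [(isLinearMap_nabla₂ f covT ρ c x _ _).map_add, smul_add, Finset.sum_add_distrib,
        _root_.map_add]
    · intro r w u
      simp only [(isLinearMap_nabla₂ f covT ρ c x _ _).map_smul, smul_comm _ r, ← Finset.smul_sum,
        spin_real_smul]
    · intro w u u'
      simp only [inner_add_left, add_mul, add_smul, Finset.sum_add_distrib, _root_.map_add]
    · intro r w u
      simp only [real_inner_smul_left, mul_assoc, mul_smul r, ← Finset.smul_sum, spin_real_smul]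
  rw [nablaStar, f.contr_eq hx hB]
  simp only [nablaTwo_eq hT hS hf hx h, ← map_sum, ← map_neg]
  congr 1
  simp only [smul_neg, Finset.sum_neg_distrib, Finset.smul_sum, neg_inj, f.inner_vec hx]
  rw [Finset.sum_comm]
  refine (Finset.sum_congr rfl fun a _ => ?_).trans Finset.sum_comm
  rw [Finset.sum_comm]
  simp [ite_smul]

end LeviCivita

end SpinFrame
end FrameTensors
end SpinGeom

namespace SpinGeom

section Equivariance

variable {n : ℕ} {V : Type*} [AddCommGroup V] [Module ℝ V]

/-! ### The action of skew matrices on tensor-spinors -/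

/-- The action of a skew matrix on spinors. -/
noncomputable def skewSpin (Γ : Fin n → Module.End ℝ V) (A : Fin n → Fin n → ℝ) : Module.End ℝ V :=
  (1 / 4 : ℝ) • ∑ a, ∑ b, A a b • (Γ a * Γ b)

/-- The action of a skew matrix on spinor-valued `1`-forms. -/
noncomputable def skewAct (Γ : Fin n → Module.End ℝ V) (A : Fin n → Fin n → ℝ) (φ : Fin n → V)
    (a : Fin n) : V :=
  skewSpin Γ A (φ a) - ∑ d, A a d • φ d

/-- The action of a skew matrix on spinor-valued `2`-tensors. -/
noncomputable def skewAct₂ (Γ : Fin n → Module.End ℝ V) (A : Fin n → Fin n → ℝ)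
    (Φ : Fin n → Fin n → V) (a b : Fin n) : V :=
  skewSpin Γ A (Φ a b) - ∑ d, A a d • Φ d b - ∑ d, A b d • Φ a d

/-- The four projections as linear maps. -/
noncomputable def frameProjₗ (Γ : Fin n → Module.End ℝ V) (s : Summand) (a b : Fin n) :
    (Fin n → Fin n → V) →ₗ[ℝ] V where
  toFun Φ := frameProj Γ s Φ a b
  map_add' Φ Ψ := by
    cases s <;> simp only [frameProj, frameTr, frameGtr, Pi.add_apply, map_add,
      Finset.sum_add_distrib] <;> module
  map_smul' r Φ := by
    cases s <;> simp only [frameProj, frameTr, frameGtr, Pi.smul_apply, map_smul,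
      ← Finset.smul_sum, RingHom.id_apply] <;> module

variable {Γ : Fin n → Module.End ℝ V} {A : Fin n → Fin n → ℝ}

/-- Moving `Γ d Γ e` past `Γ a` leaves two contractions. Against a skew matrix they are equal, each
twice the matrix term, and the factor `1/4` in `skewSpin` normalizes their sum. This is the
infinitesimal equivariance of Clifford multiplication, and it is what makes the latter parallel. -/
lemma IsCliffordFamily.skewSpin_apply (hΓ : IsCliffordFamily Γ) (hA : ∀ a b, A a b = -A b a)
    (a : Fin n) (ψ : V) : skewSpin Γ A (Γ a ψ) = Γ a (skewSpin Γ A ψ) + ∑ d, A a d • Γ d ψ := by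
  have h : ∀ d e, Γ d (Γ e (Γ a ψ)) = Γ a (Γ d (Γ e ψ))
      + ((if d = a then (2 : ℝ) else 0) • Γ e ψ - (if e = a then (2 : ℝ) else 0) • Γ d ψ) := by
    intro d e
    rw [hΓ e a, hΓ a d]
    simp only [map_sub, map_neg, map_smul, eq_comm (a := a)]
    abel
  simp only [skewSpin, LinearMap.smul_apply, LinearMap.sum_apply, Module.End.mul_apply, h, smul_add,
    Finset.sum_add_distrib, map_smul, map_sum, smul_sub, Finset.sum_sub_distrib]
  congr 1
  have h1 : ∑ d, ∑ e, A d e • (if d = a then (2 : ℝ) else 0) • Γ e ψ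
      = (2 : ℝ) • ∑ e, A a e • Γ e ψ := by
    rw [Finset.sum_comm]
    simp only [ite_smul, smul_ite, zero_smul, smul_zero, Finset.sum_ite_eq', Finset.mem_univ,
      if_true, Finset.smul_sum]
    exact Finset.sum_congr rfl fun e _ => smul_comm _ _ _
  have h2 : ∑ d, ∑ e, A d e • (if e = a then (2 : ℝ) else 0) • Γ d ψ
      = -((2 : ℝ) • ∑ e, A a e • Γ e ψ) := by
    simp only [ite_smul, smul_ite, zero_smul, smul_zero, Finset.sum_ite_eq', Finset.mem_univ,
      if_true, Finset.smul_sum, ← Finset.sum_neg_distrib]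
    refine Finset.sum_congr rfl fun e _ => ?_
    rw [hA e a]
    module
  rw [h1, h2]
  module

lemma frameTr_skewAct₂ (hA : ∀ a b, A a b = -A b a) (Φ : Fin n → Fin n → V) :
    frameTr (skewAct₂ Γ A Φ) = skewSpin Γ A (frameTr Φ) := by
  have : ∑ a, ∑ d, A a d • Φ a d = -∑ a, ∑ d, A a d • Φ d a := by
    rw [Finset.sum_comm, ← Finset.sum_neg_distrib]
    refine Finset.sum_congr rfl fun a _ => ?_
    rw [← Finset.sum_neg_distrib]
    refine Finset.sum_congr rfl fun d _ => ?_
    rw [hA d a]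
    module
  simp only [frameTr, skewAct₂, Finset.sum_sub_distrib, map_sum, this]
  abel

/-- On the contracted index, the matrix action cancels against the commutator of `skewSpin` with
Clifford multiplication; only the action on the free index survives. -/
lemma IsCliffordFamily.frameGtr_skewAct₂ (hΓ : IsCliffordFamily Γ) (hA : ∀ a b, A a b = -A b a)
    (Φ : Fin n → Fin n → V) (b : Fin n) :
    frameGtr Γ (skewAct₂ Γ A Φ) b = skewSpin Γ A (frameGtr Γ Φ b)
        - ∑ d, A b d • frameGtr Γ Φ d := by
  have h1 : ∑ a, ∑ d, A a d • Γ a (Φ d b) = -∑ a, ∑ d, A a d • Γ d (Φ a b) := by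
    rw [Finset.sum_comm, ← Finset.sum_neg_distrib]
    refine Finset.sum_congr rfl fun a _ => ?_
    rw [← Finset.sum_neg_distrib]
    refine Finset.sum_congr rfl fun d _ => ?_
    rw [hA d a]
    module
  simp only [frameGtr, skewAct₂, map_sub, map_sum, map_smul, Finset.sum_sub_distrib,
    hΓ.skewSpin_apply hA, Finset.sum_add_distrib, h1, Finset.smul_sum]
  rw [Finset.sum_comm (f := fun a d => A b d • Γ a (Φ a d))]
  abel

/-- The projections are equivariant. -/
lemma IsCliffordFamily.frameProj_skewAct₂ (hΓ : IsCliffordFamily Γ) (hA : ∀ a b, A a b = -A b a)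
    (s : Summand) (Φ : Fin n → Fin n → V) (a b : Fin n) :
    frameProj Γ s (skewAct₂ Γ A Φ) a b = skewAct₂ Γ A (frameProj Γ s Φ) a b := by
  have ht := frameTr_skewAct₂ (Γ := Γ) hA Φ
  have hg := hΓ.frameGtr_skewAct₂ hA Φ
  -- A skew matrix annihilates the metric. This is needed only for the term `g_{αβ}` in the
  -- projection onto `Z`.
  have hδ : ∀ ψ : V, ∑ d, A a d • (if d = b then (1 : ℝ) else 0) • ψ
      + ∑ d, A b d • (if a = d then (1 : ℝ) else 0) • ψ = 0 := by
    intro ψ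
    simp only [ite_smul, smul_ite, zero_smul, smul_zero, Finset.sum_ite_eq', Finset.sum_ite_eq,
      Finset.mem_univ, if_true, hA b a]
    module
  cases s <;>
    simp only [frameProj, skewAct₂, ht, hg] <;>
    simp only [map_add, map_sub, map_smul, map_neg, map_sum, hΓ.skewSpin_apply hA, mul_smul,
        smul_add,
      smul_sub, Finset.sum_add_distrib, Finset.sum_sub_distrib, neg_smul, smul_neg,
      Finset.sum_neg_distrib, smul_comm (A _ _), ← Finset.smul_sum]
  · module
  · module
  · module
  · have h := hδ (frameTr Φ)
    simp only [smul_comm (A _ _)] at h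
    linear_combination (norm := module) (-(1 / (2 * ((n : ℝ) + 2))) * 2) • h

end Equivariance
end SpinGeom

namespace SpinGeom

open scoped Topology

section EquivarianceOne

variable {n : ℕ} {V : Type*} [AddCommGroup V] [Module ℝ V]
  {Γ : Fin n → Module.End ℝ V} {A : Fin n → Fin n → ℝ}

/-- The matrix action on the index cancels the commutator term of `skewSpin_apply`. Hence the
connection part of a covariant derivative preserves the twistor condition. -/
lemma IsCliffordFamily.sum_skewAct (hΓ : IsCliffordFamily Γ) (hA : ∀ a b, A a b = -A b a)
    (φ : Fin n → V) : ∑ a, Γ a (skewAct Γ A φ a) = skewSpin Γ A (∑ a, Γ a (φ a)) := by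
  have h1 : ∑ a, ∑ d, A a d • Γ a (φ d) = -∑ a, ∑ d, A a d • Γ d (φ a) := by
    rw [Finset.sum_comm, ← Finset.sum_neg_distrib]
    refine Finset.sum_congr rfl fun a _ => ?_
    rw [← Finset.sum_neg_distrib]
    refine Finset.sum_congr rfl fun d _ => ?_
    rw [hA d a]
    module
  simp only [skewAct, map_sub, map_sum, map_smul, Finset.sum_sub_distrib,
    hΓ.skewSpin_apply hA, Finset.sum_add_distrib, h1]
  abel

end EquivarianceOne

/-! ### Twistors and the projections in a spin frame, and their parallelism -/

section FrameProjections

variable {n : ℕ}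
  {M : Type*} [TopologicalSpace M] [ChartedSpace (EuclideanSpace ℝ (Fin n)) M]
  [IsManifold (𝓡 n) ∞ M]
  [RiemannianBundle (fun x : M => TangentSpace (𝓡 n) x)]
  {Δ : Type*} [NormedAddCommGroup Δ] [InnerProductSpace ℂ Δ]
  {S : M → Type*} [∀ x, NormedAddCommGroup (S x)] [∀ x, InnerProductSpace ℂ (S x)]
  [TopologicalSpace (TotalSpace Δ S)] [FiberBundle Δ S]
  {ρ : SpinorModule n Δ} {σ : SpinStructure (M := M) ρ S}

namespace SpinFrame

variable {f : SpinFrame n M Δ S} {x : M}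

lemma gam_vec (hf : f ∈ σ.atlas) (hx : x ∈ f.dom) (a : Fin n) (ψ : Δ) :
    σ.gam x (f.vec a x) (f.spin x ψ) = f.spin x (ρ.gen a ψ) :=
  σ.gam_frame f hf x hx a ψ

lemma isTwistorAt_iff (hf : f ∈ σ.atlas) (hx : x ∈ f.dom)
    {φ : (x : M) → TangentSpace (𝓡 n) x → S x} {c : Fin n → M → Δ} (h : f.HasComponents φ c) :
    IsTwistorAt σ x (φ x) ↔ ∑ a, ρ.gen a (c a x) = 0 := by
  have hB : IsBilinearMap ℝ (fun u v => σ.gam x u (φ x v)) := by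
    constructor
    · intro u u' v
      simp only [_root_.map_add, LinearMap.add_apply]
    · intro r u v
      simp only [_root_.map_smul, LinearMap.smul_apply]
    · intro u v v'
      simp only [h.map_add hx, _root_.map_add]
    · intro r u v
      simp only [h.map_smul hx, LinearMap.map_smul_of_tower]
  rw [IsTwistorAt, f.contr_eq hx hB]
  simp only [h.apply_vec hx, gam_vec hf hx, ← map_sum]
  exact map_eq_zero_iff _ (f.spin x).injective

lemma HasComponents₂.hasComponents {Φ : (x : M) → TangentSpace (𝓡 n) x → TangentSpace (𝓡 n) x → S x}
    {c : Fin n → Fin n → M → Δ} (h : f.HasComponents₂ Φ c) (a : Fin n) :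
    f.HasComponents (fun y v => Φ y (f.vec a y) v) (c a) where
  smooth b := h.smooth a b
  apply y hy v := by
    rw [h.apply y hy]
    simp only [f.inner_vec hy, mul_smul, ← Finset.smul_sum]
    simp only [ite_smul, one_smul, zero_smul, Finset.sum_ite_eq, Finset.mem_univ, if_true]

/-- A bilinear expression with smooth values on the frame has these as components. -/
lemma HasComponents₂.of_isBilinearMap
    {Φ : (x : M) → TangentSpace (𝓡 n) x → TangentSpace (𝓡 n) x → S x} {c : Fin n → Fin n → M → Δ}
    (hs : ∀ a b, SmoothFun n f.dom (c a b)) (hB : ∀ y ∈ f.dom, IsBilinearMap ℝ (Φ y))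
    (hc : ∀ y ∈ f.dom, ∀ a b, Φ y (f.vec a y) (f.vec b y) = f.spin y (c a b y)) :
    f.HasComponents₂ Φ c where
  smooth := hs
  apply y hy u v := by
    simp only [map_sum, spin_real_smul, ← hc y hy, mul_smul, ← Finset.smul_sum]
    have h1 : ∀ w, ∑ b, (inner ℝ v (f.vec b y) : ℝ) • Φ y w (f.vec b y) = Φ y w v :=
      fun w => sum_inner_smul_map hy ((hB y hy).toLinearMap w) v
    simp only [h1]
    exact (sum_inner_smul_map hy ((hB y hy).toLinearMap.flip v) u).symm

variable {Φ : (x : M) → TangentSpace (𝓡 n) x → TangentSpace (𝓡 n) x → S x}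
    {c : Fin n → Fin n → M → Δ}

lemma HasComponents₂.tr_eq (h : f.HasComponents₂ Φ c) (hx : x ∈ f.dom) :
    tr Φ x = f.spin x (frameTr fun a b => c a b x) := by
  rw [tr, f.contr_eq hx (h.isBilinearMap hx)]
  simp only [h.apply_vec hx, ← map_sum]
  rfl

lemma HasComponents₂.gtr_eq_sum (h : f.HasComponents₂ Φ c) (hx : x ∈ f.dom)
    (v : TangentSpace (𝓡 n) x) :
    gtr σ Φ x v = ∑ a, σ.gam x (f.vec a x) (Φ x (f.vec a x) v) := by
  have hΦ := h.isBilinearMap hx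
  refine f.contr_eq hx ?_
  constructor
  · intro u u' v
    simp only [_root_.map_add, LinearMap.add_apply]
  · intro r u v
    simp only [_root_.map_smul, LinearMap.smul_apply]
  · intro u v v'
    simp only [hΦ.add_left, _root_.map_add]
  · intro r u v
    simp only [hΦ.smul_left, LinearMap.map_smul_of_tower]

lemma HasComponents₂.gtr_vec (h : f.HasComponents₂ Φ c) (hf : f ∈ σ.atlas) (hx : x ∈ f.dom)
    (b : Fin n) : gtr σ Φ x (f.vec b x) = f.spin x (frameGtr ρ.gen (fun a b => c a b x) b) := by
  rw [h.gtr_eq_sum hx]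
  simp only [h.apply_vec hx, gam_vec hf hx, ← map_sum]
  rfl

lemma HasComponents₂.gtr_add (h : f.HasComponents₂ Φ c) (hx : x ∈ f.dom)
    (u v : TangentSpace (𝓡 n) x) : gtr σ Φ x (u + v) = gtr σ Φ x u + gtr σ Φ x v := by
  simp only [h.gtr_eq_sum hx, (h.isBilinearMap hx).add_right, _root_.map_add,
    Finset.sum_add_distrib]

lemma HasComponents₂.gtr_smul (h : f.HasComponents₂ Φ c) (hx : x ∈ f.dom) (r : ℝ)
    (v : TangentSpace (𝓡 n) x) : gtr σ Φ x (r • v) = r • gtr σ Φ x v := by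
  simp only [h.gtr_eq_sum hx, (h.isBilinearMap hx).smul_right, LinearMap.map_smul_of_tower,
    Finset.smul_sum]

lemma HasComponents₂.isBilinearMap_proj (h : f.HasComponents₂ Φ c) (s : Summand) (hx : x ∈ f.dom) :
    IsBilinearMap ℝ (proj σ s Φ x) := by
  have hΦ := h.isBilinearMap hx
  cases s <;> constructor <;> intros <;>
    simp only [proj, projS, projT, projY, projZ, h.gtr_add hx, h.gtr_smul hx, hΦ.add_left,
      hΦ.add_right, hΦ.smul_left, hΦ.smul_right, _root_.map_add, _root_.map_smul,
      LinearMap.add_apply, LinearMap.smul_apply, LinearMap.map_smul_of_tower, inner_add_left,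
      inner_add_right, real_inner_smul_left, real_inner_smul_right] <;>
    module

lemma HasComponents₂.proj_vec (h : f.HasComponents₂ Φ c) (hf : f ∈ σ.atlas) (hx : x ∈ f.dom)
    (s : Summand) (a b : Fin n) : proj σ s Φ x (f.vec a x) (f.vec b x)
      = f.spin x (frameProj ρ.gen s (fun a b => c a b x) a b) := by
  cases s <;>
    simp only [proj, projS, projT, projY, projZ, frameProj, h.gtr_vec hf hx, h.tr_eq hx,
      h.apply_vec hx, gam_vec hf hx, f.inner_vec hx, spin_real_smul, _root_.map_add, map_sub]

variable {covT : CovariantDerivative (𝓡 n) (EuclideanSpace ℝ (Fin n))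
      (fun x : M => TangentSpace (𝓡 n) x)}

lemma nabla_eq_skewAct (c : Fin n → M → Δ) (u : TangentSpace (𝓡 n) x) (a : Fin n) :
    f.nabla covT ρ c x u a = mvfderiv (𝓡 n) (c a) x u
      + skewAct ρ.gen (f.conn covT x u) (fun a => c a x) a :=
  add_sub_assoc _ _ _

lemma nabla₂_eq_skewAct₂ (c : Fin n → Fin n → M → Δ) (u : TangentSpace (𝓡 n) x) (a b : Fin n) :
    f.nabla₂ covT ρ c x u a b = mvfderiv (𝓡 n) (c a b) x u
      + skewAct₂ ρ.gen (f.conn covT x u) (fun a b => c a b x) a b := by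
  rw [nabla₂, spinDer, skewAct₂, ← add_sub_assoc, ← add_sub_assoc]
  rfl

section Smooth

variable [FiniteDimensional ℂ Δ]

lemma smoothFun_frameProj (hc : ∀ a b, SmoothFun n f.dom (c a b)) (s : Summand) (a b : Fin n) :
    SmoothFun n f.dom (fun y => frameProj ρ.gen s (fun a b => c a b y) a b) := by
  have h : SmoothFun n f.dom (fun y a b => c a b y) :=
    contMDiffOn_pi_space.2 fun a => contMDiffOn_pi_space.2 fun b => hc a b
  exact h.clm_apply (LinearMap.toContinuousLinearMap (frameProjₗ ρ.gen s a b))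

lemma mvfderiv_frameProj (hx : x ∈ f.dom) (hc : ∀ a b, SmoothFun n f.dom (c a b)) (s : Summand)
    (a b : Fin n)
    (u : TangentSpace (𝓡 n) x) :
    mvfderiv (𝓡 n) (fun y => frameProj ρ.gen s (fun a b => c a b y) a b) x u =
      frameProj ρ.gen s (fun a b => mvfderiv (𝓡 n) (c a b) x u) a b := by
  have h' : SmoothFun n f.dom (fun y a b => c a b y) :=
    contMDiffOn_pi_space.2 fun a => contMDiffOn_pi_space.2 fun b => hc a b
  have h := h'.diffAt f.isOpen_dom hx
  have h1 := mvfderiv_clm_apply (LinearMap.toContinuousLinearMap (frameProjₗ ρ.gen s a b)) h u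
  refine h1.trans ?_
  have h2 : mvfderiv (𝓡 n) (fun y a b => c a b y) x u = fun a b => mvfderiv (𝓡 n) (c a b) x u := by
    ext a b
    exact (mvfderiv_clm_apply ((ContinuousLinearMap.proj (R := ℝ) (φ := fun _ : Fin n => Δ) b).comp
      (ContinuousLinearMap.proj (R := ℝ) (φ := fun _ : Fin n => Fin n → Δ) a)) h u).symm
  rw [h2]
  rfl

lemma HasComponents₂.proj (h : f.HasComponents₂ Φ c) (hf : f ∈ σ.atlas) (s : Summand) :
    f.HasComponents₂ (proj σ s Φ) (fun a b y => frameProj ρ.gen s (fun a b => c a b y) a b) :=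
  .of_isBilinearMap (smoothFun_frameProj h.smooth s) (fun _ hy => h.isBilinearMap_proj s hy)
    fun _ hy => h.proj_vec hf hy s

variable [IsContMDiffRiemannianBundle (𝓡 n) ∞ (EuclideanSpace ℝ (Fin n))
      (fun x : M => TangentSpace (𝓡 n) x)] (hT : IsLeviCivita covT)
include hT

/-- The projections are parallel. -/
lemma nabla₂_frameProj (hx : x ∈ f.dom) (hc : ∀ a b, SmoothFun n f.dom (c a b)) (s : Summand)
    (a b : Fin n) (u : TangentSpace (𝓡 n) x) :
    f.nabla₂ covT ρ (fun a b y => frameProj ρ.gen s (fun a b => c a b y) a b) x u a b =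
      frameProj ρ.gen s (fun a b => f.nabla₂ covT ρ c x u a b) a b := by
  -- The derivative part commutes with the projection because the coefficients in the frame are
  -- constant, the connection part because of equivariance.
  simp only [nabla₂_eq_skewAct₂, mvfderiv_frameProj hx hc]
  have h := ρ.isCliffordFamily_gen.frameProj_skewAct₂ (conn_skew hT hx u) s (fun a b => c a b x) a b
  rw [← h]
  exact ((frameProjₗ ρ.gen s a b).map_add _ _).symm

/-- The twistor bundle is parallel: the derivative part comes from differentiating `∑ a, Γ_a c_a =
0`, and the connection part from equivariance of the Clifford trace. -/
lemma sum_gen_nabla (hx : x ∈ f.dom) {c : Fin n → M → Δ} (hc : ∀ a, DiffFunAt n (c a) x)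
    (h0 : ∀ y ∈ f.dom, ∑ a, ρ.gen a (c a y) = 0) (u : TangentSpace (𝓡 n) x) :
    ∑ a, ρ.gen a (f.nabla covT ρ c x u a) = 0 := by
  have hD : ∑ a, ρ.gen a (mvfderiv (𝓡 n) (c a) x u) = 0 := by
    have h1 := (mvfderiv_sum (g := fun a y => ρ.gen a (c a y)) Finset.univ fun a _ =>
      (hc a).clm_apply (LinearMap.toContinuousLinearMap (ρ.gen a))).1
    rw [mvfderiv_eq_zero_of_eventually (c := 0)] at h1
    · have h2 := congr($h1 u)
      rw [sum_apply, zero_apply] at h2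
      rw [h2]
      exact Finset.sum_congr rfl fun a _ =>
        (mvfderiv_clm_apply (LinearMap.toContinuousLinearMap (ρ.gen a)) (hc a) u).symm
    · filter_upwards [f.isOpen_dom.mem_nhds hx] with y hy
      exact h0 y hy
  simp only [nabla_eq_skewAct, _root_.map_add, Finset.sum_add_distrib, hD,
    ρ.isCliffordFamily_gen.sum_skewAct (conn_skew hT hx u), h0 x hx, map_zero, add_zero]

lemma sum_gen_nabla₂ (hx : x ∈ f.dom) (hc : ∀ a b, DiffFunAt n (c a b) x)
    (h0 : ∀ a, ∀ y ∈ f.dom, ∑ b, ρ.gen b (c a b y) = 0) (u : TangentSpace (𝓡 n) x) (a : Fin n) :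
    ∑ b, ρ.gen b (f.nabla₂ covT ρ c x u a b) = 0 := by
  have h1 := sum_gen_nabla hT hx (hc a) (h0 a) u
  -- With the first index fixed, the remaining connection term is a linear combination of the
  -- twistors `c d`.
  have h2 : ∀ b, f.nabla₂ covT ρ c x u a b = f.nabla covT ρ (c a) x u b
      - ∑ d, f.conn covT x u a d • c d b x := fun b => by
    rw [nabla₂, nabla]
    abel
  simp only [h2, map_sub, Finset.sum_sub_distrib, h1, map_sum, _root_.map_smul]
  rw [Finset.sum_comm]
  simp [← Finset.smul_sum, h0 _ x hx]

variable [VectorBundle ℝ Δ S] {covS : CovariantDerivative (𝓡 n) Δ S}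

/-- Since the projections are parallel, they pass through the covariant derivative in `∇*` and act
on the components of `∇Φ`. -/
lemma gradAdj_eq (hS : IsSpinConnection σ covT covS) (hf : f ∈ σ.atlas) (hx : x ∈ f.dom)
    (h : f.HasComponents₂ Φ c) (s : Summand) (v : TangentSpace (𝓡 n) x) :
    gradAdj covT covS σ s Φ x v = f.spin x (∑ b, (inner ℝ v (f.vec b x) : ℝ) •
      frameLap ρ.gen (fun d a b => f.nabla₂ covT ρ c x (f.vec d x) a b) s b) := by
  rw [gradAdj, nablaStar_eq hT hS hf hx (h.proj hf s)]
  simp only [nabla₂_frameProj hT hx h.smooth]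
  rfl

end Smooth

end SpinFrame
end FrameProjections
end SpinGeom

namespace SpinGeom

open scoped Topology

section CurvatureTensor

variable {n : ℕ}
  {M : Type*} [TopologicalSpace M] [ChartedSpace (EuclideanSpace ℝ (Fin n)) M]
  [IsManifold (𝓡 n) ∞ M]

/-! ### The Riemann tensor -/

/-- The curvature operator on vector fields. -/
noncomputable def curvField (covT : CovariantDerivative (𝓡 n) (EuclideanSpace ℝ (Fin n))
      (fun x : M => TangentSpace (𝓡 n) x)) (U V W : (x : M) → TangentSpace (𝓡 n) x) (x : M) :
    TangentSpace (𝓡 n) x :=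
  covT (fun y => covT W y (V y)) x (U x) - covT (fun y => covT W y (U y)) x (V x)
    - covT W x (mlieBracket (𝓡 n) U V x)

variable {covT : CovariantDerivative (𝓡 n) (EuclideanSpace ℝ (Fin n))
      (fun x : M => TangentSpace (𝓡 n) x)} {U V W Z : (x : M) → TangentSpace (𝓡 n) x} {x : M}
  {O : Set M}

lemma curvField_swap : curvField covT U V W x = -curvField covT V U W x := by
  rw [curvField, curvField, mlieBracket_swap_apply, map_neg]
  abel

lemma exists_smoothField_extend₄ (u v w z : TangentSpace (𝓡 n) x) :
    ∃ O : Set M, IsOpen O ∧ x ∈ O ∧ SmoothField O (extend (EuclideanSpace ℝ (Fin n)) u) ∧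
      SmoothField O (extend (EuclideanSpace ℝ (Fin n)) v) ∧
      SmoothField O (extend (EuclideanSpace ℝ (Fin n)) w) ∧
      SmoothField O (extend (EuclideanSpace ℝ (Fin n)) z) := by
  obtain ⟨O1, h1, x1, s1⟩ := exists_smoothField_extend u
  obtain ⟨O2, h2, x2, s2⟩ := exists_smoothField_extend v
  obtain ⟨O3, h3, x3, s3⟩ := exists_smoothField_extend w
  obtain ⟨O4, h4, x4, s4⟩ := exists_smoothField_extend z
  exact ⟨O1 ∩ O2 ∩ O3 ∩ O4, ((h1.inter h2).inter h3).inter h4, ⟨⟨⟨x1, x2⟩, x3⟩, x4⟩,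
    s1.mono fun y hy => hy.1.1.1, s2.mono fun y hy => hy.1.1.2, s3.mono fun y hy => hy.1.2,
    s4.mono fun y hy => hy.2⟩

lemma curv_eq_curvField_extend (u v w : TangentSpace (𝓡 n) x) : curv covT x u v w =
    curvField covT (extend (EuclideanSpace ℝ (Fin n)) u) (extend (EuclideanSpace ℝ (Fin n)) v)
      (extend (EuclideanSpace ℝ (Fin n)) w) x := by
  simp only [curv, curvField, extend_apply_self]

lemma curv_swap (u v w : TangentSpace (𝓡 n) x) : curv covT x u v w = -curv covT x v u w := by
  rw [curv_eq_curvField_extend, curvField_swap, curv_eq_curvField_extend]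

variable [RiemannianBundle (fun x : M => TangentSpace (𝓡 n) x)]
  [IsContMDiffRiemannianBundle (𝓡 n) ∞ (EuclideanSpace ℝ (Fin n))
      (fun x : M => TangentSpace (𝓡 n) x)] [T2Space M] (hT : IsLeviCivita covT)
include hT

/-- For `g • U`, the derivative of `g` along `V` appears once from differentiating `∇_{gU} W` and
once, with opposite sign, from the bracket. -/
lemma tensorialAt_curvField (hO : IsOpen O) (hx : x ∈ O) (hW : SmoothField O W) :
    TensorialAt (𝓡 n) (EuclideanSpace ℝ (Fin n)) (fun U => curvField covT U V W x) x where
  smul {g U} hg hU := by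
    have h1 : covT (fun y => covT W y ((g • U) y)) x (V x) =
        g x • covT (fun y => covT W y (U y)) x (V x)
            + mvfderiv (𝓡 n) g x (V x) • covT W x (U x) := by
      simp only [Pi.smul_apply', map_smul]
      exact cov_smul hg (hT.diffFieldAt_cov hO hW hx hU) _
    rw [curvField, curvField, h1, mlieBracket_smul_left hg hU]
    simp only [Pi.smul_apply', map_smul, map_add, map_neg, neg_smul]
    module
  add {U U'} hU hU' := by
    have h1 : covT (fun y => covT W y ((U + U') y)) x (V x) =
        covT (fun y => covT W y (U y)) x (V x) + covT (fun y => covT W y (U' y)) x (V x) := by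
      simp only [Pi.add_apply, map_add]
      exact cov_add (hT.diffFieldAt_cov hO hW hx hU) (hT.diffFieldAt_cov hO hW hx hU') _
    rw [curvField, curvField, curvField, h1, mlieBracket_add_left hU hU']
    simp only [Pi.add_apply, map_add]
    module

/-- Apply the commutator of derivations to the function `⟨W, Z⟩`. The mixed products of first
derivatives are symmetric in the two directions and cancel. -/
lemma inner_curvField [NeZero n] (hO : IsOpen O) (hx : x ∈ O) (hU : SmoothField O U)
    (hV : SmoothField O V) (hW : SmoothField O W) (hZ : SmoothField O Z) :
    (inner ℝ (curvField covT U V W x) (Z x) : ℝ) = -inner ℝ (W x) (curvField covT U V Z x) := by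
  have h := mvfderiv_mlieBracket hO (hW.inner hZ) hU hV hx
  have key : ∀ {X Y : (x : M) → TangentSpace (𝓡 n) x}, SmoothField O X → SmoothField O Y →
      mvfderiv (𝓡 n) (fun y => mvfderiv (𝓡 n) (fun z => (inner ℝ (W z) (Z z) : ℝ)) y (Y y)) x (X x)
      = inner ℝ (covT (fun y => covT W y (Y y)) x (X x)) (Z x)
        + inner ℝ (covT W x (Y x)) (covT Z x (X x))
        + (inner ℝ (covT W x (X x)) (covT Z x (Y x))
        + inner ℝ (W x) (covT (fun y => covT Z y (Y y)) x (X x))) := by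
    intro X Y hX hY
    have e : (fun y => mvfderiv (𝓡 n) (fun z => (inner ℝ (W z) (Z z) : ℝ)) y (Y y)) =ᶠ[𝓝 x]
        fun y => (inner ℝ (covT W y (Y y)) (Z y) : ℝ) + inner ℝ (W y) (covT Z y (Y y)) := by
      filter_upwards [hO.mem_nhds hx] with y hy
      exact hT.mvfderiv_inner (hW.diffAt hO hy) (hZ.diffAt hO hy) _
    have dWY := (hT.smoothField_cov hO hW hY).diffAt hO hx
    have dZY := (hT.smoothField_cov hO hZ hY).diffAt hO hx
    have dW := hW.diffAt hO hx
    have dZ := hZ.diffAt hO hx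
    rw [mvfderiv_congr e, mvfderiv_add_apply (dWY.inner dZ) (dW.inner dZY),
      hT.mvfderiv_inner dWY dZ, hT.mvfderiv_inner dW dZY]
  rw [key hU hV, key hV hU, hT.mvfderiv_inner (hW.diffAt hO hx) (hZ.diffAt hO hx)] at h
  simp only [curvField, inner_sub_left, inner_sub_right]
  linarith

/-- Vanishing torsion rewrites the cyclic sum of second covariant derivatives in terms of iterated
brackets, and the Jacobi identity finishes. -/
lemma curvField_bianchi (hO : IsOpen O) (hx : x ∈ O) (hU : SmoothField O U)
    (hV : SmoothField O V) (hW : SmoothField O W) :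
    curvField covT U V W x + curvField covT V W U x + curvField covT W U V x = 0 := by
  have key : ∀ {X Y Q : (x : M) → TangentSpace (𝓡 n) x}, SmoothField O X → SmoothField O Y →
      SmoothField O Q → covT (fun y => covT Q y (Y y)) x (X x) =
        covT (fun y => covT Y y (Q y)) x (X x) + (mlieBracket (𝓡 n) X (mlieBracket (𝓡 n) Y Q) x
          + covT X x (mlieBracket (𝓡 n) Y Q x)) := by
    intro X Y Q hX hY hQ
    have dYQ := hY.mlieBracket hO hQ
    have d1 := hT.smoothField_cov hO hY hQ
    have d2 := hT.smoothField_cov hO hQ hY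
    have e : ∀ᶠ y in 𝓝 x, covT Q y (Y y) = covT Y y (Q y) + mlieBracket (𝓡 n) Y Q y := by
      filter_upwards [hO.mem_nhds hx] with y hy
      rw [hT.mlieBracket_eq (hY.diffAt hO hy) (hQ.diffAt hO hy)]
      abel
    rw [cov_congr (W := fun y => covT Y y (Q y) + mlieBracket (𝓡 n) Y Q y) (d2.diffAt hO hx)
        (SmoothField.diffAt hO (d1.add_section dYQ) hx) e,
      cov_add (d1.diffAt hO hx) (dYQ.diffAt hO hx),
      hT.mlieBracket_eq (hX.diffAt hO hx) (dYQ.diffAt hO hx)]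
    abel
  have two : ∀ {Z : (x : M) → TangentSpace (𝓡 n) x}, SmoothField O Z →
      ContMDiffAt (𝓡 n) ((𝓡 n).prod 𝓘(ℝ, EuclideanSpace ℝ (Fin n))) (minSmoothness ℝ 2)
        (fun x => TotalSpace.mk' (EuclideanSpace ℝ (Fin n)) x (Z x)) x := by
    intro Z hZ
    rw [minSmoothness_of_isRCLikeNormedField]
    exact (hZ.contMDiffAt (hO.mem_nhds hx)).of_le ENat.LEInfty.out
  have : IsManifold (𝓡 n) (minSmoothness ℝ 3) M := by
    rw [minSmoothness_of_isRCLikeNormedField]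
    infer_instance
  have j := leibniz_identity_mlieBracket_apply (two hU) (two hV) (two hW)
  have s1 : mlieBracket (𝓡 n) (mlieBracket (𝓡 n) U V) W x
      = -mlieBracket (𝓡 n) W (mlieBracket (𝓡 n) U V) x := mlieBracket_swap_apply ..
  have s2 : mlieBracket (𝓡 n) V (mlieBracket (𝓡 n) U W) x
      = -mlieBracket (𝓡 n) V (mlieBracket (𝓡 n) W U) x := by
    have e : mlieBracket (𝓡 n) U W = (fun _ : M => (-1 : ℝ)) • mlieBracket (𝓡 n) W U := by
      ext1 y
      rw [mlieBracket_swap_apply]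
      simp
    rw [e, mlieBracket_smul_right (mdifferentiableAt_const) ((hW.mlieBracket hO hU).diffAt hO hx),
      mvfderiv_const]
    simp
  rw [s1, s2] at j
  simp only [curvField]
  rw [key hU hV hW, key hV hW hU, key hW hU hV, j]
  abel

lemma curv_bianchi (u v w : TangentSpace (𝓡 n) x) :
    curv covT x u v w + curv covT x v w u + curv covT x w u v = 0 := by
  obtain ⟨O, hO, hx, hu, hv, hw, -⟩ := exists_smoothField_extend₄ u v w u
  simp only [curv_eq_curvField_extend]
  exact curvField_bianchi hT hO hx hu hv hw

lemma inner_curv [NeZero n] (u v w z : TangentSpace (𝓡 n) x) :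
    (inner ℝ (curv covT x u v w) z : ℝ) = -inner ℝ w (curv covT x u v z) := by
  obtain ⟨O, hO, hx, hu, hv, hw, hz⟩ := exists_smoothField_extend₄ u v w z
  have h := inner_curvField hT hO hx hu hv hw hz
  simpa only [← curv_eq_curvField_extend, extend_apply_self] using h

lemma curv_add_left (u u' v w : TangentSpace (𝓡 n) x) :
    curv covT x (u + u') v w = curv covT x u v w + curv covT x u' v w := by
  obtain ⟨O, hO, hx, -, -, hw, -⟩ := exists_smoothField_extend₄ u v w u
  have h := (TensorialAt.mkHom _ _ (tensorialAt_curvField (V := extend (EuclideanSpace ℝ (Fin n)) v)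
    hT hO hx hw)).map_add u u'
  simpa only [TensorialAt.mkHom_apply_eq_extend, ← curv_eq_curvField_extend] using h

lemma curv_smul_left (r : ℝ) (u v w : TangentSpace (𝓡 n) x) :
    curv covT x (r • u) v w = r • curv covT x u v w := by
  obtain ⟨O, hO, hx, -, -, hw, -⟩ := exists_smoothField_extend₄ u v w u
  have h := (TensorialAt.mkHom _ _ (tensorialAt_curvField (V := extend (EuclideanSpace ℝ (Fin n)) v)
    hT hO hx hw)).map_smul r u
  simpa only [TensorialAt.mkHom_apply_eq_extend, ← curv_eq_curvField_extend] using h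

/-- The extensions in the definition of `curv` may be replaced by arbitrary smooth fields, one slot
at a time: the first by tensoriality, the second by antisymmetry, and the third by pairing with a
vector and using skew-adjointness. -/
lemma curv_eq_curvField [NeZero n] (hO : IsOpen O) (hx : x ∈ O) (hU : SmoothField O U)
    (hV : SmoothField O V) (hW : SmoothField O W) :
    curv covT x (U x) (V x) (W x) = curvField covT U V W x := by
  refine ext_inner_right ℝ fun z => ?_
  obtain ⟨O', hO', hx', -, -, hw', hz'⟩ := exists_smoothField_extend₄ (U x) (V x) (W x) z
  have hI := hO.inter hO'
  have hxI : x ∈ O ∩ O' := ⟨hx, hx'⟩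
  have hU : SmoothField (O ∩ O') U := hU.mono Set.inter_subset_left
  have hV : SmoothField (O ∩ O') V := hV.mono Set.inter_subset_left
  have hW : SmoothField (O ∩ O') W := hW.mono Set.inter_subset_left
  have hw : SmoothField (O ∩ O') _ := hw'.mono Set.inter_subset_right
  have hz : SmoothField (O ∩ O') _ := hz'.mono Set.inter_subset_right
  set Z := extend (EuclideanSpace ℝ (Fin n)) z
  have hZx : Z x = z := extend_apply_self _ z
  have e1 : curv covT x (U x) (V x) (W x) =
      curvField covT U (extend (EuclideanSpace ℝ (Fin n)) (V x))
        (extend (EuclideanSpace ℝ (Fin n)) (W x)) x := by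
    rw [curv_eq_curvField_extend]
    exact (tensorialAt_curvField hT hI hxI hw).pointwise (mdifferentiableAt_extend ..)
      (hU.diffAt hI hxI) (extend_apply_self _ _)
  have e2 : curvField covT U (extend (EuclideanSpace ℝ (Fin n)) (V x))
        (extend (EuclideanSpace ℝ (Fin n)) (W x)) x =
      curvField covT U V (extend (EuclideanSpace ℝ (Fin n)) (W x)) x := by
    rw [curvField_swap, curvField_swap (V := V), neg_inj]
    exact (tensorialAt_curvField hT hI hxI hw).pointwise (mdifferentiableAt_extend ..)
      (hV.diffAt hI hxI) (extend_apply_self _ _)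
  rw [e1, e2, ← hZx, inner_curvField hT hI hxI hU hV hw hz, inner_curvField hT hI hxI hU hV hW hz,
    extend_apply_self]

lemma curv_add_middle (u v v' w : TangentSpace (𝓡 n) x) :
    curv covT x u (v + v') w = curv covT x u v w + curv covT x u v' w := by
  rw [curv_swap, curv_add_left hT, curv_swap v, curv_swap v']
  abel

lemma curv_smul_middle (r : ℝ) (u v w : TangentSpace (𝓡 n) x) :
    curv covT x u (r • v) w = r • curv covT x u v w := by
  rw [curv_swap, curv_smul_left hT, curv_swap v]
  module

lemma curv_add_right [NeZero n] (u v w w' : TangentSpace (𝓡 n) x) :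
    curv covT x u v (w + w') = curv covT x u v w + curv covT x u v w' := by
  refine ext_inner_right ℝ fun z => ?_
  rw [inner_add_left, inner_curv hT, inner_curv hT, inner_curv hT, inner_add_left]
  ring

lemma curv_smul_right [NeZero n] (r : ℝ) (u v w : TangentSpace (𝓡 n) x) :
    curv covT x u v (r • w) = r • curv covT x u v w := by
  refine ext_inner_right ℝ fun z => ?_
  rw [real_inner_smul_left, inner_curv hT, inner_curv hT, real_inner_smul_left]
  ring

end CurvatureTensor
end SpinGeom

namespace SpinGeom

open scoped Topology

/-! ### Commutators of the actions of skew matrices -/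

section SkewCommutator

variable {n : ℕ} {V : Type*} [AddCommGroup V] [Module ℝ V]
  {Γ : Fin n → Module.End ℝ V} {P Q : Fin n → Fin n → ℝ}

/-- The matrix of the commutator of the actions of two skew matrices. -/
def skewComm (P Q : Fin n → Fin n → ℝ) (a b : Fin n) : ℝ :=
  ∑ k, Q a k * P k b - ∑ k, P a k * Q k b

/-- By `skewSpin_apply`, the action of `P` is a derivation on each product `Γ a Γ b` in the action
of `Q`. The two derivation terms assemble into the matrix `QP - PQ`. -/
lemma IsCliffordFamily.skewSpin_comm (hΓ : IsCliffordFamily Γ) (hP : ∀ a b, P a b = -P b a)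
    (ψ : V) :
    skewSpin Γ P (skewSpin Γ Q ψ) - skewSpin Γ Q (skewSpin Γ P ψ)
      = skewSpin Γ (skewComm P Q) ψ := by
  have e : ∀ R : Fin n → Fin n → ℝ, ∀ χ, skewSpin Γ R χ
      = (1 / 4 : ℝ) • ∑ a, ∑ b, R a b • Γ a (Γ b χ) := by
    intro R χ
    simp only [skewSpin, LinearMap.smul_apply, LinearMap.sum_apply, Module.End.mul_apply]
  have h1 : skewSpin Γ P (skewSpin Γ Q ψ) = (1 / 4 : ℝ) • ∑ a, ∑ b, Q a b •
      (Γ a (Γ b (skewSpin Γ P ψ)) + ∑ d, P b d • Γ a (Γ d ψ) + ∑ d, P a d • Γ d (Γ b ψ)) := by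
    rw [e Q]
    simp only [map_smul, map_sum, hΓ.skewSpin_apply hP, map_add]
  have h2 : ∑ a, ∑ b, Q a b • ∑ d, P b d • Γ a (Γ d ψ)
      = ∑ a, ∑ b, (∑ k, Q a k * P k b) • Γ a (Γ b ψ) := by
    refine Finset.sum_congr rfl fun a _ => ?_
    simp only [Finset.smul_sum, smul_smul, Finset.sum_smul]
    exact Finset.sum_comm
  have h3 : ∑ a, ∑ b, Q a b • ∑ d, P a d • Γ d (Γ b ψ)
      = -∑ a, ∑ b, (∑ k, P a k * Q k b) • Γ a (Γ b ψ) := by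
    simp only [Finset.smul_sum, smul_smul, Finset.sum_smul, ← Finset.sum_neg_distrib]
    refine (Finset.sum_congr rfl fun a _ => Finset.sum_comm).trans ?_
    rw [Finset.sum_comm]
    refine Finset.sum_congr rfl fun d _ => ?_
    rw [Finset.sum_comm]
    refine Finset.sum_congr rfl fun b _ => Finset.sum_congr rfl fun k _ => ?_
    rw [hP k d]
    module
  rw [h1]
  simp only [smul_add, Finset.sum_add_distrib, h2, h3]
  rw [e Q (skewSpin Γ P ψ), e (skewComm P Q)]
  simp only [skewComm, sub_smul, Finset.sum_sub_distrib]
  module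

lemma IsCliffordFamily.skewAct_comm (hΓ : IsCliffordFamily Γ) (hP : ∀ a b, P a b = -P b a)
    (φ : Fin n → V) (b : Fin n) :
    skewAct Γ P (skewAct Γ Q φ) b - skewAct Γ Q (skewAct Γ P φ) b
      = skewAct Γ (skewComm P Q) φ b := by
  have h := hΓ.skewSpin_comm (Q := Q) hP (φ b)
  simp only [skewAct, map_sub, map_sum, map_smul, smul_sub, Finset.sum_sub_distrib, Finset.smul_sum,
    smul_smul, skewComm, sub_smul, Finset.sum_smul]
  rw [Finset.sum_comm (f := fun d k => (Q b k * P k d) • φ d),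
    Finset.sum_comm (f := fun d k => (P b k * Q k d) • φ d), ← h]
  abel

lemma skewAct_sub_left (φ : Fin n → V) (b : Fin n) : skewAct Γ (fun a b => P a b - Q a b) φ b
    = skewAct Γ P φ b - skewAct Γ Q φ b := by
  simp only [skewAct, skewSpin, sub_smul, Finset.sum_sub_distrib, smul_sub, LinearMap.sub_apply]
  abel

lemma skewAct_add_left (φ : Fin n → V) (b : Fin n) : skewAct Γ (fun a b => P a b + Q a b) φ b
    = skewAct Γ P φ b + skewAct Γ Q φ b := by
  simp only [skewAct, skewSpin, add_smul, Finset.sum_add_distrib, smul_add, LinearMap.add_apply]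
  abel

lemma skewAct_add_right (φ χ : Fin n → V) (b : Fin n) : skewAct Γ P (fun a => φ a + χ a) b
    = skewAct Γ P φ b + skewAct Γ P χ b := by
  simp only [skewAct, map_add, smul_add, Finset.sum_add_distrib]
  abel

lemma skewAct_eq_sum (φ : Fin n → V) (b : Fin n) : skewAct Γ P φ b
    = ∑ i : Fin n × Fin n, P i.1 i.2 • ((1 / 4 : ℝ) • Γ i.1 (Γ i.2 (φ b)))
      - ∑ d, P b d • φ d := by
  simp only [skewAct, skewSpin, LinearMap.smul_apply, LinearMap.sum_apply, Module.End.mul_apply,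
    Fintype.sum_prod_type, Finset.smul_sum, smul_comm (1 / 4 : ℝ)]

end SkewCommutator

lemma mvfderiv_skewAct {n : ℕ} {M : Type*} [TopologicalSpace M]
    [ChartedSpace (EuclideanSpace ℝ (Fin n)) M] {Δ : Type*} [NormedAddCommGroup Δ]
    [InnerProductSpace ℂ Δ] [FiniteDimensional ℂ Δ] {ρ : SpinorModule n Δ} {x : M}
    {A : M → Fin n → Fin n → ℝ} {c : Fin n → M → Δ}
    (hA : ∀ a b, DiffFunAt n (fun y => A y a b) x) (hc : ∀ a, DiffFunAt n (c a) x) (b : Fin n)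
    (u : TangentSpace (𝓡 n) x) :
    mvfderiv (𝓡 n) (fun y => skewAct ρ.gen (A y) (fun a => c a y) b) x u =
      skewAct ρ.gen (fun a b => mvfderiv (𝓡 n) (fun y => A y a b) x u) (fun a => c a x) b
        + skewAct ρ.gen (A x) (fun a => mvfderiv (𝓡 n) (c a) x u) b := by
  let L : Fin n × Fin n → Δ →L[ℝ] Δ := fun i =>
    LinearMap.toContinuousLinearMap ((1 / 4 : ℝ) • (ρ.gen i.1 * ρ.gen i.2))
  have hL : ∀ i ψ, (1 / 4 : ℝ) • ρ.gen i.1 (ρ.gen i.2 ψ) = L i ψ := fun i ψ => rfl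
  simp only [skewAct_eq_sum, hL]
  have h1 := mvfderiv_sum_smul (Finset.univ (α := Fin n × Fin n)) (fun i _ => hA i.1 i.2)
    (fun i _ => (hc b).clm_apply (L i)) u
  have h2 := mvfderiv_sum_smul (Finset.univ (α := Fin n)) (fun d _ => hA b d) (fun d _ => hc d) u
  have d1 := (mvfderiv_sum (g := fun (i : Fin n × Fin n) y => A y i.1 i.2 • L i (c b y)) Finset.univ
    fun i _ => (hA i.1 i.2).smul ((hc b).clm_apply (L i))).2
  have d2 := (mvfderiv_sum (g := fun d y => A y b d • c d y) Finset.univ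
    fun d _ => (hA b d).smul (hc d)).2
  rw [mvfderiv_fun_sub d1 d2, sub_apply, h1, h2]
  simp only [mvfderiv_clm_apply (L _) (hc b), Finset.sum_add_distrib]
  abel

section FrameCurvature

variable {n : ℕ}
  {M : Type*} [TopologicalSpace M] [ChartedSpace (EuclideanSpace ℝ (Fin n)) M]
  [IsManifold (𝓡 n) ∞ M]
  [RiemannianBundle (fun x : M => TangentSpace (𝓡 n) x)]
  {Δ : Type*} [NormedAddCommGroup Δ] [InnerProductSpace ℂ Δ]
  {S : M → Type*} [∀ x, NormedAddCommGroup (S x)] [∀ x, InnerProductSpace ℂ (S x)]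
  [TopologicalSpace (TotalSpace Δ S)] [FiberBundle Δ S]

/-! ### Curvature in a spin frame -/

namespace SpinFrame

variable (f : SpinFrame n M Δ S)
  (covT : CovariantDerivative (𝓡 n) (EuclideanSpace ℝ (Fin n)) (fun x : M => TangentSpace (𝓡 n) x))

/-- The components `⟨R(e_c, e_a) e_b, e_d⟩` of the Riemann tensor. -/
noncomputable def riem (x : M) (c a b d : Fin n) : ℝ :=
  inner ℝ (curv covT x (f.vec c x) (f.vec a x) (f.vec b x)) (f.vec d x)

variable {f covT} {x : M} [IsContMDiffRiemannianBundle (𝓡 n) ∞ (EuclideanSpace ℝ (Fin n))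
      (fun x : M => TangentSpace (𝓡 n) x)] [T2Space M] (hT : IsLeviCivita covT)
include hT

lemma isCurvatureLike_riem [NeZero n] (x : M) : IsCurvatureLike (f.riem covT x) where
  swap_left c a b d := by rw [riem, riem, curv_swap, inner_neg_left]
  swap_right c a b d := by rw [riem, riem, inner_curv hT, real_inner_comm]
  bianchi c a b d := by
    rw [riem, riem, riem, ← inner_add_left, ← inner_add_left, curv_bianchi hT, inner_zero_left]

/-- The structure equation. -/
lemma riem_eq [NeZero n] (hx : x ∈ f.dom) (c a b d : Fin n) : f.riem covT x c a b d =
    mvfderiv (𝓡 n) (fun y => f.conn covT y (f.vec a y) b d) x (f.vec c x)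
      - mvfderiv (𝓡 n) (fun y => f.conn covT y (f.vec c y) b d) x (f.vec a x)
      - f.conn covT x (mlieBracket (𝓡 n) (f.vec c) (f.vec a) x) b d
      + skewComm (f.conn covT x (f.vec c x)) (f.conn covT x (f.vec a x)) b d := by
  have hd := fun a b => (hT.smoothField_cov f.isOpen_dom (f.smooth b) (f.smooth a)).diffAt
    f.isOpen_dom hx
  rw [riem, curv_eq_curvField hT f.isOpen_dom hx (f.smooth c) (f.smooth a) (f.smooth b), curvField,
    inner_sub_left, inner_sub_left, inner_cov hT hx (hd a b), inner_cov hT hx (hd c b), skewComm]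
  simp only [conn]
  ring

variable [FiniteDimensional ℂ Δ] {ρ : SpinorModule n Δ}

/-- The Ricci identity for twistors. -/
lemma nabla₂_nabla_sub [NeZero n] (hx : x ∈ f.dom) {φ : Fin n → M → Δ}
    (hφ : ∀ a, SmoothFun n f.dom (φ a)) (c a b : Fin n) :
    f.nabla₂ covT ρ (fun a b y => f.nabla covT ρ φ y (f.vec a y) b) x (f.vec c x) a b
      - f.nabla₂ covT ρ (fun a b y => f.nabla covT ρ φ y (f.vec a y) b) x (f.vec a x) c b
      = frameCurvAct ρ.gen (f.riem covT x) (fun a => φ a x) c a b := by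
  set L := mlieBracket (𝓡 n) (f.vec c) (f.vec a) x with hL
  have hLs : L =
      ∑ d, (f.conn covT x (f.vec c x) a d - f.conn covT x (f.vec a x) c d) • f.vec d x := by
    rw [hL, hT.mlieBracket_eq ((f.smooth c).diffAt f.isOpen_dom hx)
      ((f.smooth a).diffAt f.isOpen_dom hx), cov_vec covT hx, cov_vec covT hx]
    simp only [sub_smul, Finset.sum_sub_distrib]
  -- The second derivative is expanded into pure second derivatives, derivatives of the connection,
  -- mixed terms, products of connections, and the term from the first tensor index.
  have hD : ∀ c a : Fin n,
      f.nabla₂ covT ρ (fun a b y => f.nabla covT ρ φ y (f.vec a y) b) x (f.vec c x) a b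
      = mvfderiv (𝓡 n) (fun y => mvfderiv (𝓡 n) (φ b) y (f.vec a y)) x (f.vec c x)
        + (skewAct ρ.gen (fun b d => mvfderiv (𝓡 n) (fun y => f.conn covT y (f.vec a y) b d) x
            (f.vec c x)) (fun a => φ a x) b
        + skewAct ρ.gen (f.conn covT x (f.vec a x))
            (fun b => mvfderiv (𝓡 n) (φ b) x (f.vec c x)) b)
        + (skewAct ρ.gen (f.conn covT x (f.vec c x))
            (fun b => mvfderiv (𝓡 n) (φ b) x (f.vec a x)) b
        + skewAct ρ.gen (f.conn covT x (f.vec c x))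
            (skewAct ρ.gen (f.conn covT x (f.vec a x)) (fun a => φ a x)) b)
        - ∑ d, f.conn covT x (f.vec c x) a d • f.nabla covT ρ φ x (f.vec d x) b := by
    intro c a
    have hA := fun b d => (smoothFun_conn hT (f.smooth a) b d).diffAt f.isOpen_dom hx
    have hφx := fun a => (hφ a).diffAt f.isOpen_dom hx
    have hDφ := (SmoothFun.mvfderiv_apply f.isOpen_dom (hφ b) (f.smooth a)).diffAt f.isOpen_dom hx
    have hn := (smoothFun_nabla ρ hT (f.smooth a) hφ b).diffAt f.isOpen_dom hx
    have e1 : f.nabla₂ covT ρ (fun a b y => f.nabla covT ρ φ y (f.vec a y) b) x (f.vec c x) a b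
      = f.nabla covT ρ (fun b y => f.nabla covT ρ φ y (f.vec a y) b) x (f.vec c x) b
        - ∑ d, f.conn covT x (f.vec c x) a d • f.nabla covT ρ φ x (f.vec d x) b := by
      rw [nabla₂, nabla]
      abel
    have hsk : DiffFunAt n
        (fun y => skewAct ρ.gen (f.conn covT y (f.vec a y)) (fun a => φ a y) b) x := by
      have := hn.sub hDφ
      refine this.congr_of_eventuallyEq (.of_forall fun y => ?_)
      simp [nabla_eq_skewAct]
    rw [e1, nabla_eq_skewAct]
    simp only [nabla_eq_skewAct (c := φ)]
    rw [mvfderiv_add_apply hDφ hsk, mvfderiv_skewAct hA hφx, skewAct_add_right]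
  have hR : frameCurvAct ρ.gen (f.riem covT x) (fun a => φ a x) c a b
      = skewAct ρ.gen (f.riem covT x c a) (fun a => φ a x) b := by
    simp only [frameCurvAct, skewAct, skewSpin, LinearMap.smul_apply, LinearMap.sum_apply,
      Module.End.mul_apply]
  have hR2 : f.riem covT x c a = fun b d =>
    (mvfderiv (𝓡 n) (fun y => f.conn covT y (f.vec a y) b d) x (f.vec c x)
      - mvfderiv (𝓡 n) (fun y => f.conn covT y (f.vec c y) b d) x (f.vec a x)
      - f.conn covT x L b d)
      + skewComm (f.conn covT x (f.vec c x)) (f.conn covT x (f.vec a x)) b d := by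
    ext b d
    exact riem_eq hT hx c a b d
  -- Because the torsion vanishes, the terms from the first tensor index combine into the derivative
  -- along `[e_c, e_a]`.
  have hS : ∑ d, f.conn covT x (f.vec c x) a d • f.nabla covT ρ φ x (f.vec d x) b
      - ∑ d, f.conn covT x (f.vec a x) c d • f.nabla covT ρ φ x (f.vec d x) b
      = f.nabla covT ρ φ x L b := by
    rw [hLs, ← Finset.sum_sub_distrib]
    simp only [← sub_smul]
    have h := (isLinearMap_nabla f covT ρ φ x b)
    have := (map_sum h.mk' (fun d => (f.conn covT x (f.vec c x) a d - f.conn covT x (f.vec a x) c d)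
      • f.vec d x) Finset.univ).symm
    simpa only [_root_.map_smul, IsLinearMap.mk'_apply] using this
  have hB := mvfderiv_mlieBracket f.isOpen_dom (hφ b) (f.smooth c) (f.smooth a) hx
  rw [hR, hR2, skewAct_add_left, skewAct_sub_left, skewAct_sub_left,
    ← ρ.isCliffordFamily_gen.skewAct_comm (conn_skew hT hx _), hD c a, hD a c]
  rw [nabla_eq_skewAct] at hS
  -- The mixed terms are symmetric in `c` and `a` and drop out. `hB` handles the pure second
  -- derivatives, and the connection terms are those of the structure equation.
  linear_combination (norm := module) -hB - hS

end SpinFrame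
end FrameCurvature
end SpinGeom

namespace SpinGeom

open scoped Topology

section CurvatureActions

variable {n : ℕ}
  {M : Type*} [TopologicalSpace M] [ChartedSpace (EuclideanSpace ℝ (Fin n)) M]
  [IsManifold (𝓡 n) ∞ M]
  [RiemannianBundle (fun x : M => TangentSpace (𝓡 n) x)]

/-! ### The curvature actions in a spin frame -/

section Multilinear

variable {covT : CovariantDerivative (𝓡 n) (EuclideanSpace ℝ (Fin n))
  (fun x : M => TangentSpace (𝓡 n) x)} {x : M} [NeZero n]
  [IsContMDiffRiemannianBundle (𝓡 n) ∞ (EuclideanSpace ℝ (Fin n))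
      (fun x : M => TangentSpace (𝓡 n) x)] [T2Space M] (hT : IsLeviCivita covT)
include hT

omit [NeZero n] in
lemma isBilinearMap_inner_curv_left (v w : TangentSpace (𝓡 n) x) :
    IsBilinearMap ℝ (fun u u' => (inner ℝ (curv covT x u v w) u' : ℝ)) where
  add_left u u' z := by rw [curv_add_left hT, inner_add_left]
  add_right u z z' := by rw [inner_add_right]
  smul_left r u z := by rw [curv_smul_left hT, real_inner_smul_left, smul_eq_mul]
  smul_right r u z := by rw [real_inner_smul_right, smul_eq_mul]

lemma isBilinearMap_ricci : IsBilinearMap ℝ (ricci covT x) where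
  add_left w w' v := by
    simp only [ricci, contr, curv_add_right hT, inner_add_left, Finset.sum_add_distrib]
  add_right w v v' := by
    simp only [ricci, contr, curv_add_middle hT, inner_add_left, Finset.sum_add_distrib]
  smul_left r w v := by
    simp only [ricci, contr, curv_smul_right hT, real_inner_smul_left, ← Finset.mul_sum,
        smul_eq_mul]
  smul_right r w v := by
    simp only [ricci, contr, curv_smul_middle hT, real_inner_smul_left, ← Finset.mul_sum,
        smul_eq_mul]

lemma isBilinearMap_einstein : IsBilinearMap ℝ (einstein covT x) := by
  have h := isBilinearMap_ricci hT (x := x)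
  constructor <;> intros <;>
    simp only [einstein, h.add_left, h.add_right, h.smul_left, h.smul_right, inner_add_left,
      inner_add_right, real_inner_smul_left, real_inner_smul_right, smul_eq_mul] <;> ring

lemma isBilinearMap_schouten : IsBilinearMap ℝ (schouten covT x) := by
  have h := isBilinearMap_ricci hT (x := x)
  constructor <;> intros <;>
    simp only [schouten, h.add_left, h.add_right, h.smul_left, h.smul_right, inner_add_left,
      inner_add_right, real_inner_smul_left, real_inner_smul_right, smul_eq_mul] <;> ring

lemma isBilinearMap_weyl_left (k l : TangentSpace (𝓡 n) x) :
    IsBilinearMap ℝ (fun a b => weyl covT x a b k l) := by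
  have h := isBilinearMap_schouten hT (x := x)
  constructor <;> intros <;>
    simp only [weyl, h.add_left, h.smul_left, inner_add_left,
      inner_add_right, real_inner_smul_left, real_inner_smul_right, smul_eq_mul, curv_add_right hT,
      curv_smul_right hT] <;> ring

lemma isBilinearMap_weyl_right (a b : TangentSpace (𝓡 n) x) :
    IsBilinearMap ℝ (fun k l => weyl covT x a b k l) := by
  have h := isBilinearMap_schouten hT (x := x)
  constructor <;> intros <;>
    simp only [weyl, h.add_right, h.smul_right, inner_add_left,
      inner_add_right, real_inner_smul_left, real_inner_smul_right, smul_eq_mul, curv_add_left hT,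
      curv_smul_left hT, curv_add_middle hT, curv_smul_middle hT] <;> ring

end Multilinear

variable {Δ : Type*} [NormedAddCommGroup Δ] [InnerProductSpace ℂ Δ]
  {S : M → Type*} [∀ x, NormedAddCommGroup (S x)] [∀ x, InnerProductSpace ℂ (S x)]
  [TopologicalSpace (TotalSpace Δ S)] [FiberBundle Δ S]

namespace SpinFrame

variable {f : SpinFrame n M Δ S}
  {covT : CovariantDerivative (𝓡 n) (EuclideanSpace ℝ (Fin n)) (fun x : M => TangentSpace (𝓡 n) x)}
  {x : M} [NeZero n] [IsContMDiffRiemannianBundle (𝓡 n) ∞ (EuclideanSpace ℝ (Fin n))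
      (fun x : M => TangentSpace (𝓡 n) x)] [T2Space M] (hT : IsLeviCivita covT)
include hT

omit [NeZero n] in
lemma ricci_vec (hx : x ∈ f.dom) (b a : Fin n) :
    ricci covT x (f.vec b x) (f.vec a x) = frameRic (f.riem covT x) b a :=
  f.contr_eq hx (isBilinearMap_inner_curv_left hT _ _)

lemma scal_eq (hx : x ∈ f.dom) : scal covT x = frameScal (f.riem covT x) := by
  rw [scal, f.contr_eq hx (isBilinearMap_ricci hT)]
  simp only [ricci_vec hT hx]
  rfl

lemma einstein_vec (hx : x ∈ f.dom) (a b : Fin n) :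
    einstein covT x (f.vec a x) (f.vec b x) = frameEinstein (f.riem covT x) a b := by
  rw [einstein, ricci_vec hT hx, scal_eq hT hx, f.inner_vec hx]
  rfl

lemma schouten_vec (hx : x ∈ f.dom) (a b : Fin n) :
    schouten covT x (f.vec a x) (f.vec b x) = frameSchouten (f.riem covT x) a b := by
  rw [schouten, ricci_vec hT hx, scal_eq hT hx, f.inner_vec hx]
  rfl

lemma weyl_vec (hx : x ∈ f.dom) (a b k l : Fin n) :
    weyl covT x (f.vec a x) (f.vec b x) (f.vec k x) (f.vec l x)
      = frameWeyl (f.riem covT x) a b k l := by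
  simp only [weyl, schouten_vec hT hx, f.inner_vec hx]
  rfl

variable {ρ : SpinorModule n Δ} {σ : SpinStructure (M := M) ρ S}
  {φ : (x : M) → TangentSpace (𝓡 n) x → S x} {c : Fin n → M → Δ}

lemma einsteinAct_eq (h : f.HasComponents φ c) (hf : f ∈ σ.atlas) (hx : x ∈ f.dom)
    (v : TangentSpace (𝓡 n) x) :
    einsteinAct covT σ φ x v = f.spin x (∑ m, (inner ℝ v (f.vec m x) : ℝ) •
      frameEinsteinAct ρ.gen (f.riem covT x) (fun a => c a x) m) := by
  have hE := isBilinearMap_einstein hT (x := x)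
  have hl : IsLinearMap ℝ (einsteinAct covT σ φ x) := by
    constructor <;> intros <;>
      simp only [einsteinAct, contr, hE.add_left, hE.smul_left, add_smul, Finset.sum_add_distrib,
        _root_.map_add, _root_.map_smul, LinearMap.add_apply, LinearMap.smul_apply,
        LinearMap.map_smul_of_tower, smul_add, smul_eq_mul, mul_smul, ← Finset.smul_sum,
        smul_comm (einstein covT x _ _)] <;>
      module
  have hv : ∀ m, einsteinAct covT σ φ x (f.vec m x)
      = f.spin x (frameEinsteinAct ρ.gen (f.riem covT x) (fun a => c a x) m) := by
    intro m
    have b1 : IsBilinearMap ℝ (fun l l' => einstein covT x (f.vec m x) l • φ x l') := by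
      constructor <;> intros <;>
        simp only [hE.add_right, hE.smul_right, h.map_add hx, h.map_smul hx, smul_eq_mul] <;> module
    have b2 : ∀ a a', IsBilinearMap ℝ (fun l l' =>
        einstein covT x a l • σ.gam x a' (σ.gam x (f.vec m x) (φ x l'))) := by
      intro a a'
      constructor <;> intros <;>
        simp only [hE.add_right, hE.smul_right, h.map_add hx, h.map_smul hx, smul_eq_mul,
          _root_.map_add, LinearMap.map_smul_of_tower] <;> module
    have b3 : IsBilinearMap ℝ (fun a a' => contr x (fun l l' =>
        einstein covT x a l • σ.gam x a' (σ.gam x (f.vec m x) (φ x l')))) := by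
      constructor <;> intros <;>
        simp only [contr, hE.add_left, hE.smul_left, add_smul, Finset.sum_add_distrib,
          _root_.map_add, _root_.map_smul, LinearMap.add_apply, LinearMap.smul_apply, smul_add,
          smul_eq_mul, mul_smul, ← Finset.smul_sum, smul_comm (einstein covT x _ _)]
    rw [einsteinAct, f.contr_eq hx b1, f.contr_eq hx b3]
    simp only [f.contr_eq hx (b2 _ _), h.apply_vec hx, einstein_vec hT hx, gam_vec hf hx,
      ← spin_real_smul, ← map_sum, ← map_sub]
    rfl
  refine (sum_inner_smul_map hx hl.mk' v).symm.trans ?_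
  simp only [IsLinearMap.mk'_apply, hv, map_sum, spin_real_smul]

lemma weylAct_eq (h : f.HasComponents φ c) (hf : f ∈ σ.atlas) (hx : x ∈ f.dom)
    (v : TangentSpace (𝓡 n) x) :
    weylAct covT σ φ x v = f.spin x (∑ m, (inner ℝ v (f.vec m x) : ℝ) •
      frameWeylAct ρ.gen (f.riem covT x) (fun a => c a x) m) := by
  have hW := fun k l => isBilinearMap_weyl_left hT (x := x) k l
  have hW' := fun a b => isBilinearMap_weyl_right hT (x := x) a b
  have hl : IsLinearMap ℝ (weylAct covT σ φ x) := by
    constructor <;> intros <;>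
      simp only [weylAct, contr, (hW' _ _).add_right, (hW' _ _).smul_right, add_smul,
        Finset.sum_add_distrib, smul_eq_mul, mul_smul, ← Finset.smul_sum]
  have hv : ∀ m, weylAct covT σ φ x (f.vec m x)
      = f.spin x (frameWeylAct ρ.gen (f.riem covT x) (fun a => c a x) m) := by
    intro m
    have b1 : ∀ a a' b b', IsBilinearMap ℝ (fun l l' =>
        weyl covT x a b l (f.vec m x) • σ.gam x a' (σ.gam x b' (φ x l'))) := by
      intro a a' b b'
      constructor <;> intros <;>
        simp only [(hW' _ _).add_left, (hW' _ _).smul_left, h.map_add hx, h.map_smul hx,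
            smul_eq_mul,
          _root_.map_add, LinearMap.map_smul_of_tower] <;> module
    have b2 : ∀ a a', IsBilinearMap ℝ (fun b b' => contr x (fun l l' =>
        weyl covT x a b l (f.vec m x) • σ.gam x a' (σ.gam x b' (φ x l')))) := by
      intro a a'
      constructor <;> intros <;>
        simp only [contr, (hW _ _).add_right, (hW _ _).smul_right, add_smul, Finset.sum_add_distrib,
          _root_.map_add, _root_.map_smul, LinearMap.add_apply, LinearMap.smul_apply, smul_add,
          LinearMap.map_smul_of_tower, smul_eq_mul, mul_smul, ← Finset.smul_sum,
          smul_comm (weyl covT x _ _ _ _)]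
    have b3 : IsBilinearMap ℝ (fun a a' => contr x (fun b b' => contr x (fun l l' =>
        weyl covT x a b l (f.vec m x) • σ.gam x a' (σ.gam x b' (φ x l'))))) := by
      constructor <;> intros <;>
        simp only [contr, (hW _ _).add_left, (hW _ _).smul_left, add_smul, Finset.sum_add_distrib,
          _root_.map_add, _root_.map_smul, LinearMap.add_apply, LinearMap.smul_apply, smul_add,
          smul_eq_mul, mul_smul, ← Finset.smul_sum, smul_comm (weyl covT x _ _ _ _)]
    rw [weylAct, f.contr_eq hx b3]
    simp only [f.contr_eq hx (b2 _ _)]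
    simp only [f.contr_eq hx (b1 _ _ _ _), h.apply_vec hx, weyl_vec hT hx,
      gam_vec hf hx, ← spin_real_smul, ← map_sum]
    rfl
  refine (sum_inner_smul_map hx hl.mk' v).symm.trans ?_
  simp only [IsLinearMap.mk'_apply, hv, map_sum, spin_real_smul]

end SpinFrame
end CurvatureActions
end SpinGeom

namespace SpinGeom

open scoped Topology

section FormalAdjoint

variable {n : ℕ}
  {M : Type*} [TopologicalSpace M] [ChartedSpace (EuclideanSpace ℝ (Fin n)) M]
  [IsManifold (𝓡 n) ∞ M]
  [RiemannianBundle (fun x : M => TangentSpace (𝓡 n) x)]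
  {Δ : Type*} [NormedAddCommGroup Δ] [InnerProductSpace ℂ Δ]
  {S : M → Type*} [∀ x, NormedAddCommGroup (S x)] [∀ x, InnerProductSpace ℂ (S x)]
  [TopologicalSpace (TotalSpace Δ S)] [FiberBundle Δ S]

/-! ### Formal adjoints -/

section Pairing

/-- The real part of a Hermitian inner product, as a bilinear map. -/
noncomputable def rePair (V : Type*) [NormedAddCommGroup V] [InnerProductSpace ℂ V] :
    V →ₗ[ℝ] V →ₗ[ℝ] ℝ :=
  LinearMap.mk₂ ℝ (fun ψ χ => (inner ℂ ψ χ).re)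
    (fun ψ ψ' χ => by rw [inner_add_left, Complex.add_re])
    (fun r ψ χ => by
      rw [← Complex.coe_smul, inner_smul_left, Complex.conj_ofReal, Complex.re_ofReal_mul,
          smul_eq_mul])
    (fun ψ χ χ' => by rw [inner_add_right, Complex.add_re])
    (fun r ψ χ => by
      rw [← Complex.coe_smul, inner_smul_right, Complex.re_ofReal_mul, smul_eq_mul])

lemma rePair_apply {V : Type*} [NormedAddCommGroup V] [InnerProductSpace ℂ V] (ψ χ : V) :
    rePair V ψ χ = (inner ℂ ψ χ).re := rfl

end Pairing

namespace SpinFrame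

variable {f : SpinFrame n M Δ S} {x : M}

lemma rePair_spin (ψ χ : Δ) : rePair (S x) (f.spin x ψ) (f.spin x χ) = rePair Δ ψ χ := by
  rw [rePair_apply, rePair_apply, (f.spin x).inner_map_map]

/-- Moving two skew operators across the pairing reverses their order; relabelling the indices of
the skew matrix then gives the sign. -/
lemma rePair_skewSpin {ρ : SpinorModule n Δ} {A : Fin n → Fin n → ℝ} (hA : ∀ a b, A a b = -A b a)
    (ψ χ : Δ) : rePair Δ (skewSpin ρ.gen A ψ) χ = -rePair Δ ψ (skewSpin ρ.gen A χ) := by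
  have h : ∀ a b, rePair Δ (ρ.gen a (ρ.gen b ψ)) χ = rePair Δ ψ (ρ.gen b (ρ.gen a χ)) := by
    intro a b
    simp only [rePair_apply, ρ.re_inner_gen, neg_neg]
  have h2 : ∑ a, ∑ b, A a b * rePair Δ (ρ.gen a (ρ.gen b ψ)) χ
      = -∑ a, ∑ b, A a b * rePair Δ ψ (ρ.gen a (ρ.gen b χ)) := by
    simp only [h]
    rw [Finset.sum_comm]
    simp only [← Finset.sum_neg_distrib]
    refine Finset.sum_congr rfl fun a _ => Finset.sum_congr rfl fun b _ => ?_
    rw [hA b a]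
    ring
  simp only [skewSpin, LinearMap.smul_apply, LinearMap.sum_apply, Module.End.mul_apply, map_smul,
    map_sum, smul_eq_mul, h2]
  ring

lemma sum_rePair_frameProj {ρ : SpinorModule n Δ} (s : Summand) {Ψ Φ : Fin n → Fin n → Δ}
    (hΨ : ∀ a, ∑ b, ρ.gen b (Ψ a b) = 0) (hΦ : ∀ a, ∑ b, ρ.gen b (Φ a b) = 0) :
    ∑ a, ∑ b, rePair Δ (frameProj ρ.gen s Ψ a b) (Φ a b)
      = ∑ a, ∑ b, rePair Δ (Ψ a b) (frameProj ρ.gen s Φ a b) :=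
  -- The underlying real inner product of `Δ` is the real part of the Hermitian one, so the
  -- algebraic symmetry lemma applies to `rePair`.
  letI := InnerProductSpace.complexToReal (G := Δ)
  sum_inner_frameProj_comm ρ.isCliffordFamily_gen (fun a ψ χ => ρ.re_inner_gen a ψ χ) s hΨ hΦ

lemma contr_rePair (hx : x ∈ f.dom) {F G : TangentSpace (𝓡 n) x → S x} {p q : Fin n → Δ}
    (hF : ∀ v, F v = f.spin x (∑ b, (inner ℝ v (f.vec b x) : ℝ) • p b))
    (hG : ∀ v, G v = f.spin x (∑ b, (inner ℝ v (f.vec b x) : ℝ) • q b)) :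
    contr x (fun v v' => rePair (S x) (F v) (G v')) = ∑ b, rePair Δ (p b) (q b) := by
  classical
  have hB : IsBilinearMap ℝ (fun v v' => rePair (S x) (F v) (G v')) := by
    constructor <;> intros <;>
      simp only [hF, hG, inner_add_left, real_inner_smul_left, add_smul, mul_smul,
        Finset.sum_add_distrib, ← Finset.smul_sum, spin_real_smul, map_add, map_smul,
        LinearMap.add_apply, LinearMap.smul_apply]
  rw [f.contr_eq hx hB]
  simp only [hF, hG, f.inner_vec hx, ite_smul, one_smul, zero_smul, Finset.sum_ite_eq,
    Finset.mem_univ, if_true, rePair_spin]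

lemma contr_rePair₂ {F G : (x : M) → TangentSpace (𝓡 n) x → TangentSpace (𝓡 n) x → S x}
    {p q : Fin n → Fin n → M → Δ} (hF : f.HasComponents₂ F p) (hG : f.HasComponents₂ G q)
    (hx : x ∈ f.dom) :
    contr x (fun u u' => contr x (fun v v' => rePair (S x) (F x u v) (G x u' v')))
      = ∑ a, ∑ b, rePair Δ (p a b x) (q a b x) := by
  have hF' := hF.isBilinearMap hx
  have hG' := hG.isBilinearMap hx
  have hB : IsBilinearMap ℝ
      (fun u u' => contr x (fun v v' => rePair (S x) (F x u v) (G x u' v'))) := by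
    constructor <;> intros <;>
      simp only [contr, hF'.add_left, hF'.smul_left, hG'.add_left, hG'.smul_left, map_add, map_smul,
        LinearMap.add_apply, LinearMap.smul_apply, Finset.sum_add_distrib, ← Finset.smul_sum]
  rw [f.contr_eq hx hB]
  exact Finset.sum_congr rfl fun a _ => contr_rePair hx ((hF.hasComponents a).apply x hx)
    ((hG.hasComponents a).apply x hx)

lemma isTwistorAt_of_apply {ρ : SpinorModule n Δ} {σ : SpinStructure (M := M) ρ S}
    (hf : f ∈ σ.atlas)
    (hx : x ∈ f.dom) {F : TangentSpace (𝓡 n) x → S x} {p : Fin n → Δ}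
    (hF : ∀ v, F v = f.spin x (∑ b, (inner ℝ v (f.vec b x) : ℝ) • p b))
    (hp : ∑ a, ρ.gen a (p a) = 0) : IsTwistorAt σ x F := by
  classical
  have hB : IsBilinearMap ℝ (fun u v => σ.gam x u (F v)) := by
    constructor <;> intros <;>
      simp only [hF, inner_add_left, real_inner_smul_left, add_smul, mul_smul,
        Finset.sum_add_distrib, ← Finset.smul_sum, spin_real_smul, map_add, map_smul,
        LinearMap.add_apply, LinearMap.smul_apply, LinearMap.map_smul_of_tower]
  rw [IsTwistorAt, f.contr_eq hx hB]
  simp only [hF, f.inner_vec hx, ite_smul, one_smul, zero_smul, Finset.sum_ite_eq,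
    Finset.mem_univ, if_true, gam_vec hf hx, ← map_sum, hp, map_zero]

section Leibniz

variable [FiniteDimensional ℂ Δ] {p q : M → Δ}

/-- A finite sum of products of real functionals reduces smoothness and the Leibniz rule for the
pairing to those of scalar functions. -/
lemma exists_rePair_expansion (Δ : Type*) [NormedAddCommGroup Δ] [InnerProductSpace ℂ Δ]
    [FiniteDimensional ℂ Δ] : ∃ (ι : Type) (_ : Fintype ι) (L L' : ι → Δ →L[ℝ] ℝ),
      ∀ ψ χ, rePair Δ ψ χ = ∑ i, L i ψ • L' i χ := by
  obtain ⟨ι, hι, b, L, hL⟩ := exists_coord_clm Δ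
  refine ⟨ι, hι, L, fun i => LinearMap.toContinuousLinearMap (rePair Δ (b i)), fun ψ χ => ?_⟩
  conv_lhs => rw [← hL ψ]
  simp only [map_sum, map_smul, LinearMap.sum_apply, LinearMap.smul_apply]
  rfl

omit [IsManifold (𝓡 n) ∞ M] [RiemannianBundle (fun x : M => TangentSpace (𝓡 n) x)] in
lemma mvfderiv_rePair (hp : DiffFunAt n p x) (hq : DiffFunAt n q x) (u : TangentSpace (𝓡 n) x) :
    DiffFunAt n (fun y => rePair Δ (p y) (q y)) x ∧
    mvfderiv (𝓡 n) (fun y => rePair Δ (p y) (q y)) x u =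
      rePair Δ (mvfderiv (𝓡 n) p x u) (q x) + rePair Δ (p x) (mvfderiv (𝓡 n) q x u) := by
  obtain ⟨ι, _, L, L', h⟩ := exists_rePair_expansion Δ
  simp only [h]
  refine ⟨(mvfderiv_sum (g := fun i y => L i (p y) • L' i (q y)) Finset.univ fun i _ =>
    (hp.clm_apply (L i)).smul (hq.clm_apply (L' i))).2, ?_⟩
  rw [mvfderiv_sum_smul _ (fun i _ => hp.clm_apply (L i)) (fun i _ => hq.clm_apply (L' i)),
    ← Finset.sum_add_distrib]
  simp only [mvfderiv_clm_apply (L _) hp, mvfderiv_clm_apply (L' _) hq]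

omit [IsManifold (𝓡 n) ∞ M] [RiemannianBundle (fun x : M => TangentSpace (𝓡 n) x)] in
lemma smoothFun_rePair {U : Set M} (hp : SmoothFun n U p) (hq : SmoothFun n U q) :
    SmoothFun n U (fun y => rePair Δ (p y) (q y)) := by
  obtain ⟨ι, _, L, L', h⟩ := exists_rePair_expansion Δ
  simp only [h]
  exact SmoothFun.sum fun i => (hp.clm_apply (L i)).smul (hq.clm_apply (L' i))

end Leibniz

section Divergence

variable {covT : CovariantDerivative (𝓡 n) (EuclideanSpace ℝ (Fin n))
  (fun x : M => TangentSpace (𝓡 n) x)} {ρ : SpinorModule n Δ}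
  [IsContMDiffRiemannianBundle (𝓡 n) ∞ (EuclideanSpace ℝ (Fin n))
      (fun x : M => TangentSpace (𝓡 n) x)]
  (hT : IsLeviCivita covT)
include hT

lemma divergence_eq (hx : x ∈ f.dom) {X : (x : M) → TangentSpace (𝓡 n) x} {ξ : Fin n → M → ℝ}
    (hξ : ∀ a, SmoothFun n f.dom (ξ a)) (hX : ∀ y ∈ f.dom, X y = ∑ a, ξ a y • f.vec a y) :
    divergence covT X x = ∑ a, (mvfderiv (𝓡 n) (ξ a) x (f.vec a x)
      + ∑ b, ξ b x * f.conn covT x (f.vec a x) b a) := by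
  classical
  have hXs : DiffFieldAt X x := by
    have h : SmoothField f.dom (fun y => ∑ a, ξ a y • f.vec a y) :=
      ContMDiffOn.sum_section fun a _ => (hξ a).smul_section (f.smooth a)
    refine (h.diffAt f.isOpen_dom hx).congr_of_eventuallyEq ?_
    filter_upwards [f.isOpen_dom.mem_nhds hx] with y hy
    rw [hX y hy]
  have hB : IsBilinearMap ℝ (fun u v => (inner ℝ (covT X x u) v : ℝ)) := by
    constructor <;> intros <;>
      simp only [map_add, map_smul, inner_add_left, inner_add_right, real_inner_smul_left,
        real_inner_smul_right, smul_eq_mul]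
  have hXa : ∀ y ∈ f.dom, ∀ a, (inner ℝ (X y) (f.vec a y) : ℝ) = ξ a y := by
    intro y hy a
    simp only [hX y hy, sum_inner, real_inner_smul_left, f.inner_vec hy, mul_ite, mul_one, mul_zero,
      Finset.sum_ite_eq', Finset.mem_univ, if_true]
  rw [divergence, f.contr_eq hx hB]
  refine Finset.sum_congr rfl fun a _ => ?_
  rw [inner_cov hT hx hXs]
  simp only [hXa x hx]
  rw [mvfderiv_congr (g' := ξ a)]
  filter_upwards [f.isOpen_dom.mem_nhds hx] with y hy
  exact hXa y hy a

/-- The Leibniz rule for the pairing of a `1`-form with a `2`-tensor. -/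
lemma sum_rePair_nabla [FiniteDimensional ℂ Δ] (hx : x ∈ f.dom) {p : Fin n → M → Δ}
    {k : Fin n → Fin n → M → Δ}
    (hp : ∀ b, SmoothFun n f.dom (p b)) (hk : ∀ a b, SmoothFun n f.dom (k a b)) :
    ∑ a, ∑ b, rePair Δ (f.nabla covT ρ p x (f.vec a x) b) (k a b x)
      + ∑ a, ∑ b, rePair Δ (p b x) (f.nabla₂ covT ρ k x (f.vec a x) a b)
      = ∑ a, (mvfderiv (𝓡 n) (fun y => ∑ b, rePair Δ (p b y) (k a b y)) x (f.vec a x)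
      + ∑ d, (∑ b, rePair Δ (p b x) (k d b x)) * f.conn covT x (f.vec a x) d a) := by
  rw [← Finset.sum_add_distrib]
  refine Finset.sum_congr rfl fun a _ => ?_
  have hpx := fun b => (hp b).diffAt f.isOpen_dom hx
  have hkx := fun a b => (hk a b).diffAt f.isOpen_dom hx
  set u := f.vec a x
  have hω := conn_skew hT hx u
  rw [(mvfderiv_sum Finset.univ fun b _ => (mvfderiv_rePair (hpx b) (hkx a b) u).1).1, sum_apply]
  simp only [(mvfderiv_rePair (hpx _) (hkx a _) u).2]
  -- The connection terms on spinors cancel by skewness (`h1`), as do those on the contracted index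
  -- `b` (`h2`). Those on the index `a` remain and form the connection part of the divergence
  -- (`h3`).
  have h1 : ∀ b, rePair Δ (f.spinConn covT ρ x u (p b x)) (k a b x)
      = -rePair Δ (p b x) (f.spinConn covT ρ x u (k a b x)) := fun b => rePair_skewSpin hω _ _
  have h2 : ∑ b, ∑ d, f.conn covT x u b d * rePair Δ (p d x) (k a b x)
      = -∑ b, ∑ d, f.conn covT x u b d * rePair Δ (p b x) (k a d x) := by
    rw [Finset.sum_comm]
    simp only [← Finset.sum_neg_distrib]
    refine Finset.sum_congr rfl fun b _ => Finset.sum_congr rfl fun d _ => ?_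
    rw [hω d b]
    ring
  have h3 : ∑ d, (∑ b, rePair Δ (p b x) (k d b x)) * f.conn covT x u d a
      = -∑ b, ∑ d, f.conn covT x u a d * rePair Δ (p b x) (k d b x) := by
    rw [Finset.sum_comm (f := fun b d => f.conn covT x u a d * rePair Δ (p b x) (k d b x)),
      ← Finset.sum_neg_distrib]
    refine Finset.sum_congr rfl fun d _ => ?_
    rw [hω d a, ← Finset.mul_sum]
    ring
  rw [h3]
  simp only [nabla, nabla₂, spinDer, map_sub, map_add, map_sum, map_smul, LinearMap.sub_apply,
    LinearMap.add_apply, LinearMap.sum_apply, LinearMap.smul_apply, h1, Finset.sum_add_distrib,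
    Finset.sum_sub_distrib, Finset.sum_neg_distrib, smul_eq_mul, h2]
  ring

end Divergence

end SpinFrame
end FormalAdjoint
end SpinGeom

namespace SpinGeom

open scoped Topology

/-! ### The formal adjoints and the Weitzenböck formulas on the manifold -/

section Main

variable {n : ℕ}
  {M : Type*} [TopologicalSpace M] [T2Space M] [ChartedSpace (EuclideanSpace ℝ (Fin n)) M]
  [IsManifold (𝓡 n) ∞ M]
  [RiemannianBundle (fun x : M => TangentSpace (𝓡 n) x)]
  [IsContMDiffRiemannianBundle (𝓡 n) ∞ (EuclideanSpace ℝ (Fin n))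
    (fun x : M => TangentSpace (𝓡 n) x)]
  {Δ : Type*} [NormedAddCommGroup Δ] [InnerProductSpace ℂ Δ] [FiniteDimensional ℂ Δ]
  {ρ : SpinorModule n Δ}
  {S : M → Type*} [∀ x, NormedAddCommGroup (S x)] [∀ x, InnerProductSpace ℂ (S x)]
  [TopologicalSpace (TotalSpace Δ S)] [FiberBundle Δ S] [VectorBundle ℝ Δ S]
  [ContMDiffVectorBundle ∞ Δ S (𝓡 n)] {σ : SpinStructure (M := M) ρ S}
  {covT : CovariantDerivative (𝓡 n) (EuclideanSpace ℝ (Fin n))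
    (fun x : M => TangentSpace (𝓡 n) x)} (hT : IsLeviCivita covT)
  {covS : CovariantDerivative (𝓡 n) Δ S} (hS : IsSpinConnection σ covT covS)

/-- The vector field `X_α = Re ⟨φ_β, Ψ_α^β⟩`. -/
noncomputable def pairField (φ : (x : M) → TangentSpace (𝓡 n) x → S x)
    (Ψ : (x : M) → TangentSpace (𝓡 n) x → TangentSpace (𝓡 n) x → S x) (x : M) :
    TangentSpace (𝓡 n) x :=
  contr x fun u u' => contr x (fun v v' => rePair (S x) (φ x v) (Ψ x u v')) • u'

namespace SpinFrame

variable {f : SpinFrame n M Δ S} {x : M}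

omit [T2Space M] [IsContMDiffRiemannianBundle (𝓡 n) ∞ (EuclideanSpace ℝ (Fin n))
    (fun x : M => TangentSpace (𝓡 n) x)] [FiniteDimensional ℂ Δ] [VectorBundle ℝ Δ S]
  [ContMDiffVectorBundle ∞ Δ S (𝓡 n)] in
lemma pairField_eq {φ : (x : M) → TangentSpace (𝓡 n) x → S x}
    {Ψ : (x : M) → TangentSpace (𝓡 n) x → TangentSpace (𝓡 n) x → S x} {p : Fin n → M → Δ}
    {k : Fin n → Fin n → M → Δ} (hφ : f.HasComponents φ p) (hΨ : f.HasComponents₂ Ψ k)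
    (hx : x ∈ f.dom) :
    pairField φ Ψ x = ∑ a, (∑ b, rePair Δ (p b x) (k a b x)) • f.vec a x := by
  have hB : IsBilinearMap ℝ (fun u u' => contr x (fun v v' =>
      rePair (S x) (φ x v) (Ψ x u v')) • (u' : TangentSpace (𝓡 n) x)) := by
    have h := hΨ.isBilinearMap hx
    constructor <;> intros <;>
      simp only [contr, h.add_left, h.smul_left, map_add, map_smul, Finset.sum_add_distrib,
        ← Finset.mul_sum, add_smul, smul_add, smul_eq_mul, mul_smul]
    rw [smul_comm]
  rw [pairField, f.contr_eq hx hB]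
  refine Finset.sum_congr rfl fun a _ => ?_
  rw [contr_rePair hx (hφ.apply x hx) ((hΨ.hasComponents a).apply x hx)]

end SpinFrame

open SpinFrame

include hT hS

omit [T2Space M] in
-- The components of `∇Φ` still satisfy the twistor condition in the last index, so each summand of
-- the divergence is a projection of such a tensor and is a twistor in its free index.
lemma isTwistorAt_gradAdj (hn : 3 ≤ n) (s : Summand)
    {Φ : (x : M) → TangentSpace (𝓡 n) x →L[ℝ] TangentSpace (𝓡 n) x →L[ℝ] S x}
    (hΦ : IsSmoothTwo Δ Φ) (hΦt : ∀ x u, IsTwistorAt σ x (Φ x u)) (x : M) :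
    IsTwistorAt σ x (gradAdj covT covS σ s (fun y u v => Φ y u v) x) := by
  obtain ⟨f, hf, hx⟩ := σ.cover x
  have hc := f.hasComponents₂ hΦ
  have ht : ∀ a, ∀ y ∈ f.dom, ∑ b, ρ.gen b (f.components₂ (fun y u v => Φ y u v) a b y) = 0 :=
    fun a y hy => (isTwistorAt_iff hf hy (hc.hasComponents a)).1 (hΦt y _)
  refine isTwistorAt_of_apply hf hx (gradAdj_eq hT hS hf hx hc s) ?_
  simp only [frameLap, map_neg, map_sum, Finset.sum_neg_distrib, neg_eq_zero]
  rw [Finset.sum_comm]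
  refine Finset.sum_eq_zero fun a _ => ρ.isCliffordFamily_gen.sum_frameProj hn (fun d => ?_) s a
  exact sum_gen_nabla₂ hT hx (fun a b => (hc.smooth a b).diffAt f.isOpen_dom hx) ht _ d

theorem isFormalAdjoint_gradAdj (hn : 3 ≤ n) (s : Summand) :
    IsFormalAdjoint covT σ (grad covT covS σ s) (gradAdj covT covS σ s) := by
  refine fun Φ hΦ hΦt => ⟨isTwistorAt_gradAdj hT hS hn s hΦ hΦt, fun φ hφ hφt => ?_⟩
  have hp := fun f : SpinFrame n M Δ S => f.hasComponents hφ
  have hc := fun f : SpinFrame n M Δ S => f.hasComponents₂ hΦ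
  have hk := fun (f : SpinFrame n M Δ S) (hf : f ∈ σ.atlas) => (hc f).proj hf s
  have hξ : ∀ f ∈ σ.atlas, ∀ a, SmoothFun n f.dom (fun y => ∑ b,
      rePair Δ (f.components (fun y v => φ y v) b y)
        (frameProj ρ.gen s (fun a b => f.components₂ (fun y u v => Φ y u v) a b y) a b)) :=
    fun f hf a => SmoothFun.sum fun b => smoothFun_rePair ((hp f).smooth b) ((hk f hf).smooth a b)
  have hX := fun (f : SpinFrame n M Δ S) (hf : f ∈ σ.atlas) (y : M) (hy : y ∈ f.dom) =>
    pairField_eq (hp f) (hk f hf) hy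
  -- The field pairs `φ` with the projected tensor rather than with `Φ`: by symmetry of the
  -- projection, `⟨P∇φ, Φ⟩ = ⟨∇φ, PΦ⟩`, and the Leibniz rule applies to the latter.
  refine ⟨pairField (fun y v => φ y v) (proj σ s fun y u v => Φ y u v), fun x => ?_, fun x h0 => ?_,
    fun x => ?_⟩
  · obtain ⟨f, hf, hx⟩ := σ.cover x
    have h : SmoothField f.dom (fun y => ∑ a, (∑ b, rePair Δ (f.components (fun y v => φ y v) b y)
        (frameProj ρ.gen s (fun a b => f.components₂ (fun y u v => Φ y u v) a b y) a b))
          • f.vec a y) :=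
      ContMDiffOn.sum_section fun a _ => (hξ f hf a).smul_section (f.smooth a)
    refine (h.contMDiffAt (f.isOpen_dom.mem_nhds hx)).congr_of_eventuallyEq ?_
    filter_upwards [f.isOpen_dom.mem_nhds hx] with y hy
    rw [hX f hf y hy]
  · obtain ⟨f, hf, hx⟩ := σ.cover x
    rw [hX f hf x hx]
    refine Finset.sum_eq_zero fun a _ => ?_
    rcases h0 with h0 | h0
    · simp [components, h0]
    · have h1 : (fun a b => f.components₂ (fun y u v => Φ y u v) a b x) = 0 := by
        ext a b
        simp [components₂, h0]
      have h2 : ∀ a b, frameProj ρ.gen s 0 a b = 0 := fun a b => (frameProjₗ ρ.gen s a b).map_zero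
      simp [h1, h2]
  · obtain ⟨f, hf, hx⟩ := σ.cover x
    have ht : ∀ a, ∀ y ∈ f.dom, ∑ b, ρ.gen b (f.components₂ (fun y u v => Φ y u v) a b y) = 0 :=
      fun a y hy => (isTwistorAt_iff hf hy ((hc f).hasComponents a)).1 (hΦt y _)
    have htp : ∀ y ∈ f.dom, ∑ b, ρ.gen b (f.components (fun y v => φ y v) b y) = 0 :=
      fun y hy => (isTwistorAt_iff hf hy (hp f)).1 (hφt y)
    have hN := hasComponents₂_nablaOne hT hS hf (hp f)
    have e1 := contr_rePair₂ (hN.proj hf s) (hc f) hx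
    have e2 := contr_rePair hx ((hp f).apply x hx) (gradAdj_eq hT hS hf hx (hc f) s)
    -- Moving the projection from `∇φ` to `Φ` requires both to be twistor-valued; for `∇φ` this is
    -- the parallelism of the twistor bundle.
    rw [sum_rePair_frameProj s (fun a => sum_gen_nabla hT hx
      (fun b => ((hp f).smooth b).diffAt f.isOpen_dom hx) htp _) (fun a => ht a x hx)] at e1
    have e3 := sum_rePair_nabla (ρ := ρ) hT hx (hp f).smooth (hk f hf).smooth
    rw [divergence_eq hT hx (hξ f hf) (hX f hf), ← e3]
    refine (congrArg₂ (· - ·) e1 e2).trans ?_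
    simp only [frameLap, nabla₂_frameProj hT hx (hc f).smooth, map_neg, map_sum,
      Finset.sum_neg_distrib, sub_neg_eq_add]
    rw [Finset.sum_comm (f := fun b a => rePair Δ (f.components (fun y v => φ y v) b x) _)]

theorem weitzenboeck (hn : 3 ≤ n)
    {φ : (x : M) → TangentSpace (𝓡 n) x →L[ℝ] S x} (hφ : IsSmoothOne Δ φ)
    (hφt : ∀ x, IsTwistorAt σ x (φ x)) (x : M) (v : TangentSpace (𝓡 n) x) :
    letI ψ : (y : M) → TangentSpace (𝓡 n) y → S y := fun y w => φ y w
    letI GG : Summand → S x := fun s => gradAdj covT covS σ s (grad covT covS σ s ψ) x v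
    letI N : ℝ := n
    ((N - 3) * (N - 2) / (2 * N)) • GG .S - ((N + 2) * (N - 3) / (2 * N)) • GG .T + GG .Y
        = (1 / 8 : ℝ) • weylAct covT σ ψ x v
          + ((N - 3) / (2 * (N - 2))) • einsteinAct covT σ ψ x v
          - ((N - 2) * (N - 3) / (8 * N * (N - 1)) * scal covT x) • φ x v ∧
    -((N - 1) * (N + 2) / (2 * N)) • GG .S - ((N + 1) * (N - 2) / (2 * N)) • GG .T + GG .Z
        = (3 / 8 : ℝ) • weylAct covT σ ψ x v
          - ((N + 1) / (2 * (N - 2))) • einsteinAct covT σ ψ x v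
          - ((N + 2) * (N + 1) / (8 * N * (N - 1)) * scal covT x) • φ x v := by
  have : NeZero n := ⟨by omega⟩
  obtain ⟨f, hf, hx⟩ := σ.cover x
  have hp := f.hasComponents hφ
  have htp : ∀ y ∈ f.dom, ∑ b, ρ.gen b (f.components (fun y v => φ y v) b y) = 0 :=
    fun y hy => (isTwistorAt_iff hf hy hp).1 (hφt y)
  have hN := hasComponents₂_nablaOne hT hS hf hp
  -- The second derivative of `φ` is a twistor in its last index, which is the condition under which
  -- the projections are idempotent.
  have hH : ∀ d a, ∑ b, ρ.gen b (f.nabla₂ covT ρ (fun a b y =>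
      f.nabla covT ρ (f.components fun y v => φ y v) y (f.vec a y) b) x (f.vec d x) a b) = 0 :=
    fun d a => sum_gen_nabla₂ hT hx (fun a b => (hN.smooth a b).diffAt f.isOpen_dom hx)
      (fun a y hy => sum_gen_nabla hT hy
        (fun b => (hp.smooth b).diffAt f.isOpen_dom hy) htp _) _ a
  -- In `G_s* G_s` the projection occurs twice. Parallelism brings both copies in front of the
  -- second derivative, where idempotence merges them.
  have hG : ∀ s, gradAdj covT covS σ s (grad covT covS σ s fun y w => φ y w) x v
      = f.spin x (∑ b, (inner ℝ v (f.vec b x) : ℝ) • frameLap ρ.gen (fun d a b =>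
          f.nabla₂ covT ρ (fun a b y => f.nabla covT ρ (f.components fun y v => φ y v) y
            (f.vec a y) b) x (f.vec d x) a b) s b) := fun s => by
    rw [grad, gradAdj_eq hT hS hf hx (hN.proj hf s)]
    simp only [frameLap, nabla₂_frameProj hT hx hN.smooth,
      ρ.isCliffordFamily_gen.frameProj_frameProj hn (hH _)]
  have key := frameLap_weitzenboeck hn ρ.isCliffordFamily_gen (isCurvatureLike_riem hT x)
    (htp x hx) (nabla₂_nabla_sub hT hx hp.smooth)
  simp only [hG, weylAct_eq hT hp hf hx v, einsteinAct_eq hT hp hf hx v, scal_eq hT hx,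
    hp.apply x hx v, ← spin_real_smul, ← map_add, ← map_sub, Finset.smul_sum,
    smul_comm _ (inner ℝ v (f.vec _ x) : ℝ), ← smul_add, ← smul_sub, ← Finset.sum_add_distrib,
    ← Finset.sum_sub_distrib]
  refine ⟨congrArg _ (Finset.sum_congr rfl fun b _ => ?_),
    congrArg _ (Finset.sum_congr rfl fun b _ => ?_)⟩
  · rw [(key b).1]
  · rw [(key b).2]

end Main
end SpinGeom

theorem theorem5p1 {n : ℕ} (hn : 3 ≤ n)
    {M : Type*} [TopologicalSpace M] [T2Space M] [SecondCountableTopology M]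
    [ChartedSpace (EuclideanSpace ℝ (Fin n)) M] [IsManifold (𝓡 n) ∞ M]
    [RiemannianBundle (fun x : M => TangentSpace (𝓡 n) x)]
    [IsContMDiffRiemannianBundle (𝓡 n) ∞ (EuclideanSpace ℝ (Fin n))
      (fun x : M => TangentSpace (𝓡 n) x)]
    {Δ : Type*} [NormedAddCommGroup Δ] [InnerProductSpace ℂ Δ] [FiniteDimensional ℂ Δ]
    (ρ : SpinGeom.SpinorModule n Δ)
    {S : M → Type*} [∀ x, NormedAddCommGroup (S x)] [∀ x, InnerProductSpace ℂ (S x)]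
    [TopologicalSpace (TotalSpace Δ S)] [FiberBundle Δ S] [VectorBundle ℝ Δ S]
    [ContMDiffVectorBundle ∞ Δ S (𝓡 n)]
    (σ : SpinGeom.SpinStructure (M := M) ρ S)
    (covT : CovariantDerivative (𝓡 n) (EuclideanSpace ℝ (Fin n))
      (fun x : M => TangentSpace (𝓡 n) x))
    (hT : SpinGeom.IsLeviCivita covT)
    (covS : CovariantDerivative (𝓡 n) Δ S)
    (hS : SpinGeom.IsSpinConnection σ covT covS) :
    (∀ s : SpinGeom.Summand,
      SpinGeom.IsFormalAdjoint covT σ (SpinGeom.grad covT covS σ s)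
        (SpinGeom.gradAdj covT covS σ s)) ∧
    ∀ φ : (x : M) → TangentSpace (𝓡 n) x →L[ℝ] S x,
      SpinGeom.IsSmoothOne Δ φ → (∀ x, SpinGeom.IsTwistorAt σ x (φ x)) →
      ∀ (x : M) (v : TangentSpace (𝓡 n) x),
        letI ψ : (y : M) → TangentSpace (𝓡 n) y → S y := fun y w => φ y w
        letI GG : SpinGeom.Summand → S x := fun s =>
          SpinGeom.gradAdj covT covS σ s (SpinGeom.grad covT covS σ s ψ) x v
        letI N : ℝ := n
        ((N - 3) * (N - 2) / (2 * N)) • GG .S - ((N + 2) * (N - 3) / (2 * N)) • GG .T + GG .Y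
            = (1 / 8 : ℝ) • SpinGeom.weylAct covT σ ψ x v
              + ((N - 3) / (2 * (N - 2))) • SpinGeom.einsteinAct covT σ ψ x v
              - ((N - 2) * (N - 3) / (8 * N * (N - 1)) * SpinGeom.scal covT x) • φ x v ∧
        -((N - 1) * (N + 2) / (2 * N)) • GG .S - ((N + 1) * (N - 2) / (2 * N)) • GG .T + GG .Z
            = (3 / 8 : ℝ) • SpinGeom.weylAct covT σ ψ x v
              - ((N + 1) / (2 * (N - 2))) • SpinGeom.einsteinAct covT σ ψ x v
              - ((N + 2) * (N + 1) / (8 * N * (N - 1)) * SpinGeom.scal covT x) • φ x v := by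
  refine ⟨fun s => SpinGeom.isFormalAdjoint_gradAdj hT hS hn s, fun φ hφ hφt x v => ?_⟩
  exact SpinGeom.weitzenboeck hT hS hn hφ hφt x v
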